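/- Let $d,m\in\mathbb N$. For $k\in\mathbb N$, let $H^k(\mathbb R^d)$ be the Sobolev space of real-valued functions in $L^2(\mathbb R^d)$ whose weak derivatives up to order $k$ lie in $L^2(\mathbb R^d)$, with norm $\|f\|_{H^k}=\sum_{|\alpha|\le k}\|D^\alpha f\|_{L^2}$, and let $C_b^k(\mathbb R^d)$ be the space of $C^k$ functions that are bounded together with their derivatives up to order $k$, with norm $\|v\|_{C_b^k}=\sum_{|\alpha|\le k}\|D^\alpha v\|_{L^\infty}$ (for matrix-valued $v$, the operator norm is used pointwise). There is a constant $C>0$, depending only on $d$ and $m$, such that the following holds. Let $T>0$, let $\rho_0\in H^m(\mathbb R^d)$ and $g\in L^1\bigl([0,T];H^m(\mathbb R^d)\bigr)$, and let $a:[0,T]\times\mathbb R^d\to\mathbb R^d$ be a vector field with $a\in L^1\bigl([0,T];C^{m+1}(\mathbb R^d)\bigr)$ and $\nabla a\in L^1\bigl([0,T];C_b^m(\mathbb R^d)\bigr)$. Here $f\in L^1([0,T];C^{k}(\mathbb R^d))$ means that $t\mapsto f(t,x)$ is measurable for every $x$, that $f(t,\cdot)\in C^k(\mathbb R^d)$ for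 a.e. $t$, and that $\int_0^T\sum_{|\alpha|\le k}\sup_{x\in K}|D^\alpha f(t,x)|\,dt<\infty$ for every compact $K\subset\mathbb R^d$; similarly, $f\in L^1([0,T];C_b^k(\mathbb R^d))$ means that $t\mapsto f(t,x)$ is measurable for every $x$, that $f(t,\cdot)\in C_b^k(\mathbb R^d)$ for a.e. $t$, and that $\int_0^T\|f(t)\|_{C_b^k}\,dt<\infty$. (In particular, $a$ may be unbounded, with at most linear growth in $x$.) Then there exists a unique $\rho\in C\bigl([0,T];H^m(\mathbb R^d)\bigr)$ that solves the Liouville problem $$\partial_t\rho+\operatorname{div}(a\,\rho)=g\quad\text{in }[0,T]\times\mathbb R^d,\qquad \rho_{|t=0}=\rho_0,$$ in the weak sense, that is, for all $\phi\in C_c^\infty\bigl([0,T[\,\times\mathbb R^d\bigr)$, $$-\int_0^T\!\!\int_{\mathbb R^d}\rho\,\partial_t\phi\,dx\,dt-\int_0^T\!\!\int_{\mathbb R^d}\rho\,a\cdot\nabla\phi\,dx\,dt=\int_0^T\!\!\int_{\mathbb R^d}g\,\phi\,dx\,dt+\int_{\mathbb R^d}\rho_0\,\phi(0,x)\,dx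 .$$ Moreover, for every $t\in[0,T]$, $$\|\rho(t)\|_{H^m}\le C\left(\|\rho_0\|_{H^m}+\int_0^t\|g(\tau)\|_{H^m}\,d\tau\right)\exp\left(C\int_0^t\|\nabla a(\tau)\|_{C_b^m}\,d\tau\right).$$ -/

import Mathlib

open MeasureTheory Set
open scoped ContDiff ENNReal

noncomputable section

namespace Liouville

/-- The space `ℝ^d` with its Euclidean norm. -/
abbrev Rd (d : ℕ) : Type := EuclideanSpace ℝ (Fin d)

section Derivatives

variable {d : ℕ} {F : Type*} [NormedAddCommGroup F] [NormedSpace ℝ F]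

/-- The classical partial derivative `∂_i f`. -/
def partialD (i : Fin d) (f : Rd d → F) : Rd d → F :=
  fun x => fderiv ℝ f x (EuclideanSpace.single i 1)

/-- The classical derivative `D^α f = ∂_0^{α_0} ∂_1^{α_1} ⋯ ∂_{d-1}^{α_{d-1}} f`. -/
def multiD (α : Fin d → ℕ) (f : Rd d → F) : Rd d → F :=
  (List.finRange d).foldr (fun i h => (partialD i)^[α i] h) f

/-- The multi-indices `α ∈ ℕ^d` with `|α| ≤ k`. Each entry is then at most `k`, which is built into
the type so that it is visibly finite. -/
abbrev MultiIndex (d k : ℕ) : Type :=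
  {α : Fin d → Fin (k + 1) // ∑ i, (α i : ℕ) ≤ k}

/-- The multi-index as a tuple of natural numbers. -/
def MultiIndex.toFun {k : ℕ} (α : MultiIndex d k) : Fin d → ℕ := fun i => (α.1 i : ℕ)

/-- The length `|α|`. -/
def MultiIndex.length {k : ℕ} (α : MultiIndex d k) : ℕ := ∑ i, α.toFun i

/-- The multi-index `0`. -/
def MultiIndex.zero (d k : ℕ) : MultiIndex d k := ⟨fun _ => 0, by simp⟩

lemma partialD_smooth_compact {i : Fin d} {f : Rd d → F}
    (hf : ContDiff ℝ ∞ f ∧ HasCompactSupport f) :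
    ContDiff ℝ ∞ (partialD i f) ∧ HasCompactSupport (partialD i f) := by
  refine ⟨(hf.1.fderiv_right (m := ∞) (by simp)).clm_apply contDiff_const, ?_⟩
  exact hf.2.fderiv_apply ℝ _

lemma multiD_smooth_compact (α : Fin d → ℕ) {f : Rd d → F}
    (hf : ContDiff ℝ ∞ f ∧ HasCompactSupport f) :
    ContDiff ℝ ∞ (multiD α f) ∧ HasCompactSupport (multiD α f) := by
  have hit : ∀ (i : Fin d) (n : ℕ) (h : Rd d → F), (ContDiff ℝ ∞ h ∧ HasCompactSupport h) →
      (ContDiff ℝ ∞ ((partialD i)^[n] h) ∧ HasCompactSupport ((partialD i)^[n] h)) := by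
    intro i n
    induction n with
    | zero => intro h hh; simpa using hh
    | succ n ih => intro h hh; exact ih _ (partialD_smooth_compact hh)
  unfold multiD
  induction List.finRange d with
  | nil => simpa using hf
  | cons i l ih => exact hit i (α i) _ ih

end Derivatives

section Sobolev

variable {d : ℕ}

lemma integrable_L2_mul_test (u : Lp ℝ 2 (volume : Measure (Rd d))) {ψ : Rd d → ℝ}
    (hψ : ContDiff ℝ ∞ ψ ∧ HasCompactSupport ψ) :
    Integrable (fun x => u x * ψ x) volume :=
  (Lp.memLp u).integrable_mul (q := 2)
    (hψ.1.continuous.memLp_of_hasCompactSupport hψ.2)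

/-- `v` is the weak derivative `D^α u`, for `u, v ∈ L²(ℝ^d)`. -/
def IsWeakDeriv {k : ℕ} (α : MultiIndex d k) (u v : Lp ℝ 2 (volume : Measure (Rd d))) : Prop :=
  ∀ φ : Rd d → ℝ, ContDiff ℝ ∞ φ → HasCompactSupport φ →
    ∫ x, u x * multiD α.toFun φ x = (-1) ^ α.length * ∫ x, v x * φ x

/-- The Sobolev space `H^m(ℝ^d)`: a function `u ∈ L²` together with its weak derivatives
`D^α u ∈ L²`, `|α| ≤ m`. The entry of index `0` is `u` itself, and it determines all the others, so
that this is the usual space of functions. The ambient `ℓ¹` sum provides the norm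
`‖u‖_{H^m} = ∑_{|α| ≤ m} ‖D^α u‖_{L²}`. -/
def sobolevSubmodule (d m : ℕ) :
    Submodule ℝ (PiLp 1 (fun _ : MultiIndex d m => Lp ℝ 2 (volume : Measure (Rd d)))) where
  carrier := {U | ∀ α, IsWeakDeriv α (U (MultiIndex.zero d m)) (U α)}
  zero_mem' := by
    intro α φ _ _
    have h : ((0 : Lp ℝ 2 (volume : Measure (Rd d))) : Rd d → ℝ) =ᵐ[volume] 0 := Lp.coeFn_zero _ _ _
    have h1 : ∀ ψ : Rd d → ℝ,
        ∫ x, (0 : Lp ℝ 2 (volume : Measure (Rd d))) x * ψ x = 0 := by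
      intro ψ
      rw [integral_congr_ae (g := fun _ => (0 : ℝ)) (by filter_upwards [h] with x hx; rw [hx]; simp)]
      simp
    simp only [PiLp.zero_apply, h1, mul_zero]
  add_mem' := by
    intro U V hU hV α φ hφ hc
    have key : ∀ (u v : Lp ℝ 2 (volume : Measure (Rd d))) (ψ : Rd d → ℝ),
        (ContDiff ℝ ∞ ψ ∧ HasCompactSupport ψ) →
        ∫ x, (u + v) x * ψ x = (∫ x, u x * ψ x) + ∫ x, v x * ψ x := by
      intro u v ψ hψ
      rw [← integral_add (integrable_L2_mul_test u hψ) (integrable_L2_mul_test v hψ)]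
      refine integral_congr_ae ?_
      filter_upwards [Lp.coeFn_add u v] with x hx
      rw [hx, Pi.add_apply, add_mul]
    simp only [PiLp.add_apply]
    rw [key _ _ _ (multiD_smooth_compact _ ⟨hφ, hc⟩), key _ _ _ ⟨hφ, hc⟩, hU α φ hφ hc,
      hV α φ hφ hc, mul_add]
  smul_mem' := by
    intro c U hU α φ hφ hc
    have key : ∀ (u : Lp ℝ 2 (volume : Measure (Rd d))) (ψ : Rd d → ℝ),
        ∫ x, (c • u) x * ψ x = c * ∫ x, u x * ψ x := by
      intro u ψ
      rw [← integral_const_mul]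
      refine integral_congr_ae ?_
      filter_upwards [Lp.coeFn_smul c u] with x hx
      rw [hx, Pi.smul_apply, smul_eq_mul, mul_assoc]
    simp only [PiLp.smul_apply]
    rw [key, key, hU α φ hφ hc]
    ring

/-- The normed space `H^m(ℝ^d)`. -/
abbrev Hm (d m : ℕ) : Type := sobolevSubmodule d m

/-- The function in `L²(ℝ^d)` underlying an element of `H^m(ℝ^d)`. -/
def Hm.toL2 {m : ℕ} (u : Hm d m) : Lp ℝ 2 (volume : Measure (Rd d)) :=
  u.1 (MultiIndex.zero d m)

end Sobolev

section Drift

variable {d : ℕ} {F : Type*} [NormedAddCommGroup F] [NormedSpace ℝ F]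

/-- `f ∈ C_b^k(ℝ^d)`. -/
def MemCb (k : ℕ) (f : Rd d → F) : Prop :=
  ContDiff ℝ k f ∧ ∀ α : MultiIndex d k, ∃ B : ℝ, ∀ x, ‖multiD α.toFun f x‖ ≤ B

/-- `‖f‖_{C_b^k} = ∑_{|α| ≤ k} sup_x |D^α f(x)|`, meaningful for `f ∈ C_b^k`. -/
def cbNorm (k : ℕ) (f : Rd d → F) : ℝ :=
  ∑ α : MultiIndex d k, ⨆ x, ‖multiD α.toFun f x‖

/-- The seminorm `∑_{|α| ≤ k} sup_{x ∈ K} |D^α f(x)|` of `C^k(ℝ^d)` attached to a compact `K`. -/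
def cSeminorm (k : ℕ) (K : Set (Rd d)) (f : Rd d → F) : ℝ :=
  ∑ α : MultiIndex d k, ⨆ x : K, ‖multiD α.toFun f x‖

/-- `f ∈ L¹([0,T]; C_b^k(ℝ^d))`. Measurability in time is only asked for at each point `x`; this is
implied by strong measurability of `t ↦ f(t)` in `C_b^k`. -/
def MemL1Cb (T : ℝ) (k : ℕ) (f : ℝ → Rd d → F) : Prop :=
  (∀ x, AEStronglyMeasurable (fun t => f t x) (volume.restrict (Icc 0 T))) ∧
  (∀ᵐ t ∂(volume.restrict (Icc 0 T)), MemCb k (f t)) ∧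
  IntegrableOn (fun t => cbNorm k (f t)) (Icc 0 T)

/-- `f ∈ L¹([0,T]; C^k(ℝ^d))`, where `C^k(ℝ^d)` has its Fréchet topology of uniform convergence on
compact sets of the derivatives up to order `k`. -/
def MemL1C (T : ℝ) (k : ℕ) (f : ℝ → Rd d → F) : Prop :=
  (∀ x, AEStronglyMeasurable (fun t => f t x) (volume.restrict (Icc 0 T))) ∧
  (∀ᵐ t ∂(volume.restrict (Icc 0 T)), ContDiff ℝ k (f t)) ∧
  ∀ K : Set (Rd d), IsCompact K → IntegrableOn (fun t => cSeminorm k K (f t)) (Icc 0 T)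

/-- The Jacobian `∇v` of a vector field, its values measured in the operator norm. -/
def jac (v : Rd d → Rd d) : Rd d → (Rd d →L[ℝ] Rd d) := fun x => fderiv ℝ v x

/-- The assumptions on the drift: `a ∈ L¹([0,T]; C^{m+1})` and `∇a ∈ L¹([0,T]; C_b^m)`. -/
def DriftHyp (T : ℝ) (m : ℕ) (a : ℝ → Rd d → Rd d) : Prop :=
  MemL1C T (m + 1) a ∧ MemL1Cb T m (fun t => jac (a t))

/-- Test functions in `C_c^∞([0,T[ × ℝ^d)`, given as restrictions to `t ≥ 0` of smooth compactly
supported functions on `ℝ × ℝ^d` whose support lies in `]-∞,T[ × ℝ^d`. -/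
def IsTestFunction (T : ℝ) (φ : ℝ × Rd d → ℝ) : Prop :=
  ContDiff ℝ ∞ φ ∧ HasCompactSupport φ ∧ tsupport φ ⊆ {p | p.1 < T}

/-- `ρ` is a weak solution on `[0,T]` of `∂_t ρ + div(a ρ) = g`, `ρ|_{t=0} = ρ₀`. The term
`fderiv ℝ (φ(t,·)) x (a t x)` is `a(t,x) · ∇φ(t,x)`. -/
def IsWeakSolution {m : ℕ} (T : ℝ) (a : ℝ → Rd d → Rd d) (g : ℝ → Hm d m) (ρ₀ : Hm d m)
    (ρ : ℝ → Hm d m) : Prop :=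
  ∀ φ : ℝ × Rd d → ℝ, IsTestFunction T φ →
    -(∫ t in (0 : ℝ)..T, ∫ x, (ρ t).toL2 x * deriv (fun s => φ (s, x)) t)
      - (∫ t in (0 : ℝ)..T, ∫ x, (ρ t).toL2 x * fderiv ℝ (fun y => φ (t, y)) x (a t x))
    = (∫ t in (0 : ℝ)..T, ∫ x, (g t).toL2 x * φ (t, x)) + ∫ x, ρ₀.toL2 x * φ (0, x)

end Drift

end Liouville

end

open MeasureTheory Set
open scoped ContDiff ENNReal

noncomputable section

namespace Liouville

/-! The proof is an energy method in Hilbert space. `H^m` is given the equivalent `ℓ²` norm (`HS`),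
so that inner products are available, and the drift is modified on a null set of times so that every
time slice is regular (`DriftHyp.exists_regularDrift`).

Existence. The unbounded operator `w ↦ -div(a w)` is replaced by bounded operators: `a` is truncated
at radius `n`, a mollification `J` is applied on both sides, and a scalar damping factor makes the
bound uniform in time. Each regularized equation is a linear ODE solved by Picard iteration
(`exists_linear_ode`). Since `J` is symmetric and commutes with derivatives, the pairing of the
regularized operator with `U` in `H^m` is the energy of `div(b w)` for the smooth `w = J U`. By
Leibniz' rule the only term with `m + 1` derivatives on `w` is a transport term, and integration by
parts leaves one derivative of `b` there; hence only derivatives of `b` of orders `1, …, m + 1`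
enter (`abs_energy_le`, `abs_inner_regOp_le`). The truncation costs little: `a` grows at most
linearly and the gradient of the cutoff is of size `1/n` where it lives, so the error caused by
`a(t,0)` is `O(1/n)`. Bounds uniform in `n`, with weak equicontinuity on a dense set of test
vectors, give a weakly convergent subsequence (`exists_weak_evolution`, `exists_evolution`).

Uniqueness. The difference of two solutions is truncated and mollified in `L²`; Friedrichs'
commutator estimate (`exists_commutator_bound`) bounds the energy of the result, and Grönwall
concludes (`eq_zero_of_solvesFrom`).

Strong continuity. The energy estimate holds in both time directions and from any initial time. By
uniqueness the solution is also the one restarted at `t₀`, so its norm is upper semicontinuous at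
`t₀`; with weak continuity this gives continuity in norm (`exists_continuous_evolution`).

Finally, the space-time weak formulation is shown to be equivalent to an equation integrated in time
(`weakForm_of_integrated`, `solvesFrom_of_weakForm`). All time dependence is merely integrable, and
a.e. differentiation is avoided: the product rule and Grönwall's inequality both rest on
`le_of_increment_le_sq`. -/

open Filter Topology

/-! ### Product rule and Grönwall inequality for primitives of integrable functions. -/

section Calculus

/-- A function whose increments are dominated by squares of increments of a continuous function
is nonincreasing. -/
lemma le_of_increment_le_sq {G V : ℝ → ℝ} {C : ℝ} (hV : Continuous V)
    (h : ∀ s t, s ≤ t → G t - G s ≤ C * (V t - V s) ^ 2) {s t : ℝ} (hst : s ≤ t) :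
    G t ≤ G s := by
  -- Splitting `[s, t]` where `V` takes its mean value leaves each half with a quarter of the
  -- square, so every bisection halves the bound.
  have key : ∀ n : ℕ, ∀ s t, s ≤ t → G t - G s ≤ C * (V t - V s) ^ 2 / 2 ^ n := by
    intro n
    induction n with
    | zero => intro s t hst; simpa using h s t hst
    | succ n ih =>
      intro s t hst
      obtain ⟨r, hr, hVr⟩ : ∃ r ∈ uIcc s t, V r = (V s + V t) / 2 := by
        have := intermediate_value_uIcc (a := s) (b := t) hV.continuousOn
        apply this
        rcases le_total (V s) (V t) with h1 | h1
        · rw [uIcc_of_le h1]; constructor <;> linarith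
        · rw [uIcc_of_ge h1]; constructor <;> linarith
      rw [uIcc_of_le hst] at hr
      have h1 := ih s r hr.1
      have h2 := ih r t hr.2
      rw [hVr] at h1 h2
      have e : C * (V t - V s) ^ 2 / 2 ^ (n + 1)
          = C * ((V s + V t) / 2 - V s) ^ 2 / 2 ^ n + C * (V t - (V s + V t) / 2) ^ 2 / 2 ^ n := by
        rw [pow_succ]; field_simp; ring
      rw [e]; linarith
  have hlim : Tendsto (fun n : ℕ => C * (V t - V s) ^ 2 / 2 ^ n) atTop (𝓝 0) := by
    have := (tendsto_pow_atTop_nhds_zero_of_lt_one (r := (1 / 2 : ℝ)) (by norm_num)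
      (by norm_num)).const_mul (C * (V t - V s) ^ 2)
    simpa [div_eq_mul_inv] using this
  have := ge_of_tendsto' hlim (fun n => key n s t hst)
  linarith

lemma continuous_integral_from {f : ℝ → ℝ} (hf : Integrable f) (t₀ : ℝ) :
    Continuous fun t => ∫ τ in t₀..t, f τ :=
  intervalIntegral.continuous_primitive (fun _ _ => hf.intervalIntegrable) t₀

lemma integral_sub_from {E : Type*} [NormedAddCommGroup E] [NormedSpace ℝ E]
    {f : ℝ → E} (hf : Integrable f) (t₀ s t : ℝ) :
    (∫ τ in t₀..t, f τ) - ∫ τ in t₀..s, f τ = ∫ τ in s..t, f τ :=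
  intervalIntegral.integral_interval_sub_left hf.intervalIntegrable hf.intervalIntegrable

variable {H : Type*} [NormedAddCommGroup H] [InnerProductSpace ℝ H]

lemma norm_sub_le_integral {u u' : ℝ → H} (hu : ∀ s t, u t - u s = ∫ τ in s..t, u' τ)
    {s t : ℝ} (hst : s ≤ t) : ‖u t - u s‖ ≤ ∫ τ in s..t, ‖u' τ‖ := by
  rw [hu]; exact intervalIntegral.norm_integral_le_integral_norm hst

lemma continuous_of_primitive {u u' : ℝ → H} (hu' : Integrable u')
    (hu : ∀ s t, u t - u s = ∫ τ in s..t, u' τ) : Continuous u := by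
  have : u = fun t => u 0 + ∫ τ in (0 : ℝ)..t, u' τ := by
    ext t; rw [← hu 0 t]; abel
  rw [this]
  exact continuous_const.add
    (intervalIntegral.continuous_primitive (fun _ _ => hu'.intervalIntegrable) 0)

lemma intervalIntegrable_inner {u' v : ℝ → H} (hu' : Integrable u') (hv : Continuous v) (s t : ℝ) :
    IntervalIntegrable (fun τ => inner ℝ (u' τ) (v τ)) volume s t := by
  rw [intervalIntegrable_iff]
  obtain ⟨B, hB⟩ := (isCompact_uIcc (a := s) (b := t)).exists_bound_of_continuousOn
    hv.continuousOn
  refine Integrable.mono' (g := fun τ => ‖u' τ‖ * B) (hu'.norm.mul_const B).integrableOn ?_ ?_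
  · exact (hu'.aestronglyMeasurable.inner hv.aestronglyMeasurable).restrict
  · filter_upwards [ae_restrict_mem measurableSet_uIoc] with τ hτ
    calc ‖inner ℝ (u' τ) (v τ)‖ ≤ ‖u' τ‖ * ‖v τ‖ := norm_inner_le_norm _ _
      _ ≤ ‖u' τ‖ * B := by
        gcongr; exact hB τ (uIoc_subset_uIcc hτ)

/-- The product rule for the inner product of two primitives of Bochner integrable functions. -/
theorem inner_sub_inner_eq_integral [CompleteSpace H] {u u' v v' : ℝ → H} (hu' : Integrable u')
    (hv' : Integrable v') (hu : ∀ s t, u t - u s = ∫ τ in s..t, u' τ)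
    (hv : ∀ s t, v t - v s = ∫ τ in s..t, v' τ) (s t : ℝ) :
    inner ℝ (u t) (v t) - inner ℝ (u s) (v s)
      = ∫ τ in s..t, (inner ℝ (u' τ) (v τ) + inner ℝ (u τ) (v' τ)) := by
  have cu := continuous_of_primitive hu' hu
  have cv := continuous_of_primitive hv' hv
  have i1 := intervalIntegrable_inner hu' cv
  have i2 : ∀ s t, IntervalIntegrable (fun τ => inner ℝ (u τ) (v' τ)) volume s t := by
    intro s t
    simpa only [real_inner_comm] using intervalIntegrable_inner hv' cu s t
  set V : ℝ → ℝ := fun t => ∫ τ in (0 : ℝ)..t, (‖u' τ‖ + ‖v' τ‖) with hVdef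
  have hn : Integrable (fun τ => ‖u' τ‖ + ‖v' τ‖) := hu'.norm.add hv'.norm
  have hV : Continuous V := continuous_integral_from hn 0
  have hVsub : ∀ s t, V t - V s = ∫ τ in s..t, (‖u' τ‖ + ‖v' τ‖) := fun s t =>
    integral_sub_from hn 0 s t
  have hVmono : ∀ s t, s ≤ t → V s ≤ V t := by
    intro s t hst
    have : 0 ≤ V t - V s := by
      rw [hVsub]; exact intervalIntegral.integral_nonneg hst (fun _ _ => by positivity)
    linarith
  have dv : ∀ s t, s ≤ t → ‖v t - v s‖ ≤ V t - V s := by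
    intro s t hst
    refine (norm_sub_le_integral hv hst).trans ?_
    rw [hVsub]
    exact intervalIntegral.integral_mono_on hst hv'.norm.intervalIntegrable
      hn.intervalIntegrable (fun _ _ => by simp)
  have du : ∀ s t, s ≤ t → ‖u t - u s‖ ≤ V t - V s := by
    intro s t hst
    refine (norm_sub_le_integral hu hst).trans ?_
    rw [hVsub]
    exact intervalIntegral.integral_mono_on hst hu'.norm.intervalIntegrable
      hn.intervalIntegrable (fun _ _ => by simp)
  -- `G` is the defect in the product rule. Its increments are bounded by squares of increments of
  -- `V`, so both `G` and `-G` are nonincreasing.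
  set G : ℝ → ℝ := fun t => inner ℝ (u t) (v t)
    - ∫ τ in (0 : ℝ)..t, (inner ℝ (u' τ) (v τ) + inner ℝ (u τ) (v' τ)) with hG
  have hGsub : ∀ s t, G t - G s = inner ℝ (u t) (v t) - inner ℝ (u s) (v s)
      - ∫ τ in s..t, (inner ℝ (u' τ) (v τ) + inner ℝ (u τ) (v' τ)) := by
    intro s t
    rw [← intervalIntegral.integral_interval_sub_left (a := 0) (b := t) (c := s)
      ((i1 _ _).add (i2 _ _)) ((i1 _ _).add (i2 _ _)), hG]
    ring
  have est : ∀ s t, s ≤ t → |G t - G s| ≤ 1 * (V t - V s) ^ 2 := by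
    intro s t hst
    -- Freezing `v` at `t` and `u` at `s` makes the identity exact; the error of unfreezing is
    -- quadratic in the increment of `V`.
    have e1 : inner ℝ (u t) (v t) - inner ℝ (u s) (v s)
        = ∫ τ in s..t, (inner ℝ (u' τ) (v t) + inner ℝ (u s) (v' τ)) := by
      have h1 : inner ℝ (u t - u s) (v t) = ∫ τ in s..t, inner ℝ (u' τ) (v t) := by
        rw [hu]
        have := ContinuousLinearMap.intervalIntegral_comp_comm (innerSL ℝ (v t))
          (hu'.intervalIntegrable (a := s) (b := t))
        simp only [innerSL_apply_apply] at this
        rw [real_inner_comm, ← this]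
        simp only [real_inner_comm]
      have h2 : inner ℝ (u s) (v t - v s) = ∫ τ in s..t, inner ℝ (u s) (v' τ) := by
        rw [hv]
        have := ContinuousLinearMap.intervalIntegral_comp_comm (innerSL ℝ (u s))
          (hv'.intervalIntegrable (a := s) (b := t))
        simp only [innerSL_apply_apply] at this
        rw [← this]
      rw [intervalIntegral.integral_add (hu'.inner_const _).intervalIntegrable
        (hv'.const_inner _).intervalIntegrable, ← h1, ← h2, inner_sub_left, inner_sub_right]
      ring
    have i3 : IntervalIntegrable (fun τ => inner ℝ (u' τ) (v t) + inner ℝ (u s) (v' τ))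
        volume s t := ((hu'.inner_const _).add (hv'.const_inner _)).intervalIntegrable
    rw [hGsub, e1, ← intervalIntegral.integral_sub i3 ((i1 _ _).add (i2 _ _))]
    have : ‖∫ τ in s..t, (inner ℝ (u' τ) (v t) + inner ℝ (u s) (v' τ)
        - (inner ℝ (u' τ) (v τ) + inner ℝ (u τ) (v' τ)))‖
        ≤ ∫ τ in s..t, (‖u' τ‖ + ‖v' τ‖) * (V t - V s) := by
      refine intervalIntegral.norm_integral_le_of_norm_le hst ?_
        (hn.mul_const _).intervalIntegrable
      refine Eventually.of_forall fun τ hτ => ?_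
      have e : inner ℝ (u' τ) (v t) + inner ℝ (u s) (v' τ)
        - (inner ℝ (u' τ) (v τ) + inner ℝ (u τ) (v' τ))
        = inner ℝ (u' τ) (v t - v τ) - inner ℝ (u τ - u s) (v' τ) := by
        simp only [inner_sub_left, inner_sub_right]; ring
      rw [e]
      have hm1 := hVmono s τ hτ.1.le
      have hm2 := hVmono τ t hτ.2
      have a1 : ‖inner ℝ (u' τ) (v t - v τ)‖ ≤ ‖u' τ‖ * (V t - V s) := by
        refine (norm_inner_le_norm _ _).trans ?_
        gcongr
        exact (dv τ t hτ.2).trans (by linarith)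
      have a2 : ‖inner ℝ (u τ - u s) (v' τ)‖ ≤ (V t - V s) * ‖v' τ‖ := by
        refine (norm_inner_le_norm _ _).trans ?_
        gcongr
        exact (du s τ hτ.1.le).trans (by linarith)
      refine (norm_sub_le _ _).trans ?_
      linarith
    rw [intervalIntegral.integral_mul_const, ← hVsub] at this
    rw [one_mul, sq]; exact this
  have main : ∀ s t, s ≤ t → G t = G s := by
    intro s t hst
    have l1 := le_of_increment_le_sq hV
      (fun s t h => (le_abs_self _).trans (est s t h)) hst
    have l2 := le_of_increment_le_sq (G := fun t => - G t) (C := 1) hV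
      (fun s t h => by
        have := (neg_abs_le (G t - G s)); have := est s t h; linarith) hst
    linarith
  have : G t - G s = 0 := by
    rcases le_total s t with h | h
    · rw [main s t h, sub_self]
    · rw [main t s h, sub_self]
  rw [hGsub] at this
  linarith

/-- Grönwall's inequality with an integrable kernel. -/
theorem gronwall_forward {f κ : ℝ → ℝ} {c t₀ t₁ B : ℝ} (hκ : Integrable κ) (hκ0 : ∀ t, 0 ≤ κ t)
    (hf : AEStronglyMeasurable f) (hf0 : ∀ t, 0 ≤ f t) (hB : ∀ t ∈ Icc t₀ t₁, f t ≤ B)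
    (hc : 0 ≤ c) (h : ∀ t ∈ Icc t₀ t₁, f t ≤ c + ∫ τ in t₀..t, κ τ * f τ) :
    ∀ t ∈ Icc t₀ t₁, f t ≤ c * Real.exp (∫ τ in t₀..t, κ τ) := by
  -- truncate `f` outside the interval
  set F : ℝ → ℝ := (Icc t₀ t₁).indicator f with hF
  have hF0 : ∀ t, 0 ≤ F t := fun t => indicator_nonneg (fun _ _ => hf0 _) t
  have hFi : Integrable (fun τ => κ τ * F τ) := by
    refine Integrable.mono' (g := fun τ => κ τ * |B|) (hκ.mul_const _)
      (hκ.aestronglyMeasurable.mul (hf.indicator measurableSet_Icc)) ?_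
    refine Eventually.of_forall fun τ => ?_
    rw [Real.norm_of_nonneg (mul_nonneg (hκ0 τ) (hF0 τ))]
    refine mul_le_mul_of_nonneg_left ?_ (hκ0 τ)
    by_cases hτ : τ ∈ Icc t₀ t₁
    · rw [hF, indicator_of_mem hτ]; exact (hB τ hτ).trans (le_abs_self B)
    · rw [hF, indicator_of_notMem hτ]; exact abs_nonneg B
  set R : ℝ → ℝ := fun t => c + ∫ τ in t₀..t, κ τ * F τ with hR
  set V : ℝ → ℝ := fun t => ∫ τ in t₀..t, κ τ with hV
  have hVc : Continuous V := continuous_integral_from hκ t₀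
  have hRsub : ∀ s t, R t - R s = ∫ τ in s..t, κ τ * F τ := by
    intro s t
    rw [← integral_sub_from hFi t₀ s t, hR]; ring
  have hVsub : ∀ s t, V t - V s = ∫ τ in s..t, κ τ := fun s t => integral_sub_from hκ t₀ s t
  have hRmono : ∀ s t, s ≤ t → R s ≤ R t := by
    intro s t hst
    have : 0 ≤ R t - R s := by
      rw [hRsub]
      exact intervalIntegral.integral_nonneg hst (fun τ _ => mul_nonneg (hκ0 τ) (hF0 τ))
    linarith
  have hVmono : ∀ s t, s ≤ t → V s ≤ V t := by
    intro s t hst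
    have : 0 ≤ V t - V s := by
      rw [hVsub]
      exact intervalIntegral.integral_nonneg hst (fun τ _ => hκ0 τ)
    linarith
  have hRt0 : R t₀ = c := by simp [hR]
  have hVt0 : V t₀ = 0 := by simp [hV]
  have hFR : ∀ t ∈ Icc t₀ t₁, f t ≤ R t := by
    intro t ht
    refine (h t ht).trans (le_of_eq ?_)
    rw [hR]
    congr 1
    refine intervalIntegral.integral_congr fun τ hτ => ?_
    rw [uIcc_of_le ht.1] at hτ
    have hm : τ ∈ Icc t₀ t₁ := ⟨hτ.1, hτ.2.trans ht.2⟩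
    simp only [hF, indicator_of_mem hm]
  have hFR' : ∀ t, t₀ ≤ t → F t ≤ R t := by
    intro t ht
    by_cases h1 : t ∈ Icc t₀ t₁
    · rw [hF, indicator_of_mem h1]; exact hFR t h1
    · rw [hF, indicator_of_notMem h1]
      exact hc.trans (hRt0 ▸ hRmono t₀ t ht)
  intro t₂ ht₂
  -- freeze the function outside the interval
  set p : ℝ → ℝ := fun t => max t₀ (min t t₂) with hp
  have hpc : Continuous p := by fun_prop
  have hpm : ∀ s t, s ≤ t → p s ≤ p t := fun s t h =>
    max_le_max le_rfl (min_le_min h le_rfl)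
  have hp0 : ∀ t, t₀ ≤ p t := fun t => le_max_left _ _
  have hp2 : ∀ t, p t ≤ t₂ := fun t => max_le ht₂.1 (min_le_right _ _)
  have hRpos : 0 ≤ R t₂ := hc.trans (hRt0 ▸ hRmono t₀ t₂ ht₂.1)
  -- The integrating factor: `R * exp (-V)` is nonincreasing, because the first-order terms in the
  -- increment of `V` cancel.
  have main := le_of_increment_le_sq (G := fun t => R (p t) * Real.exp (-V (p t)))
    (V := fun t => V (p t)) (C := R t₂) (hVc.comp hpc) (fun s t hst => by
      set x := p s
      set y := p t
      have hxy : x ≤ y := hpm s t hst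
      have hD : 0 ≤ V y - V x := by have := hVmono x y hxy; linarith
      have hR1 : R y - R x ≤ R y * (V y - V x) := by
        rw [hRsub, hVsub, ← intervalIntegral.integral_const_mul]
        refine intervalIntegral.integral_mono_on hxy hFi.intervalIntegrable
          (hκ.const_mul _).intervalIntegrable (fun τ hτ => ?_)
        rw [mul_comm]
        refine mul_le_mul_of_nonneg_right ?_ (hκ0 τ)
        exact (hFR' τ ((hp0 s).trans hτ.1)).trans (hRmono τ y hτ.2)
      have hRy : R y ≤ R t₂ := hRmono _ _ (hp2 t)
      have hRy0 : 0 ≤ R y := hc.trans (hRt0 ▸ hRmono t₀ y (hp0 t))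
      have hVx : 0 ≤ V x := by have := hVmono t₀ x (hp0 s); rw [hVt0] at this; exact this
      have ex1 : Real.exp (-V x) ≤ 1 := Real.exp_le_one_iff.2 (by linarith)
      have ex0 : 0 < Real.exp (-V x) := Real.exp_pos _
      have e1 : Real.exp (-V y) = Real.exp (-V x) * Real.exp (-(V y - V x)) := by
        rw [← Real.exp_add]; congr 1; ring
      -- Through `exp (-z) ≤ 1 / (1 + z)`, this reduces to `1 ≤ (1 + z) * (1 - z + z ^ 2) = 1 + z ^
      -- 3`.
      have e2 : Real.exp (-(V y - V x)) ≤ 1 - (V y - V x) + (V y - V x) ^ 2 := by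
        set z := V y - V x
        have h1 : 1 + z ≤ Real.exp z := by linarith [Real.add_one_le_exp z]
        have h2 : Real.exp (-z) ≤ (1 + z)⁻¹ := by
          rw [Real.exp_neg]; exact inv_anti₀ (by linarith) h1
        refine h2.trans ?_
        rw [inv_le_iff_one_le_mul₀ (by linarith)]
        nlinarith [pow_nonneg hD 3]
      calc R y * Real.exp (-V y) - R x * Real.exp (-V x)
          = Real.exp (-V x) * (R y * Real.exp (-(V y - V x)) - R x) := by rw [e1]; ring
        _ ≤ Real.exp (-V x) * (R y * (V y - V x) ^ 2) := by
            refine mul_le_mul_of_nonneg_left ?_ ex0.le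
            nlinarith [mul_le_mul_of_nonneg_left e2 hRy0]
        _ ≤ 1 * (R y * (V y - V x) ^ 2) := by
            refine mul_le_mul_of_nonneg_right ex1 (by positivity)
        _ ≤ R t₂ * (V y - V x) ^ 2 := by
            rw [one_mul]; gcongr) ht₂.1
  have p0 : p t₀ = t₀ := by simp [hp, ht₂.1]
  have p2 : p t₂ = t₂ := by simp [hp, ht₂.1]
  simp only [p0, p2, hRt0, hVt0, neg_zero, Real.exp_zero, mul_one] at main
  refine (hFR t₂ ht₂).trans ?_
  calc R t₂ = R t₂ * Real.exp (-V t₂) * Real.exp (V t₂) := by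
        rw [mul_assoc, ← Real.exp_add]; simp
    _ ≤ c * Real.exp (V t₂) := by gcongr

/-- The backward case is the forward one after `t ↦ -t`. Both directions are needed: strong
continuity at `t₀` uses the energy estimate on either side of `t₀`. -/
theorem gronwall {f κ : ℝ → ℝ} {c t₀ t₁ B : ℝ} (hκ : Integrable κ) (hκ0 : ∀ t, 0 ≤ κ t)
    (hf : AEStronglyMeasurable f) (hf0 : ∀ t, 0 ≤ f t) (hB : ∀ t ∈ uIcc t₀ t₁, f t ≤ B)
    (hc : 0 ≤ c) (h : ∀ t ∈ uIcc t₀ t₁, f t ≤ c + |∫ τ in t₀..t, κ τ * f τ|) :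
    ∀ t ∈ uIcc t₀ t₁, f t ≤ c * Real.exp |∫ τ in t₀..t, κ τ| := by
  rcases le_total t₀ t₁ with h01 | h01
  · rw [uIcc_of_le h01] at *
    intro t ht
    rw [abs_of_nonneg (intervalIntegral.integral_nonneg ht.1 (fun τ _ => hκ0 τ))]
    refine gronwall_forward hκ hκ0 hf hf0 hB hc (fun t ht => ?_) t ht
    have := h t ht
    rwa [abs_of_nonneg (intervalIntegral.integral_nonneg ht.1
      (fun τ _ => mul_nonneg (hκ0 τ) (hf0 τ)))] at this
  · rw [uIcc_of_ge h01] at *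
    have hswap : ∀ (F : ℝ → ℝ) (t : ℝ), ∫ τ in (-t₀)..t, F (-τ) = ∫ τ in (-t)..t₀, F τ := by
      intro F t; rw [intervalIntegral.integral_comp_neg]; simp
    have key := gronwall_forward (f := fun t => f (-t)) (κ := fun t => κ (-t)) (c := c)
      (t₀ := -t₀) (t₁ := -t₁) (B := B) hκ.comp_neg (fun t => hκ0 _)
      (hf.comp_quasiMeasurePreserving
        (Measure.measurePreserving_neg (volume : Measure ℝ)).quasiMeasurePreserving)
      (fun t => hf0 _) (fun t ht => hB _ ⟨by linarith [ht.2], by linarith [ht.1]⟩) hc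
      (fun t ht => by
        rw [hswap (fun τ => κ τ * f τ) t]
        have := h (-t) ⟨by linarith [ht.2], by linarith [ht.1]⟩
        rwa [intervalIntegral.integral_symm, abs_neg, abs_of_nonneg
          (intervalIntegral.integral_nonneg (by linarith [ht.1])
          (fun τ _ => mul_nonneg (hκ0 τ) (hf0 τ)))] at this)
    intro t ht
    have := key (-t) ⟨by linarith [ht.2], by linarith [ht.1]⟩
    rw [hswap κ (-t), neg_neg] at this
    rwa [intervalIntegral.integral_symm, abs_neg, abs_of_nonneg
          (intervalIntegral.integral_nonneg ht.2 (fun τ _ => hκ0 τ))]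

end Calculus

/-! ### Weak versus strong measurability in separable Hilbert spaces. -/

section Pettis

variable {H : Type*} [NormedAddCommGroup H] [InnerProductSpace ℝ H] [CompleteSpace H]
  [SecondCountableTopology H] {α : Type*} {mα : MeasurableSpace α} {μ : Measure α}

/-- In a separable Hilbert space, weak measurability implies strong measurability. -/
theorem aestronglyMeasurable_of_inner {f : α → H}
    (h : ∀ v, AEStronglyMeasurable (fun t => inner ℝ v (f t)) μ) : AEStronglyMeasurable f μ := by
  obtain ⟨w, b, hb⟩ := exists_hilbertBasis ℝ H
  have ho : Orthonormal ℝ (Subtype.val : w → H) := hb ▸ b.orthonormal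
  -- Distinct orthonormal vectors are at distance `√2`, so balls of radius `1/2` around them are
  -- disjoint, and a separable space holds only countably many.
  have hcount : w.Countable := by
    refine Set.PairwiseDisjoint.countable_of_isOpen (s := fun x : H => Metric.ball x (1 / 2))
      (a := w) ?_ (fun x _ => Metric.isOpen_ball) (fun x _ => ⟨x, by simp⟩)
    intro x hx y hy hxy
    refine Metric.ball_disjoint_ball ?_
    have h0 : inner ℝ x y = 0 := ho.2 (i := ⟨x, hx⟩) (j := ⟨y, hy⟩) (by simpa using hxy)
    have hx1 : ‖x‖ = 1 := ho.1 ⟨x, hx⟩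
    have hy1 : ‖y‖ = 1 := ho.1 ⟨y, hy⟩
    rw [dist_eq_norm]
    have h2 := norm_sub_sq_real x y
    rw [h0, hx1, hy1] at h2
    nlinarith [norm_nonneg (x - y)]
  -- Countability makes `atTop` on `Finset w` countably generated, which measurability of the limit
  -- of the partial sums requires.
  have : Countable w := hcount
  refine aestronglyMeasurable_of_tendsto_ae (u := (atTop : Filter (Finset w)))
    (f := fun s t => ∑ i ∈ s, (b.repr (f t)) i • b i) (fun s => ?_)
    (Eventually.of_forall fun t => b.hasSum_repr (f t))
  refine Finset.aestronglyMeasurable_fun_sum _ fun i _ => ?_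
  simp only [b.repr_apply_apply]
  exact (h (b i)).smul_const (b i)

lemma aestronglyMeasurable_adjoint_apply {A : α → H →L[ℝ] H}
    (hA : ∀ u, AEStronglyMeasurable (fun t => A t u) μ) (v : H) :
    AEStronglyMeasurable (fun t => (A t).adjoint v) μ := by
  refine aestronglyMeasurable_of_inner fun u => ?_
  simp only [ContinuousLinearMap.adjoint_inner_right]
  exact (hA u).inner aestronglyMeasurable_const

/-- The operators are measurable only on fixed vectors. Passing to the adjoint writes each weak
component as an inner product of two measurable curves. -/
lemma aestronglyMeasurable_clm_apply {A : α → H →L[ℝ] H} {w : α → H}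
    (hA : ∀ u, AEStronglyMeasurable (fun t => A t u) μ) (hw : AEStronglyMeasurable w μ) :
    AEStronglyMeasurable (fun t => A t (w t)) μ := by
  refine aestronglyMeasurable_of_inner fun v => ?_
  have := (aestronglyMeasurable_adjoint_apply hA v).inner (𝕜 := ℝ) hw
  simpa only [ContinuousLinearMap.adjoint_inner_left] using this

end Pettis

/-! ### Linear equations with bounded, time-measurable generators. -/

section LinearODE

/-- With the weight `exp (2 * c * |s - t₀|)` in the sup norm, the Picard map contracts by `1/2` on
the whole line at once. -/
lemma abs_integral_exp_le {c : ℝ} (hc : 0 ≤ c) (t₀ t : ℝ) :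
    |∫ s in t₀..t, c * Real.exp (2 * c * |s - t₀|)| ≤ 1 / 2 * Real.exp (2 * c * |t - t₀|) := by
  have one_le : ∀ x : ℝ, 0 ≤ x → 1 ≤ Real.exp (2 * c * x) := fun x hx =>
    Real.one_le_exp (by positivity)
  rcases le_total t₀ t with h | h
  · have e : ∫ s in t₀..t, c * Real.exp (2 * c * |s - t₀|)
        = 1 / 2 * Real.exp (2 * c * (t - t₀)) - 1 / 2 * Real.exp (2 * c * (t₀ - t₀)) := by
      rw [← intervalIntegral.integral_eq_sub_of_hasDerivAt
        (f := fun s => 1 / 2 * Real.exp (2 * c * (s - t₀)))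
        (f' := fun s => c * Real.exp (2 * c * (s - t₀)))]
      · refine intervalIntegral.integral_congr fun s hs => ?_
        rw [uIcc_of_le h] at hs
        simp only [abs_of_nonneg (sub_nonneg.2 hs.1)]
      · intro s _
        have := ((((hasDerivAt_id s).sub_const t₀).const_mul (2 * c)).exp).const_mul (1 / 2)
        refine this.congr_deriv ?_
        simp; ring
      · exact Continuous.intervalIntegrable (by fun_prop) _ _
    rw [e, abs_of_nonneg (sub_nonneg.2 h), sub_self, mul_zero, Real.exp_zero, abs_le]
    have := one_le _ (sub_nonneg.2 h)
    constructor <;> linarith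
  · have e : ∫ s in t₀..t, c * Real.exp (2 * c * |s - t₀|)
        = -(1 / 2) * Real.exp (2 * c * (t₀ - t)) - -(1 / 2) * Real.exp (2 * c * (t₀ - t₀)) := by
      rw [← intervalIntegral.integral_eq_sub_of_hasDerivAt
        (f := fun s => -(1 / 2) * Real.exp (2 * c * (t₀ - s)))
        (f' := fun s => c * Real.exp (2 * c * (t₀ - s)))]
      · refine intervalIntegral.integral_congr fun s hs => ?_
        rw [uIcc_of_ge h] at hs
        simp only [abs_of_nonpos (sub_nonpos.2 hs.2), neg_sub]
      · intro s _
        have := ((((hasDerivAt_id s).const_sub t₀).const_mul (2 * c)).exp).const_mul (-(1 / 2))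
        refine this.congr_deriv ?_
        simp; ring
      · exact Continuous.intervalIntegrable (by fun_prop) _ _
    rw [e, abs_of_nonpos (sub_nonpos.2 h), neg_sub, sub_self, mul_zero, Real.exp_zero, abs_le]
    have := one_le _ (sub_nonneg.2 h)
    constructor <;> linarith

variable {H : Type*} [NormedAddCommGroup H] [InnerProductSpace ℝ H] [CompleteSpace H]

/-- Solvability of `u' = A(t) u + g(t)` for bounded operators that are merely measurable in time. -/
theorem exists_linear_ode [SecondCountableTopology H] {A : ℝ → H →L[ℝ] H} {c : ℝ}
    (hc : ∀ t, ‖A t‖ ≤ c)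
    (hA : ∀ u, AEStronglyMeasurable (fun t => A t u)) {g : ℝ → H} (hg : Integrable g)
    (t₀ : ℝ) (u₀ : H) :
    ∃ u : ℝ → H, Continuous u ∧ u t₀ = u₀ ∧
      ∀ s t, u t - u s = ∫ τ in s..t, (A τ (u τ) + g τ) := by
  have hc0 : 0 ≤ c := (norm_nonneg _).trans (hc 0)
  -- The solution is sought as `w • v` with `v` bounded and continuous; the fixed point problem `Φ v
  -- = v` lives in the unweighted space.
  set w : ℝ → ℝ := fun s => Real.exp (2 * c * |s - t₀|) with hw
  have hwc : Continuous w := by fun_prop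
  have hw0 : ∀ s, 0 < w s := fun s => Real.exp_pos _
  have hw1 : ∀ s, 1 ≤ w s := fun s => Real.one_le_exp (by positivity)
  have hint : ∀ (v : ℝ → H), Continuous v → ∀ s t,
      IntervalIntegrable (fun τ => A τ (v τ)) volume s t := by
    intro v hv s t
    refine IntervalIntegrable.mono_fun' (g := fun τ => c * ‖v τ‖)
      (Continuous.intervalIntegrable (by fun_prop) _ _)
      (aestronglyMeasurable_clm_apply hA hv.aestronglyMeasurable).restrict ?_
    refine Eventually.of_forall fun τ => ?_
    exact (A τ).le_of_opNorm_le (hc τ) _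
  set I : (BoundedContinuousFunction ℝ H) → ℝ → H :=
    fun v t => ∫ τ in t₀..t, A τ (w τ • v τ) with hI
  have hIb : ∀ v t, ‖I v t‖ ≤ 1 / 2 * w t * ‖v‖ := by
    intro v t
    have h1 : ‖I v t‖ ≤ |∫ τ in t₀..t, c * w τ * ‖v‖| := by
      refine intervalIntegral.norm_integral_le_abs_of_norm_le ?_
        (Continuous.intervalIntegrable (by fun_prop) _ _)
      refine Eventually.of_forall fun τ => ?_
      calc ‖A τ (w τ • v τ)‖ ≤ c * ‖w τ • v τ‖ := (A τ).le_of_opNorm_le (hc τ) _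
        _ ≤ c * (w τ * ‖v‖) := by
          rw [norm_smul, Real.norm_of_nonneg (hw0 τ).le]
          have := v.norm_coe_le_norm τ
          have := (hw0 τ).le
          gcongr
        _ = c * w τ * ‖v‖ := by ring
    refine h1.trans ?_
    rw [intervalIntegral.integral_mul_const, abs_mul, abs_of_nonneg (norm_nonneg v)]
    gcongr
    exact abs_integral_exp_le hc0 t₀ t
  have hIc : ∀ v, Continuous (I v) := fun v =>
    intervalIntegral.continuous_primitive (fun _ _ => hint _ (hwc.smul v.continuous) _ _) t₀
  have hIsub : ∀ v v' t, I v t - I v' t = I (v - v') t := by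
    intro v v' t
    rw [hI]
    simp only
    rw [← intervalIntegral.integral_sub (hint (fun τ => w τ • v τ) (hwc.smul v.continuous) _ _)
      (hint (fun τ => w τ • v' τ) (hwc.smul v'.continuous) _ _)]
    refine intervalIntegral.integral_congr fun τ _ => ?_
    simp [smul_sub]
  set p : ℝ → H := fun t => u₀ + ∫ τ in t₀..t, g τ with hp
  have hpc : Continuous p := continuous_const.add
    (intervalIntegral.continuous_primitive (fun _ _ => hg.intervalIntegrable) t₀)
  have hpb : ∀ t, ‖p t‖ ≤ ‖u₀‖ + ∫ τ, ‖g τ‖ := by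
    intro t
    refine (norm_add_le _ _).trans (add_le_add le_rfl ?_)
    refine (intervalIntegral.norm_integral_le_integral_norm_uIoc).trans ?_
    exact setIntegral_le_integral hg.norm (Eventually.of_forall fun _ => norm_nonneg _)
  have hwinv : ∀ t, (w t)⁻¹ ≤ 1 := fun t => inv_le_one_of_one_le₀ (hw1 t)
  set Φ : BoundedContinuousFunction ℝ H → BoundedContinuousFunction ℝ H := fun v =>
    BoundedContinuousFunction.ofNormedAddCommGroup (fun t => (w t)⁻¹ • (p t + I v t))
      ((hwc.inv₀ (fun t => (hw0 t).ne')).smul (hpc.add (hIc v)))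
      (‖u₀‖ + (∫ τ, ‖g τ‖) + 1 / 2 * ‖v‖) (by
        intro t
        rw [norm_smul, norm_inv, Real.norm_of_nonneg (hw0 t).le]
        calc (w t)⁻¹ * ‖p t + I v t‖ ≤ (w t)⁻¹ * (‖p t‖ + 1 / 2 * w t * ‖v‖) := by
              have := (hw0 t).le
              gcongr
              exact (norm_add_le _ _).trans (add_le_add le_rfl (hIb v t))
          _ = (w t)⁻¹ * ‖p t‖ + 1 / 2 * ‖v‖ := by
              have := (hw0 t).ne'
              field_simp
          _ ≤ 1 * (‖u₀‖ + ∫ τ, ‖g τ‖) + 1 / 2 * ‖v‖ := by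
              gcongr
              · exact hwinv t
              · exact hpb t
          _ = _ := by ring) with hΦ
  have hcontr : ContractingWith (1 / 2) Φ := by
    refine ⟨by rw [← NNReal.coe_lt_coe]; norm_num, LipschitzWith.of_dist_le_mul fun v v' => ?_⟩
    rw [BoundedContinuousFunction.dist_le (by positivity)]
    intro t
    have e : dist (Φ v t) (Φ v' t) = (w t)⁻¹ * ‖I (v - v') t‖ := by
      rw [dist_eq_norm]
      simp only [hΦ, BoundedContinuousFunction.coe_ofNormedAddCommGroup]
      rw [← smul_sub, add_sub_add_left_eq_sub, hIsub, norm_smul, norm_inv,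
        Real.norm_of_nonneg (hw0 t).le]
    rw [e, dist_eq_norm]
    calc (w t)⁻¹ * ‖I (v - v') t‖ ≤ (w t)⁻¹ * (1 / 2 * w t * ‖v - v'‖) := by
          have := (hw0 t).le
          gcongr
          exact hIb _ _
      _ = ((1 / 2 : NNReal) : ℝ) * ‖v - v'‖ := by
          have := (hw0 t).ne'
          push_cast
          field_simp
  set v := hcontr.fixedPoint
  have hv : Φ v = v := hcontr.fixedPoint_isFixedPt
  have hu : ∀ t, w t • v t = p t + I v t := by
    intro t
    conv_lhs => rw [← hv]
    simp only [hΦ, BoundedContinuousFunction.coe_ofNormedAddCommGroup]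
    rw [smul_inv_smul₀ (hw0 t).ne']
  have huc : Continuous fun t => w t • v t := hwc.smul v.continuous
  refine ⟨fun t => w t • v t, huc, ?_, ?_⟩
  · simp only [hu]; simp [hp, hI]
  · intro s t
    rw [intervalIntegral.integral_add (hint _ huc _ _) hg.intervalIntegrable]
    have e1 := intervalIntegral.integral_interval_sub_left (a := t₀) (b := t) (c := s)
      (hint _ huc _ _) (hint _ huc _ _)
    have e2 := integral_sub_from hg t₀ s t
    rw [← e1, ← e2]
    change w t • v t - w s • v s = (I v t - I v s) + _
    rw [hu, hu]
    simp only [hp]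
    abel

/-- The energy estimate for `u' = A(t) u + g(t)`, forward and backward in time. -/
theorem norm_le_of_linear_ode {A : ℝ → H →L[ℝ] H} {g u : ℝ → H} {κ : ℝ → ℝ}
    (hκ : Integrable κ) (hκ0 : ∀ t, 0 ≤ κ t) (hg : Integrable g)
    (hAu : Integrable fun t => A t (u t))
    (hdiss : ∀ t x, |inner ℝ (A t x) x| ≤ κ t * ‖x‖ ^ 2)
    (hu : ∀ s t, u t - u s = ∫ τ in s..t, (A τ (u τ) + g τ)) (t₀ t₁ : ℝ) :
    ‖u t₁‖ ≤ (‖u t₀‖ + 2 * |∫ τ in t₀..t₁, ‖g τ‖|) * Real.exp (2 * |∫ τ in t₀..t₁, κ τ|) := by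
  have hi : Integrable fun t => A t (u t) + g t := hAu.add hg
  have cu : Continuous u := continuous_of_primitive hi hu
  -- The maximum `S` of the norm bounds the source term by `S * ‖g‖`, so that Grönwall applies to
  -- `‖u‖ ^ 2`; dividing the result by `S` restores an estimate linear in the data.
  obtain ⟨ts, hts, hmax⟩ := (isCompact_uIcc (a := t₀) (b := t₁)).exists_isMaxOn nonempty_uIcc
    cu.norm.continuousOn
  set S := ‖u ts‖ with hS
  have hSle : ∀ t ∈ uIcc t₀ t₁, ‖u t‖ ≤ S := fun t ht => hmax ht
  set Gt := |∫ τ in t₀..t₁, ‖g τ‖| with hGt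
  set K := |∫ τ in t₀..t₁, κ τ| with hK
  have mono_abs : ∀ {f : ℝ → ℝ}, Integrable f → (∀ t, 0 ≤ f t) → ∀ t ∈ uIcc t₀ t₁,
      |∫ τ in t₀..t, f τ| ≤ |∫ τ in t₀..t₁, f τ| := by
    intro f hf hf0 t ht
    refine intervalIntegral.abs_integral_mono_interval (uIoc_subset_uIoc_of_uIcc_subset_uIcc ?_)
      (Eventually.of_forall hf0) hf.intervalIntegrable
    exact uIcc_subset_uIcc_left ht
  have hE : ∀ t ∈ uIcc t₀ t₁, ‖u t‖ ^ 2 ≤ (‖u t₀‖ ^ 2 + 2 * S * Gt)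
      + |∫ τ in t₀..t, (2 * κ τ) * ‖u τ‖ ^ 2| := by
    intro t ht
    have e := inner_sub_inner_eq_integral hi hi hu hu t₀ t
    simp only [real_inner_self_eq_norm_sq] at e
    have hsub : ∀ τ ∈ uIoc t₀ t, τ ∈ uIcc t₀ t₁ := fun τ hτ =>
      uIcc_subset_uIcc_left ht (uIoc_subset_uIcc hτ)
    have hii : IntervalIntegrable (fun τ => (2 * κ τ) * ‖u τ‖ ^ 2) volume t₀ t :=
      ((hκ.const_mul 2).intervalIntegrable).mul_continuousOn (by fun_prop)
    have hii2 : IntervalIntegrable (fun τ => 2 * S * ‖g τ‖) volume t₀ t :=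
      (hg.norm.const_mul _).intervalIntegrable
    have b1 : ‖∫ τ in t₀..t, (inner ℝ (A τ (u τ) + g τ) (u τ)
        + inner ℝ (u τ) (A τ (u τ) + g τ))‖ ≤ |∫ τ in t₀..t,
          ((2 * κ τ) * ‖u τ‖ ^ 2 + 2 * S * ‖g τ‖)| := by
      refine intervalIntegral.norm_integral_le_abs_of_norm_le ?_ (hii.add hii2)
      filter_upwards [ae_restrict_mem measurableSet_uIoc] with τ hτ
      rw [real_inner_comm (u τ) (A τ (u τ) + g τ), Real.norm_eq_abs, ← two_mul, inner_add_right]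
      have h1 := hdiss τ (u τ)
      rw [real_inner_comm] at h1
      have h2 : |inner ℝ (u τ) (g τ)| ≤ S * ‖g τ‖ :=
        (abs_real_inner_le_norm _ _).trans
          (mul_le_mul_of_nonneg_right (hSle τ (hsub τ hτ)) (norm_nonneg _))
      rw [abs_mul, abs_two]
      have := abs_add_le (inner ℝ (u τ) (A τ (u τ))) (inner ℝ (u τ) (g τ))
      linarith
    rw [intervalIntegral.integral_add hii hii2, Real.norm_eq_abs] at b1
    have b2 : |∫ τ in t₀..t, 2 * S * ‖g τ‖| ≤ 2 * S * Gt := by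
      rw [intervalIntegral.integral_const_mul, abs_mul, abs_of_nonneg (by positivity)]
      have := mono_abs hg.norm (fun _ => norm_nonneg _) t ht
      have : 0 ≤ S := norm_nonneg _
      gcongr
    have b3 := abs_add_le (∫ τ in t₀..t, (2 * κ τ) * ‖u τ‖ ^ 2) (∫ τ in t₀..t, 2 * S * ‖g τ‖)
    have b4 := le_abs_self (∫ τ in t₀..t, (inner ℝ (A τ (u τ) + g τ) (u τ)
        + inner ℝ (u τ) (A τ (u τ) + g τ)))
    linarith
  have hS0 : 0 ≤ S := norm_nonneg _
  have hgr := gronwall (f := fun t => ‖u t‖ ^ 2) (κ := fun t => 2 * κ t) (B := S ^ 2)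
    (hκ.const_mul 2) (fun t => mul_nonneg zero_le_two (hκ0 t))
    (Continuous.aestronglyMeasurable (by fun_prop)) (fun t => by positivity)
    (fun t ht => by have := hSle t ht; gcongr) (c := ‖u t₀‖ ^ 2 + 2 * S * Gt) (by positivity)
    hE ts hts
  rw [intervalIntegral.integral_const_mul, abs_mul, abs_two] at hgr
  have hKle : |∫ τ in t₀..ts, κ τ| ≤ K := mono_abs hκ hκ0 ts hts
  set X := Real.exp (2 * K) with hX
  have hX1 : 0 < X := Real.exp_pos _
  have hgr2 : S ^ 2 ≤ (‖u t₀‖ ^ 2 + 2 * S * Gt) * X := by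
    exact hgr.trans (mul_le_mul_of_nonneg_left (Real.exp_le_exp.2 (by linarith))
      (by positivity))
  have hy : ‖u t₀‖ ≤ S := hSle t₀ left_mem_uIcc
  refine (hSle t₁ right_mem_uIcc).trans ?_
  rcases hS0.eq_or_lt with h | h
  · rw [← h]; positivity
  · have : S * S ≤ S * ((‖u t₀‖ + 2 * Gt) * X) := by
      have h3 : ‖u t₀‖ ^ 2 * X ≤ S * ‖u t₀‖ * X := by
        rw [sq]; gcongr
      nlinarith
    exact le_of_mul_le_mul_left this h

end LinearODE

/-! ### Weak compactness for bounded, weakly equicontinuous curves. -/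

section WeakLimits

variable {H : Type*} [NormedAddCommGroup H] [InnerProductSpace ℝ H]

lemma cauchySeq_inner_of_dense {x : ℕ → H} {B : ℝ} (hB : ∀ n, ‖x n‖ ≤ B) {D : Set H}
    (hD : Dense D) (hc : ∀ v ∈ D, CauchySeq fun n => inner ℝ (x n) v) (v : H) :
    CauchySeq fun n => inner ℝ (x n) v := by
  have hB0 : 0 ≤ B := (norm_nonneg _).trans (hB 0)
  rw [Metric.cauchySeq_iff']
  intro ε hε
  obtain ⟨v', hv', hd⟩ := hD.exists_dist_lt v (ε := ε / (3 * (B + 1))) (by positivity)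
  obtain ⟨N, hN⟩ := Metric.cauchySeq_iff'.1 (hc v' hv') (ε / 3) (by positivity)
  refine ⟨N, fun n hn => ?_⟩
  have h1 := hN n hn
  rw [Real.dist_eq] at h1 ⊢
  have hb : ∀ k, |inner ℝ (x k) v - inner ℝ (x k) v'| < ε / 3 := by
    intro k
    rw [← inner_sub_right]
    refine (abs_real_inner_le_norm _ _).trans_lt ?_
    rw [dist_eq_norm] at hd
    calc ‖x k‖ * ‖v - v'‖ ≤ B * ‖v - v'‖ := by gcongr; exact hB k
      _ ≤ (B + 1) * ‖v - v'‖ := by gcongr; linarith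
      _ < (B + 1) * (ε / (3 * (B + 1))) := by gcongr
      _ = ε / 3 := by field_simp
  have h2 := hb n
  have h3 := hb N
  rw [abs_lt] at *
  constructor <;> linarith [h1.1, h1.2, h2.1, h2.2, h3.1, h3.2]

lemma exists_weak_limit [CompleteSpace H] {x : ℕ → H} {B : ℝ} (hB : ∀ n, ‖x n‖ ≤ B)
    (hc : ∀ v, CauchySeq fun n => inner ℝ (x n) v) :
    ∃ y : H, ∀ v, Tendsto (fun n => inner ℝ (x n) v) atTop (𝓝 (inner ℝ y v)) := by
  choose ℓ hℓ using fun v => cauchySeq_tendsto_of_complete (hc v)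
  let L : H →ₗ[ℝ] ℝ :=
    { toFun := ℓ
      map_add' := fun v w => by
        refine tendsto_nhds_unique (hℓ (v + w)) ?_
        simpa only [inner_add_right] using (hℓ v).add (hℓ w)
      map_smul' := fun r v => by
        refine tendsto_nhds_unique (hℓ (r • v)) ?_
        simpa only [inner_smul_right, RingHom.id_apply, smul_eq_mul] using (hℓ v).const_mul r }
  have hL : ∀ v, ‖L v‖ ≤ B * ‖v‖ := fun v =>
    le_of_tendsto (hℓ v).norm (Eventually.of_forall fun n =>
      (norm_inner_le_norm _ _).trans (mul_le_mul_of_nonneg_right (hB n) (norm_nonneg v)))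
  refine ⟨(InnerProductSpace.toDual ℝ H).symm (L.mkContinuous B hL), fun v => ?_⟩
  rw [InnerProductSpace.toDual_symm_apply]
  exact hℓ v

/-- Test against `y` itself. The bounds may depend on `n`, which lets the vanishing truncation error
disappear from the limiting estimate. -/
lemma norm_le_of_weak_limit {x : ℕ → H} {y : H} {β : ℕ → ℝ} {b : ℝ} (hx : ∀ n, ‖x n‖ ≤ β n)
    (hβ : Tendsto β atTop (𝓝 b))
    (h : ∀ v, Tendsto (fun n => inner ℝ (x n) v) atTop (𝓝 (inner ℝ y v))) : ‖y‖ ≤ b := by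
  have h1 : inner ℝ y y ≤ b * ‖y‖ := le_of_tendsto_of_tendsto' (h y) (hβ.mul_const _)
    (fun n => (real_inner_le_norm _ _).trans
      (mul_le_mul_of_nonneg_right (hx n) (norm_nonneg y)))
  have hb : 0 ≤ b := ge_of_tendsto' hβ fun n => (norm_nonneg _).trans (hx n)
  rw [real_inner_self_eq_norm_sq] at h1
  rcases (norm_nonneg y).eq_or_lt with h0 | h0
  · rw [← h0]; exact hb
  · exact le_of_mul_le_mul_right (by rw [← sq]; exact h1) h0

/-- A uniformly bounded, weakly equicontinuous sequence of curves has a weakly convergent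
subsequence. -/
theorem exists_subseq_weak_limit [CompleteSpace H] [SecondCountableTopology H]
    {ρ : ℕ → ℝ → H} {B : ℝ}
    (hB : ∀ n t, ‖ρ n t‖ ≤ B) {D : Set H} (hD : Dense D)
    (hequi : ∀ v ∈ D, ∃ h : ℝ → ℝ, Integrable h ∧
      ∀ n s t, |inner ℝ (ρ n t) v - inner ℝ (ρ n s) v| ≤ |∫ τ in s..t, h τ|) :
    ∃ φ : ℕ → ℕ, StrictMono φ ∧ ∃ y : ℝ → H,
      (∀ t v, Tendsto (fun n => inner ℝ (ρ (φ n) t) v) atTop (𝓝 (inner ℝ (y t) v))) ∧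
      ∀ v, Continuous fun t => inner ℝ (y t) v := by
  obtain ⟨D₀, hD₀D, hD₀c, hD₀⟩ := hD.exists_countable_dense_subset
  have : Countable D₀ := hD₀c
  have hB0 : 0 ≤ B := (norm_nonneg _).trans (hB 0 0)
  -- Diagonal extraction by Tychonoff: a product of intervals over countably many pairs (rational
  -- time, vector of a countable dense set).
  have hcpt : IsCompact (univ.pi fun p : ℚ × D₀ => Icc (-(B * ‖(p.2 : H)‖)) (B * ‖(p.2 : H)‖)) :=
    isCompact_univ_pi fun _ => isCompact_Icc
  obtain ⟨z, -, φ, hφ, hz⟩ := hcpt.tendsto_subseq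
    (x := fun n (p : ℚ × D₀) => inner ℝ (ρ n p.1) (p.2 : H)) (fun n p _ => by
      exact abs_le.1 ((abs_real_inner_le_norm _ _).trans
        (mul_le_mul_of_nonneg_right (hB _ _) (norm_nonneg _))))
  rw [tendsto_pi_nhds] at hz
  have hcauchy : ∀ t, ∀ v ∈ D₀, CauchySeq fun n => inner ℝ (ρ (φ n) t) v := by
    intro t v hv
    obtain ⟨h, hh, hle⟩ := hequi v (hD₀D hv)
    rw [Metric.cauchySeq_iff']
    intro ε hε
    have hcont := continuous_integral_from hh t
    -- Equicontinuity transfers the Cauchy property from a nearby rational time to `t`.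
    obtain ⟨q, hq⟩ : ∃ q : ℚ, |∫ τ in t..(q : ℝ), h τ| < ε / 3 := by
      have ho : IsOpen {s : ℝ | |∫ τ in t..s, h τ| < ε / 3} :=
        isOpen_lt hcont.abs continuous_const
      obtain ⟨_, hs, q, rfl⟩ := Rat.denseRange_cast.inter_open_nonempty _ ho
        ⟨t, by simpa using (by positivity : 0 < ε / 3)⟩
      exact ⟨q, hs⟩
    obtain ⟨N, hN⟩ := Metric.cauchySeq_iff'.1 (hz (q, ⟨v, hv⟩)).cauchySeq (ε / 3) (by positivity)
    refine ⟨N, fun n hn => ?_⟩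
    have h1 := hN n hn
    simp only [Function.comp] at h1
    rw [Real.dist_eq] at h1 ⊢
    have h2 := (hle (φ n) t q).trans_lt hq
    have h3 := (hle (φ N) t q).trans_lt hq
    rw [abs_lt] at *
    constructor <;> linarith [h1.1, h1.2, h2.1, h2.2, h3.1, h3.2]
  choose y hy using fun t => exists_weak_limit (fun n => hB (φ n) t)
    (cauchySeq_inner_of_dense (fun n => hB (φ n) t) hD₀ (hcauchy t))
  refine ⟨φ, hφ, y, hy, ?_⟩
  have hyB : ∀ t, ‖y t‖ ≤ B := fun t =>
    norm_le_of_weak_limit (fun n => hB (φ n) t) tendsto_const_nhds (hy t)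
  have hcontD : ∀ v ∈ D, Continuous fun t => inner ℝ (y t) v := by
    intro v hv
    obtain ⟨h, hh, hle⟩ := hequi v hv
    rw [continuous_iff_continuousAt]
    intro t
    have hb : ∀ s, |inner ℝ (y s) v - inner ℝ (y t) v| ≤ |∫ τ in t..s, h τ| := fun s =>
      le_of_tendsto ((hy s v).sub (hy t v)).abs (Eventually.of_forall fun n => hle (φ n) t s)
    rw [ContinuousAt, tendsto_iff_dist_tendsto_zero]
    refine squeeze_zero (g := fun s => |∫ τ in t..s, h τ|) (fun _ => dist_nonneg) hb ?_
    have := ((continuous_integral_from hh t).abs.tendsto t)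
    simpa using this
  intro v
  -- For general `v`, the function is a uniform limit of those with `v ∈ D`, because the curve `y`
  -- is bounded.
  refine continuous_of_uniform_approx_of_continuous fun u hu => ?_
  obtain ⟨ε, hε, hεu⟩ := Metric.mem_uniformity_dist.1 hu
  obtain ⟨v', hv', hd⟩ := hD.exists_dist_lt v (ε := ε / (B + 1)) (by positivity)
  refine ⟨fun t => inner ℝ (y t) v', hcontD v' hv', fun t => hεu ?_⟩
  rw [Real.dist_eq, ← inner_sub_right]
  refine (abs_real_inner_le_norm _ _).trans_lt ?_
  rw [dist_eq_norm] at hd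
  calc ‖y t‖ * ‖v - v'‖ ≤ (B + 1) * ‖v - v'‖ := by
        gcongr; exact (hyB t).trans (by linarith)
    _ < (B + 1) * (ε / (B + 1)) := by gcongr
    _ = ε := by field_simp

end WeakLimits

/-! ### Abstract existence and uniqueness for approximated evolution equations. -/

section Evolution

variable {H : Type*} [NormedAddCommGroup H] [InnerProductSpace ℝ H] [CompleteSpace H]
  [SecondCountableTopology H]

lemma abs_intervalIntegral_le_integral {f : ℝ → ℝ} (hf : Integrable f) (hf0 : ∀ t, 0 ≤ f t)
    (s t : ℝ) : |∫ τ in s..t, f τ| ≤ ∫ τ, f τ := by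
  rw [intervalIntegral.abs_integral_eq_abs_integral_uIoc,
    abs_of_nonneg (setIntegral_nonneg measurableSet_uIoc fun _ _ => hf0 _)]
  exact setIntegral_le_integral hf (Eventually.of_forall hf0)

/-- Existence of weakly continuous solutions of an evolution equation whose generator is a limit
of bounded operators `A n t` that are uniformly dissipative, forward and backward in time. -/
theorem exists_weak_evolution {A : ℕ → ℝ → H →L[ℝ] H} {T : ℝ} {c : ℕ → ℝ}
    (hc : ∀ n t, ‖A n t‖ ≤ c n) (hsupp : ∀ n t, t ∉ Icc 0 T → A n t = 0)
    (hA : ∀ n u, AEStronglyMeasurable (fun t => A n t u))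
    {k b : ℝ → ℝ} (hk : Integrable k) (hb : Integrable b) (hk0 : ∀ t, 0 ≤ k t)
    (hb0 : ∀ t, 0 ≤ b t)
    (hdiss : ∀ n t x, |inner ℝ (A n t x) x| ≤ (k t + b t / (n + 1)) * ‖x‖ ^ 2)
    {D : Set H} (hD : Dense D)
    (hDA : ∀ v ∈ D, ∃ h : ℝ → ℝ, Integrable h ∧ ∀ n t, ‖(A n t).adjoint v‖ ≤ h t)
    {g : ℝ → H} (hg : Integrable g) (t₀ : ℝ) (u₀ : H) :
    ∃ ρ : ℝ → H, (∀ v, Continuous fun t => inner ℝ (ρ t) v) ∧ ρ t₀ = u₀ ∧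
      (∀ t, ‖ρ t‖ ≤ (‖u₀‖ + 2 * |∫ τ in t₀..t, ‖g τ‖|) * Real.exp (2 * |∫ τ in t₀..t, k τ|)) ∧
      ∀ v v' ψ : ℝ → H, Integrable v' → (∀ s t, v t - v s = ∫ τ in s..t, v' τ) →
        (∃ h : ℝ → ℝ, Integrable h ∧ ∀ n t, ‖(A n t).adjoint (v t)‖ ≤ h t) →
        (∀ t, Tendsto (fun n => (A n t).adjoint (v t)) atTop (𝓝 (ψ t))) →
        ∀ t, inner ℝ (ρ t) (v t) = inner ℝ u₀ (v t₀) + ∫ τ in t₀..t,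
          (inner ℝ (g τ) (v τ) + inner ℝ (ρ τ) (v' τ) + inner ℝ (ρ τ) (ψ τ)) := by
  choose u huc hu0 hu using fun n => exists_linear_ode (hc n) (hA n) hg t₀ u₀
  -- Boundedness of `A n` gives only local integrability; the generators vanish off `[0, T]`.
  have hAu : ∀ n, Integrable fun t => A n t (u n t) := by
    intro n
    have hm := aestronglyMeasurable_clm_apply (hA n) (huc n).aestronglyMeasurable
    refine (integrableOn_iff_integrable_of_support_subset (s := Icc 0 T) ?_).1 ?_
    · intro t ht
      by_contra h
      exact ht (by simp [hsupp n t h])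
    · refine Integrable.mono' (g := fun t => c n * ‖u n t‖)
        (Continuous.integrableOn_Icc (by fun_prop)) hm.restrict
        (Eventually.of_forall fun t => (A n t).le_of_opNorm_le (hc n t) _)
  have hκ : ∀ n : ℕ, Integrable fun t => k t + b t / (n + 1) := fun n =>
    hk.add (hb.div_const _)
  have hκ0 : ∀ (n : ℕ) t, 0 ≤ k t + b t / (n + 1) := fun n t =>
    add_nonneg (hk0 t) (div_nonneg (hb0 t) (by positivity))
  have hbound : ∀ n t, ‖u n t‖ ≤ (‖u₀‖ + 2 * |∫ τ in t₀..t, ‖g τ‖|)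
      * Real.exp (2 * |∫ τ in t₀..t, (k τ + b τ / (n + 1))|) := by
    intro n t
    have := norm_le_of_linear_ode (hκ n) (hκ0 n) hg (hAu n) (hdiss n) (hu n) t₀ t
    rwa [hu0] at this
  -- A bound uniform in `n` and `t`, obtained from `b τ / (n + 1) ≤ b τ`.
  set B : ℝ := (‖u₀‖ + 2 * ∫ τ, ‖g τ‖) * Real.exp (2 * ∫ τ, (k τ + b τ)) with hBdef
  have hgn : ∀ t, |∫ τ in t₀..t, ‖g τ‖| ≤ ∫ τ, ‖g τ‖ := fun t =>
    abs_intervalIntegral_le_integral hg.norm (fun _ => norm_nonneg _) _ _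
  have hB : ∀ n t, ‖u n t‖ ≤ B := by
    intro n t
    refine (hbound n t).trans ?_
    have h1 : |∫ τ in t₀..t, (k τ + b τ / (n + 1))| ≤ ∫ τ, (k τ + b τ) := by
      refine (abs_intervalIntegral_le_integral (hκ n) (hκ0 n) _ _).trans ?_
      refine integral_mono (hκ n) (hk.add hb) fun τ => ?_
      have : b τ / (n + 1) ≤ b τ := div_le_self (hb0 τ) (by linarith [n.cast_nonneg (α := ℝ)])
      linarith
    have h2 := hgn t
    rw [hBdef]
    gcongr
  have hB0 : 0 ≤ B := (norm_nonneg _).trans (hB 0 0)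
  -- Pairing with a moving test curve places the generator on the curve through its adjoint, where a
  -- limit in `n` exists.
  have heq : ∀ n, ∀ v v' : ℝ → H, Integrable v' → (∀ s t, v t - v s = ∫ τ in s..t, v' τ) →
      ∀ s t, inner ℝ (u n t) (v t) - inner ℝ (u n s) (v s) = ∫ τ in s..t,
        (inner ℝ (g τ) (v τ) + inner ℝ (u n τ) (v' τ)
          + inner ℝ (u n τ) ((A n τ).adjoint (v τ))) := by
    intro n v v' hv' hv s t
    rw [inner_sub_inner_eq_integral ((hAu n).add hg) hv' (hu n) hv s t]
    refine intervalIntegral.integral_congr fun τ _ => ?_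
    simp only [Pi.add_apply, inner_add_left, ContinuousLinearMap.adjoint_inner_right]
    ring
  obtain ⟨φ, hφ, ρ, hρ, hρc⟩ := exists_subseq_weak_limit (ρ := u) hB hD (by
    intro v hv
    obtain ⟨h, hh, hle⟩ := hDA v hv
    refine ⟨fun t => ‖g t‖ * ‖v‖ + B * h t, (hg.norm.mul_const _).add (hh.const_mul _), ?_⟩
    intro n s t
    -- A constant test curve yields weak equicontinuity.
    have e := heq n (fun _ => v) (fun _ => 0) (integrable_zero _ _ _) (by simp) s t
    rw [e, ← Real.norm_eq_abs]
    refine intervalIntegral.norm_integral_le_abs_of_norm_le (Eventually.of_forall fun τ => ?_)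
      ((hg.norm.mul_const _).add (hh.const_mul _)).intervalIntegrable
    simp only [inner_zero_right, add_zero]
    refine (norm_add_le _ _).trans (add_le_add (norm_inner_le_norm _ _) ?_)
    refine (norm_inner_le_norm _ _).trans ?_
    exact mul_le_mul (hB n τ) (hle n τ) (norm_nonneg _) hB0)
  have hφt : Tendsto φ atTop atTop := hφ.tendsto_atTop
  refine ⟨ρ, hρc, ?_, ?_, ?_⟩
  · refine ext_inner_right ℝ fun v => tendsto_nhds_unique (hρ t₀ v) ?_
    simp only [hu0]
    exact tendsto_const_nhds
  · intro t
    refine norm_le_of_weak_limit (fun n => hbound (φ n) t) ?_ (hρ t)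
    refine Tendsto.const_mul _ ((Real.continuous_exp.tendsto _).comp (Tendsto.const_mul _ ?_))
    refine Tendsto.abs ?_
    have e : ∀ n : ℕ, ∫ τ in t₀..t, (k τ + b τ / ((φ n : ℝ) + 1))
        = (∫ τ in t₀..t, k τ) + (∫ τ in t₀..t, b τ) * (1 / ((φ n : ℝ) + 1)) := by
      intro n
      rw [intervalIntegral.integral_add hk.intervalIntegrable
        (hb.div_const _).intervalIntegrable, intervalIntegral.integral_div]
      ring
    simp only [e]
    have := ((tendsto_one_div_add_atTop_nhds_zero_nat (𝕜 := ℝ)).comp hφt).const_mul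
      (∫ τ in t₀..t, b τ)
    simpa using this.const_add (∫ τ in t₀..t, k τ)
  · rintro v v' ψ hv' hv ⟨h, hh, hle⟩ hψ t
    have hvc := continuous_of_primitive hv' hv
    have hψb : ∀ τ, ‖ψ τ‖ ≤ h τ := fun τ =>
      le_of_tendsto (hψ τ).norm (Eventually.of_forall fun n => hle n τ)
    have hadjm : ∀ n, AEStronglyMeasurable fun τ => (A n τ).adjoint (v τ) := fun n =>
      aestronglyMeasurable_clm_apply (fun w => aestronglyMeasurable_adjoint_apply (hA n) w)
        hvc.aestronglyMeasurable
    have hlhs : Tendsto (fun n => inner ℝ (u (φ n) t) (v t) - inner ℝ u₀ (v t₀)) atTop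
        (𝓝 (inner ℝ (ρ t) (v t) - inner ℝ u₀ (v t₀))) := (hρ t (v t)).sub_const _
    have hrhs : Tendsto (fun n => ∫ τ in t₀..t, (inner ℝ (g τ) (v τ) + inner ℝ (u (φ n) τ) (v' τ)
          + inner ℝ (u (φ n) τ) ((A (φ n) τ).adjoint (v τ)))) atTop
        (𝓝 (∫ τ in t₀..t,
          (inner ℝ (g τ) (v τ) + inner ℝ (ρ τ) (v' τ) + inner ℝ (ρ τ) (ψ τ)))) := by
      obtain ⟨V, hV⟩ := (isCompact_uIcc (a := t₀) (b := t)).exists_bound_of_continuousOn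
        hvc.continuousOn
      refine intervalIntegral.tendsto_integral_filter_of_dominated_convergence
        (fun τ => ‖g τ‖ * V + B * ‖v' τ‖ + B * h τ) ?_ ?_ ?_ ?_
      · refine Eventually.of_forall fun n => ?_
        exact (((hg.aestronglyMeasurable.inner hvc.aestronglyMeasurable).add
          ((huc _).aestronglyMeasurable.inner hv'.aestronglyMeasurable)).add
          ((huc _).aestronglyMeasurable.inner (hadjm _))).restrict
      · refine Eventually.of_forall fun n => Eventually.of_forall fun τ hτ => ?_
        refine (norm_add_le _ _).trans (add_le_add ((norm_add_le _ _).trans (add_le_add ?_ ?_)) ?_)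
        · refine (norm_inner_le_norm _ _).trans ?_
          gcongr
          exact hV τ (uIoc_subset_uIcc hτ)
        · exact (norm_inner_le_norm _ _).trans
            (mul_le_mul_of_nonneg_right (hB _ _) (norm_nonneg _))
        · exact (norm_inner_le_norm _ _).trans
            (mul_le_mul (hB _ τ) (hle _ τ) (norm_nonneg _) hB0)
      · exact (((hg.norm.mul_const _).add (hv'.norm.const_mul _)).add
          (hh.const_mul _)).intervalIntegrable
      · refine Eventually.of_forall fun τ _ => ?_
        refine ((tendsto_const_nhds.add (hρ τ (v' τ)))).add ?_
        -- The pairing of a bounded, weakly convergent factor with a strongly convergent one passes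
        -- to the limit.
        have h1 : Tendsto (fun n => inner ℝ (u (φ n) τ) ((A (φ n) τ).adjoint (v τ) - ψ τ)) atTop
            (𝓝 0) := by
          have h2 : Tendsto (fun n => B * ‖(A (φ n) τ).adjoint (v τ) - ψ τ‖) atTop (𝓝 0) := by
            have := ((tendsto_iff_norm_sub_tendsto_zero.1 (hψ τ)).comp hφt).const_mul B
            simpa using this
          refine squeeze_zero_norm (fun n => ?_) h2
          exact (norm_inner_le_norm _ _).trans
            (mul_le_mul_of_nonneg_right (hB _ _) (norm_nonneg _))
        have h3 := h1.add (hρ τ (ψ τ))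
        rw [zero_add] at h3
        refine h3.congr fun n => ?_
        rw [← inner_add_right, sub_add_cancel]
    have hlim := tendsto_nhds_unique (hlhs.congr fun n => ?_) hrhs
    · linarith
    · rw [← heq (φ n) v v' hv' hv t₀ t, hu0]

/-- Uniqueness of weak solutions from regularizations `M n` with controlled commutators. -/
theorem eq_zero_of_regularization {σ : ℝ → H} {B : ℝ} (hσB : ∀ t, ‖σ t‖ ≤ B)
    (hσm : AEStronglyMeasurable σ) {M : ℕ → H →L[ℝ] H} {N : ℕ → ℝ → H →L[ℝ] H}
    {ν : ℕ → ℝ → ℝ} (hν : ∀ n, Integrable (ν n)) (hN : ∀ n t, ‖N n t‖ ≤ ν n t)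
    (hNm : ∀ n f, AEStronglyMeasurable fun t => N n t f) {t₀ : ℝ}
    (heq : ∀ n f t, inner ℝ (M n (σ t)) f = ∫ τ in t₀..t, inner ℝ (σ τ) (N n τ f))
    {κ : ℝ → ℝ} (hκ : Integrable κ)
    (hcomm : ∀ n t f, |inner ℝ f (N n t (M n f))| ≤ κ t * ‖f‖ ^ 2)
    (hM : ∀ f, Tendsto (fun n => M n f) atTop (𝓝 f)) (t : ℝ) : σ t = 0 := by
  have hB0 : 0 ≤ B := (norm_nonneg _).trans (hσB 0)
  -- The curve `M n (σ t)` has derivative `(N n t)† (σ t)`, so its energy grows at rate `2 ⟨σ, N n t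
  -- (M n σ)⟩`. The commutator bound is in terms of `‖σ‖`, not `‖M n σ‖`; the two sides match only
  -- after `n → ∞`.
  have hest : ∀ n t, ‖M n (σ t)‖ ^ 2 ≤ |∫ τ in t₀..t, (2 * |κ τ|) * ‖σ τ‖ ^ 2| := by
    intro n t
    set u' : ℝ → H := fun τ => (N n τ).adjoint (σ τ) with hu'def
    have hu'm : AEStronglyMeasurable u' :=
      aestronglyMeasurable_clm_apply (fun w => aestronglyMeasurable_adjoint_apply (hNm n) w) hσm
    have hu' : Integrable u' := by
      refine Integrable.mono' (g := fun τ => ν n τ * B) ((hν n).mul_const _) hu'm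
        (Eventually.of_forall fun τ => ?_)
      refine ((N n τ).adjoint.le_opNorm _).trans ?_
      rw [LinearIsometryEquiv.norm_map]
      exact mul_le_mul (hN n τ) (hσB τ) (norm_nonneg _) ((norm_nonneg _).trans (hN n τ))
    have hu : ∀ s t, M n (σ t) - M n (σ s) = ∫ τ in s..t, u' τ := by
      have h0 : ∀ t, M n (σ t) = ∫ τ in t₀..t, u' τ := by
        intro t
        refine ext_inner_right ℝ fun f => ?_
        rw [heq]
        have := ContinuousLinearMap.intervalIntegral_comp_comm (innerSL ℝ f)
          (hu'.intervalIntegrable (a := t₀) (b := t))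
        simp only [innerSL_apply_apply] at this
        rw [real_inner_comm, ← this]
        refine intervalIntegral.integral_congr fun τ _ => ?_
        simp only [hu'def]
        rw [ContinuousLinearMap.adjoint_inner_right, real_inner_comm]
      intro s t
      rw [h0, h0, integral_sub_from hu']
    have e := inner_sub_inner_eq_integral hu' hu' hu hu t₀ t
    have h00 : M n (σ t₀) = 0 := by
      refine ext_inner_right ℝ fun f => ?_
      rw [heq]; simp
    rw [h00, inner_zero_left, sub_zero, real_inner_self_eq_norm_sq] at e
    rw [e]
    refine (le_abs_self _).trans ?_
    rw [← Real.norm_eq_abs]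
    refine intervalIntegral.norm_integral_le_abs_of_norm_le (Eventually.of_forall fun τ => ?_) ?_
    · rw [real_inner_comm (u' τ) (M n (σ τ)), ← two_mul, hu'def]
      simp only
      rw [ContinuousLinearMap.adjoint_inner_left, Real.norm_eq_abs, abs_mul, abs_two, mul_assoc]
      have h1 := hcomm n τ (σ τ)
      have h2 : κ τ * ‖σ τ‖ ^ 2 ≤ |κ τ| * ‖σ τ‖ ^ 2 := by gcongr; exact le_abs_self _
      linarith
    · refine Integrable.intervalIntegrable ?_
      refine Integrable.mono' (g := fun τ => 2 * |κ τ| * B ^ 2) ((hκ.abs.const_mul 2).mul_const _)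
        ((hκ.abs.const_mul 2).aestronglyMeasurable.mul (hσm.norm.pow 2))
        (Eventually.of_forall fun τ => ?_)
      rw [Real.norm_of_nonneg (by positivity)]
      have := hσB τ
      gcongr
  have hlim : ∀ t, ‖σ t‖ ^ 2 ≤ 0 + |∫ τ in t₀..t, (2 * |κ τ|) * ‖σ τ‖ ^ 2| := by
    intro t
    rw [zero_add]
    exact le_of_tendsto ((hM (σ t)).norm.pow 2) (Eventually.of_forall fun n => hest n t)
  have := gronwall (f := fun t => ‖σ t‖ ^ 2) (κ := fun t => 2 * |κ t|) (B := B ^ 2) (t₀ := t₀)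
    (t₁ := t) (hκ.abs.const_mul 2) (fun t => by positivity) (hσm.norm.pow 2)
    (fun t => by positivity) (fun t _ => by have := hσB t; gcongr) le_rfl
    (fun t _ => hlim t) t right_mem_uIcc
  rw [zero_mul] at this
  have h0 : ‖σ t‖ ^ 2 = 0 := le_antisymm this (by positivity)
  simpa using h0

end Evolution

/-! ### Translation, convolution and multiplication operators on `L²`. -/

section L2Operators

variable {d : ℕ}

/-- The space `L²(ℝ^d)`. -/
abbrev L2 (d : ℕ) : Type := Lp ℝ 2 (volume : Measure (Rd d))

instance : Fact ((2 : ℝ≥0∞) ≠ ⊤) := ⟨by simp⟩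

lemma inner_L2_eq (u v : L2 d) : inner ℝ u v = ∫ x, u x * v x := by
  rw [L2.inner_def]
  refine integral_congr_ae (Eventually.of_forall fun x => ?_)
  simp [mul_comm]

/-- The class in `L²` of a square integrable function, and `0` for other functions. -/
def toL2 (h : Rd d → ℝ) : L2 d :=
  open Classical in if hh : MemLp h 2 volume then hh.toLp h else 0

lemma coeFn_toL2 {h : Rd d → ℝ} (hh : MemLp h 2 volume) : toL2 h =ᵐ[volume] h := by
  rw [toL2, dif_pos hh]; exact hh.coeFn_toLp

lemma toL2_coeFn (u : L2 d) : toL2 (fun x => u x) = u := by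
  rw [toL2, dif_pos (Lp.memLp u)]; exact Lp.toLp_coeFn u _

lemma toL2_congr {h h' : Rd d → ℝ} (e : h =ᵐ[volume] h') : toL2 h = toL2 h' := by
  by_cases hh : MemLp h 2 volume
  · have hh' : MemLp h' 2 volume := (memLp_congr_ae e).1 hh
    rw [toL2, toL2, dif_pos hh, dif_pos hh']
    exact (MemLp.toLp_eq_toLp_iff hh hh').2 e
  · have hh' : ¬ MemLp h' 2 volume := fun h2 => hh ((memLp_congr_ae e).2 h2)
    rw [toL2, toL2, dif_neg hh, dif_neg hh']

lemma eq_toL2 {u : L2 d} {h : Rd d → ℝ} (e : u =ᵐ[volume] h) : u = toL2 h := by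
  rw [← toL2_coeFn u]; exact toL2_congr e

lemma memLp_of_compact {h : Rd d → ℝ} (hc : Continuous h) (hs : HasCompactSupport h) :
    MemLp h 2 volume := hc.memLp_of_hasCompactSupport hs

lemma inner_toL2_right (u : L2 d) {h : Rd d → ℝ} (hh : MemLp h 2 volume) :
    inner ℝ u (toL2 h) = ∫ x, u x * h x := by
  rw [inner_L2_eq]
  refine integral_congr_ae ?_
  filter_upwards [coeFn_toL2 hh] with x hx
  rw [hx]

lemma inner_toL2_toL2 {h h' : Rd d → ℝ} (hh : MemLp h 2 volume) (hh' : MemLp h' 2 volume) :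
    inner ℝ (toL2 h) (toL2 h') = ∫ x, h x * h' x := by
  rw [inner_toL2_right _ hh']
  refine integral_congr_ae ?_
  filter_upwards [coeFn_toL2 hh] with x hx
  rw [hx]

lemma toL2_sub {h h' : Rd d → ℝ} (hh : MemLp h 2 volume) (hh' : MemLp h' 2 volume) :
    toL2 h - toL2 h' = toL2 (fun x => h x - h' x) := by
  refine eq_toL2 ?_
  filter_upwards [Lp.coeFn_sub (toL2 h) (toL2 h'), coeFn_toL2 hh, coeFn_toL2 hh'] with x h1 h2 h3
  rw [h1, Pi.sub_apply, h2, h3]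

lemma toL2_add {h h' : Rd d → ℝ} (hh : MemLp h 2 volume) (hh' : MemLp h' 2 volume) :
    toL2 h + toL2 h' = toL2 (fun x => h x + h' x) := by
  refine eq_toL2 ?_
  filter_upwards [Lp.coeFn_add (toL2 h) (toL2 h'), coeFn_toL2 hh, coeFn_toL2 hh'] with x h1 h2 h3
  rw [h1, Pi.add_apply, h2, h3]

lemma toL2_smul (r : ℝ) {h : Rd d → ℝ} (hh : MemLp h 2 volume) :
    r • toL2 h = toL2 (fun x => r * h x) := by
  refine eq_toL2 ?_
  filter_upwards [Lp.coeFn_smul r (toL2 h), coeFn_toL2 hh] with x h1 h2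
  rw [h1, Pi.smul_apply, h2, smul_eq_mul]

lemma toL2_sum {ι : Type*} (s : Finset ι) {h : ι → Rd d → ℝ} (hh : ∀ i, MemLp (h i) 2 volume) :
    ∑ i ∈ s, toL2 (h i) = toL2 (fun x => ∑ i ∈ s, h i x) := by
  classical
  induction s using Finset.induction_on with
  | empty =>
    simp only [Finset.sum_empty]
    exact eq_toL2 (Lp.coeFn_zero _ _ _)
  | insert i s hi ih =>
    simp only [Finset.sum_insert hi]
    rw [ih, toL2_add (hh i) (memLp_finsetSum s fun i _ => hh i)]

lemma norm_toL2_sq {h : Rd d → ℝ} (hh : MemLp h 2 volume) : ‖toL2 h‖ ^ 2 = ∫ x, h x ^ 2 := by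
  rw [← real_inner_self_eq_norm_sq, inner_toL2_toL2 hh hh]
  simp only [sq]

/-- Elements of `L²` that agree against all test functions are equal. -/
lemma L2_ext_test {u v : L2 d} (h : ∀ φ : Rd d → ℝ, ContDiff ℝ ∞ φ → HasCompactSupport φ →
    inner ℝ u (toL2 φ) = inner ℝ v (toL2 φ)) : u = v := by
  refine Lp.ext ?_
  refine ae_eq_of_integral_contDiff_smul_eq ((Lp.memLp u).locallyIntegrable (by norm_num))
    ((Lp.memLp v).locallyIntegrable (by norm_num)) fun φ hφ hc => ?_
  have hm := memLp_of_compact hφ.continuous hc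
  have := h φ hφ hc
  rw [inner_toL2_right _ hm, inner_toL2_right _ hm] at this
  simpa only [smul_eq_mul, mul_comm] using this

/-- Translation by `z` on `L²`. -/
def shift (z : Rd d) : L2 d →L[ℝ] L2 d :=
  (Lp.compMeasurePreservingₗᵢ ℝ (fun x : Rd d => x - z)
    (measurePreserving_sub_right volume z)).toContinuousLinearMap

lemma coeFn_shift (z : Rd d) (u : L2 d) : shift z u =ᵐ[volume] fun x => u (x - z) :=
  Lp.coeFn_compMeasurePreserving u (measurePreserving_sub_right volume z)

lemma norm_shift (z : Rd d) (u : L2 d) : ‖shift z u‖ = ‖u‖ :=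
  Lp.norm_compMeasurePreserving u (measurePreserving_sub_right volume z)

lemma continuous_shift (u : L2 d) : Continuous fun z => shift z u := by
  let G : Rd d → C(Rd d, Rd d) := fun z => ⟨fun x => x - z, by fun_prop⟩
  have hG : Continuous G := ContinuousMap.continuous_of_continuous_uncurry _ (by
    simp only [G, Function.uncurry_def, ContinuousMap.coe_mk]; fun_prop)
  exact Continuous.compMeasurePreservingLp (f := fun _ => u) (g := G) continuous_const hG
    (fun z => measurePreserving_sub_right volume z) (by simp)

lemma shift_zero (u : L2 d) : shift 0 u = u := by
  refine Lp.ext ((coeFn_shift 0 u).trans ?_)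
  simp

lemma inner_shift (z : Rd d) (u v : L2 d) : inner ℝ (shift z u) v = inner ℝ u (shift (-z) v) := by
  rw [inner_L2_eq, inner_L2_eq,
    ← integral_sub_right_eq_self (fun x => u x * (shift (-z) v) x) z]
  refine integral_congr_ae ?_
  have h1 := (measurePreserving_sub_right (volume : Measure (Rd d)) z).quasiMeasurePreserving.ae
    (coeFn_shift (-z) v)
  filter_upwards [coeFn_shift z u, h1] with x h2 h3
  rw [h2, h3]
  simp

lemma integrable_smul_shift {f : Rd d → ℝ} (hf : Integrable f) (u : L2 d) :
    Integrable fun z => f z • shift z u := by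
  refine Integrable.mono' (g := fun z => ‖f z‖ * ‖u‖) (hf.norm.mul_const _)
    (hf.aestronglyMeasurable.smul (continuous_shift u).aestronglyMeasurable)
    (Eventually.of_forall fun z => ?_)
  rw [norm_smul, norm_shift]

/-- Convolution with an integrable function, as a bounded operator on `L²`. -/
def conv (f : Rd d → ℝ) : L2 d →L[ℝ] L2 d :=
  open Classical in
  if hf : Integrable f then
    LinearMap.mkContinuous
      { toFun := fun u => ∫ z, f z • shift z u
        map_add' := fun u v => by
          rw [← integral_add (integrable_smul_shift hf u) (integrable_smul_shift hf v)]
          simp only [map_add, smul_add]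
        map_smul' := fun r u => by
          rw [RingHom.id_apply, ← integral_smul]
          simp only [map_smul, smul_comm r] }
      (∫ z, ‖f z‖) (fun u => by
        refine (norm_integral_le_integral_norm _).trans (le_of_eq ?_)
        rw [← integral_mul_const]
        simp only [norm_smul, norm_shift])
  else 0

lemma conv_apply {f : Rd d → ℝ} (hf : Integrable f) (u : L2 d) :
    conv f u = ∫ z, f z • shift z u := by
  rw [conv, dif_pos hf]; rfl

lemma norm_conv_apply_le {f : Rd d → ℝ} (hf : Integrable f) (u : L2 d) :
    ‖conv f u‖ ≤ (∫ z, ‖f z‖) * ‖u‖ := by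
  rw [conv_apply hf]
  refine (norm_integral_le_integral_norm _).trans (le_of_eq ?_)
  rw [← integral_mul_const]
  simp only [norm_smul, norm_shift]

lemma inner_conv_left {f : Rd d → ℝ} (hf : Integrable f) (u v : L2 d) :
    inner ℝ (conv f u) v = ∫ z, f z * inner ℝ (shift z u) v := by
  rw [conv_apply hf, real_inner_comm]
  have := (innerSL ℝ v).integral_comp_comm (integrable_smul_shift hf u)
  simp only [innerSL_apply_apply] at this
  rw [← this]
  refine integral_congr_ae (Eventually.of_forall fun z => ?_)
  simp only [inner_smul_right, real_inner_comm]

/-- Translations by `z` and `-z` are adjoint to each other; a reflection of the integration variable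
does the rest. -/
lemma inner_conv {f : Rd d → ℝ} (hf : Integrable f) (u v : L2 d) :
    inner ℝ (conv f u) v = inner ℝ u (conv (fun z => f (-z)) v) := by
  rw [real_inner_comm (conv (fun z => f (-z)) v) u, inner_conv_left hf,
    inner_conv_left hf.comp_neg, ← integral_neg_eq_self]
  refine integral_congr_ae (Eventually.of_forall fun z => ?_)
  simp only [inner_shift, neg_neg]
  rw [real_inner_comm, inner_shift]

lemma conv_neg {f : Rd d → ℝ} (hf : Integrable f) (u : L2 d) :
    conv (fun z => -f z) u = - conv f u := by
  rw [conv_apply hf, conv_apply (f := fun z => -f z) hf.neg, ← integral_neg]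
  simp only [neg_smul]

/-- The pointwise convolution `x ↦ ∫ u(y) f(x - y) dy`. -/
def smear (f u : Rd d → ℝ) : Rd d → ℝ :=
  convolution u f (ContinuousLinearMap.lsmul ℝ ℝ) volume

lemma smear_apply (f u : Rd d → ℝ) (x : Rd d) : smear f u x = ∫ y, u y * f (x - y) := rfl

lemma smear_apply' (f u : Rd d → ℝ) (x : Rd d) : smear f u x = ∫ z, f z * u (x - z) := by
  rw [smear, convolution_eq_swap]
  refine integral_congr_ae (Eventually.of_forall fun z => ?_)
  simp [mul_comm]

lemma smear_comm (f u : Rd d → ℝ) : smear f u = smear u f := by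
  ext x; rw [smear_apply, smear_apply']

lemma locallyIntegrable_L2 (u : L2 d) :
    LocallyIntegrable (fun x => u x) (volume : Measure (Rd d)) :=
  (Lp.memLp u).locallyIntegrable (by norm_num)

lemma contDiff_smear {n : ℕ∞} {f u : Rd d → ℝ} (hf : ContDiff ℝ n f) (hc : HasCompactSupport f)
    (hu : LocallyIntegrable u volume) : ContDiff ℝ n (smear f u) :=
  hc.contDiff_convolution_right _ hu hf

lemma partialD_smear (i : Fin d) {f u : Rd d → ℝ} (hf : ContDiff ℝ 1 f) (hc : HasCompactSupport f)
    (hu : LocallyIntegrable u volume) :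
    partialD i (smear f u) = smear (partialD i f) u := by
  ext x
  rw [partialD, smear, (hc.hasFDerivAt_convolution_right _ hu hf x).fderiv]
  exact convolution_precompR_apply _ hu (hc.fderiv ℝ) (hf.continuous_fderiv (by simp)) x _

/-- The Bochner integral of translates and the pointwise integral have equal pairings with every
test function, by Fubini. Integrability on the product comes from Cauchy–Schwarz in `x` and
integrability of `f` in `z`. -/
lemma coeFn_conv {f : Rd d → ℝ} (hf : Continuous f) (hc : HasCompactSupport f) (u : L2 d) :
    conv f u =ᵐ[volume] smear f (fun x => u x) := by
  have hfi : Integrable f := hf.integrable_of_hasCompactSupport hc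
  have hsm : Continuous (smear f (fun x => u x)) :=
    hc.continuous_convolution_right _ (locallyIntegrable_L2 u) hf
  refine ae_eq_of_integral_contDiff_smul_eq (locallyIntegrable_L2 _) hsm.locallyIntegrable
    fun φ hφ hφc => ?_
  have hm := memLp_of_compact hφ.continuous hφc
  have e1 : ∫ x, φ x • (conv f u) x = inner ℝ (conv f u) (toL2 φ) := by
    rw [inner_toL2_right _ hm]; simp only [smul_eq_mul, mul_comm]
  have e2 : ∀ z, f z * inner ℝ (shift z u) (toL2 φ) = ∫ x, φ x * (f z * u (x - z)) := by
    intro z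
    rw [inner_toL2_right _ hm, ← integral_const_mul]
    refine integral_congr_ae ?_
    filter_upwards [coeFn_shift z u] with x hx
    rw [hx]; ring
  have hmeas : AEStronglyMeasurable (fun p : Rd d × Rd d => φ p.1 * (f p.2 * u (p.1 - p.2)))
      (volume.prod volume) := by
    refine (hφ.continuous.comp continuous_fst).aestronglyMeasurable.mul ?_
    exact AEStronglyMeasurable.convolution_integrand (ContinuousLinearMap.lsmul ℝ ℝ)
      hf.aestronglyMeasurable (Lp.aestronglyMeasurable u)
  have hint : Integrable (fun p : Rd d × Rd d => φ p.1 * (f p.2 * u (p.1 - p.2)))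
      (volume.prod volume) := by
    have key : ∀ z, Integrable (fun x => φ x * (f z * u (x - z))) ∧
        ∫ x, ‖φ x * (f z * u (x - z))‖ ≤ ‖f z‖ * (‖toL2 φ‖ * ‖u‖) := by
      intro z
      have hu : MemLp (fun x => u (x - z)) 2 volume :=
        (Lp.memLp u).comp_measurePreserving (measurePreserving_sub_right volume z)
      have h1 : Integrable (fun x => φ x * u (x - z)) := hm.integrable_mul hu
      have e : (fun x => φ x * (f z * u (x - z))) = fun x => f z * (φ x * u (x - z)) := by
        ext x; ring
      refine ⟨by rw [e]; exact h1.const_mul _, ?_⟩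
      simp only [norm_mul]
      have e' : (fun x => ‖φ x‖ * (‖f z‖ * ‖u (x - z)‖))
          = fun x => ‖f z‖ * (‖φ x‖ * ‖u (x - z)‖) := by
        ext x; ring
      rw [e', integral_const_mul]
      gcongr
      have e3 : ∫ x, ‖φ x‖ * ‖u (x - z)‖
          = inner ℝ (toL2 fun x => ‖φ x‖) (toL2 fun x => ‖u (x - z)‖) :=
        (inner_toL2_toL2 hm.norm hu.norm).symm
      rw [e3]
      refine (real_inner_le_norm _ _).trans (le_of_eq ?_)
      have n1 : ‖toL2 fun x => ‖φ x‖‖ = ‖toL2 φ‖ := by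
        rw [← sq_eq_sq₀ (norm_nonneg _) (norm_nonneg _), norm_toL2_sq hm.norm, norm_toL2_sq hm]
        simp
      have n2 : ‖toL2 fun x => ‖u (x - z)‖‖ = ‖u‖ := by
        rw [← norm_shift z u, eq_toL2 (coeFn_shift z u),
          ← sq_eq_sq₀ (norm_nonneg _) (norm_nonneg _), norm_toL2_sq hu.norm, norm_toL2_sq hu]
        simp
      rw [n1, n2]
    rw [integrable_prod_iff' hmeas]
    refine ⟨Eventually.of_forall fun z => (key z).1, ?_⟩
    refine Integrable.mono' (hfi.norm.mul_const (‖toL2 φ‖ * ‖u‖))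
      hmeas.norm.prod_swap.integral_prod_right' (Eventually.of_forall fun z => ?_)
    rw [Real.norm_of_nonneg (integral_nonneg fun _ => norm_nonneg _)]
    exact (key z).2
  rw [e1, inner_conv_left hfi]
  simp only [e2]
  rw [← integral_integral_swap hint]
  refine integral_congr_ae (Eventually.of_forall fun x => ?_)
  simp only
  rw [integral_const_mul, smear_apply', smul_eq_mul]

lemma conv_toL2 {f h : Rd d → ℝ} (hf : Continuous f) (hc : HasCompactSupport f)
    (hh : MemLp h 2 volume) : conv f (toL2 h) = toL2 (smear f h) := by
  refine eq_toL2 ((coeFn_conv hf hc _).trans (Eventually.of_forall fun x => ?_))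
  rw [smear_apply', smear_apply']
  refine integral_congr_ae ?_
  have h1 := (quasiMeasurePreserving_sub_left_of_right_invariant
    (volume : Measure (Rd d)) x).ae (coeFn_toL2 hh)
  filter_upwards [h1] with z hz
  rw [hz]

/-- Approximate identities converge strongly. -/
lemma tendsto_conv {f : ℕ → Rd d → ℝ} (hf : ∀ n, Integrable (f n)) (h0 : ∀ n x, 0 ≤ f n x)
    (h1 : ∀ n, ∫ x, f n x = 1) {r : ℕ → ℝ} (hr : Tendsto r atTop (𝓝 0))
    (hs : ∀ n x, r n ≤ ‖x‖ → f n x = 0) (u : L2 d) :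
    Tendsto (fun n => conv (f n) u) atTop (𝓝 u) := by
  rw [Metric.tendsto_atTop]
  intro ε hε
  have hc := (continuous_shift u).tendsto 0
  rw [shift_zero, Metric.tendsto_nhds_nhds] at hc
  obtain ⟨δ, hδ, hclose⟩ := hc (ε / 2) (by positivity)
  obtain ⟨N, hN⟩ := eventually_atTop.1 (hr.eventually (gt_mem_nhds hδ))
  refine ⟨N, fun n hn => ?_⟩
  rw [dist_eq_norm]
  -- Since `f n` has integral `1`, the error is an average of `shift z u - u`, where only small `z`
  -- contribute.
  have e : conv (f n) u - u = ∫ z, f n z • (shift z u - u) := by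
    simp only [smul_sub]
    rw [integral_sub (integrable_smul_shift (hf n) u) ((hf n).smul_const u), conv_apply (hf n),
      integral_smul_const, h1, one_smul]
  rw [e]
  have : ‖∫ z, f n z • (shift z u - u)‖ ≤ ∫ z, f n z * (ε / 2) := by
    refine norm_integral_le_of_norm_le ((hf n).mul_const _) (Eventually.of_forall fun z => ?_)
    rw [norm_smul, Real.norm_of_nonneg (h0 n z)]
    by_cases hz : r n ≤ ‖z‖
    · rw [hs n z hz]; simp
    · refine mul_le_mul_of_nonneg_left ?_ (h0 n z)
      rw [← dist_eq_norm]
      refine (hclose ?_).le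
      rw [dist_zero_right]
      exact (not_le.1 hz).trans (hN n hn)
  rw [integral_mul_const, h1, one_mul] at this
  linarith

/-- Bounded continuous functions. -/
def IsBddCont (b : Rd d → ℝ) : Prop := Continuous b ∧ ∃ C : ℝ, ∀ x, |b x| ≤ C

lemma IsBddCont.of_compact {b : Rd d → ℝ} (hb : Continuous b) (hc : HasCompactSupport b) :
    IsBddCont b := ⟨hb, hc.exists_bound_of_continuous hb⟩

lemma IsBddCont.memLp_mul {b : Rd d → ℝ} (hb : IsBddCont b) {h : Rd d → ℝ}
    (hh : MemLp h 2 volume) : MemLp (fun x => b x * h x) 2 volume := by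
  obtain ⟨hc, C, hC⟩ := hb
  refine MemLp.of_le_mul (c := C) hh (hc.aestronglyMeasurable.mul hh.aestronglyMeasurable)
    (Eventually.of_forall fun x => ?_)
  rw [norm_mul]
  exact mul_le_mul_of_nonneg_right (hC x) (norm_nonneg _)

lemma norm_toL2_mul_le {b : Rd d → ℝ} (hb : IsBddCont b) {C : ℝ} (hC : ∀ x, |b x| ≤ C)
    (u : L2 d) : ‖toL2 (fun x => b x * u x)‖ ≤ C * ‖u‖ := by
  refine Lp.norm_le_mul_norm_of_ae_le_mul ?_
  filter_upwards [coeFn_toL2 (hb.memLp_mul (Lp.memLp u))] with x hx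
  rw [hx, norm_mul]
  exact mul_le_mul_of_nonneg_right (hC x) (norm_nonneg _)

/-- Multiplication by a bounded continuous function on `L²`. -/
def mulOp (b : Rd d → ℝ) : L2 d →L[ℝ] L2 d :=
  open Classical in
  if hb : IsBddCont b then
    LinearMap.mkContinuous
      { toFun := fun u => toL2 fun x => b x * u x
        map_add' := fun u v => by
          rw [toL2_add (hb.memLp_mul (Lp.memLp u)) (hb.memLp_mul (Lp.memLp v))]
          refine toL2_congr ?_
          filter_upwards [Lp.coeFn_add u v] with x hx
          rw [hx, Pi.add_apply, mul_add]
        map_smul' := fun r u => by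
          rw [RingHom.id_apply, toL2_smul r (hb.memLp_mul (Lp.memLp u))]
          refine toL2_congr ?_
          filter_upwards [Lp.coeFn_smul r u] with x hx
          rw [hx, Pi.smul_apply, smul_eq_mul]; ring }
      hb.2.choose (fun u => norm_toL2_mul_le hb hb.2.choose_spec u)
  else 0

lemma mulOp_apply {b : Rd d → ℝ} (hb : IsBddCont b) (u : L2 d) :
    mulOp b u = toL2 fun x => b x * u x := by
  rw [mulOp, dif_pos hb]; rfl

lemma coeFn_mulOp {b : Rd d → ℝ} (hb : IsBddCont b) (u : L2 d) :
    mulOp b u =ᵐ[volume] fun x => b x * u x := by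
  rw [mulOp_apply hb]; exact coeFn_toL2 (hb.memLp_mul (Lp.memLp u))

lemma norm_mulOp_le {b : Rd d → ℝ} (hb : IsBddCont b) {C : ℝ} (hC : ∀ x, |b x| ≤ C) (u : L2 d) :
    ‖mulOp b u‖ ≤ C * ‖u‖ := by
  rw [mulOp_apply hb]; exact norm_toL2_mul_le hb hC u

lemma mulOp_toL2 {b h : Rd d → ℝ} (hb : IsBddCont b) (hh : MemLp h 2 volume) :
    mulOp b (toL2 h) = toL2 fun x => b x * h x := by
  rw [mulOp_apply hb]
  refine toL2_congr ?_
  filter_upwards [coeFn_toL2 hh] with x hx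
  rw [hx]

lemma inner_mulOp {b : Rd d → ℝ} (hb : IsBddCont b) (u v : L2 d) :
    inner ℝ (mulOp b u) v = inner ℝ u (mulOp b v) := by
  rw [inner_L2_eq, inner_L2_eq]
  refine integral_congr_ae ?_
  filter_upwards [coeFn_mulOp hb u, coeFn_mulOp hb v] with x h1 h2
  rw [h1, h2]; ring

/-- The commutator of multiplication by a Lipschitz function and convolution with `f` is bounded
by the first absolute moment of `f`. -/
theorem norm_commutator_le {b : Rd d → ℝ} (hb : IsBddCont b) {K : ℝ}
    (hK : ∀ x y, |b x - b y| ≤ K * ‖x - y‖) {f : Rd d → ℝ} (hf : Integrable f)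
    (hf1 : Integrable fun z => ‖z‖ * ‖f z‖) (v : L2 d) :
    ‖mulOp b (conv f v) - conv f (mulOp b v)‖ ≤ K * (∫ z, ‖z‖ * ‖f z‖) * ‖v‖ := by
  -- Convolution averages translations, and the commutator with a single translation multiplies by
  -- `b x - b (x - z)`, at most `K * ‖z‖`.
  have e : mulOp b (conv f v) - conv f (mulOp b v)
      = ∫ z, f z • (mulOp b (shift z v) - shift z (mulOp b v)) := by
    simp only [smul_sub]
    rw [conv_apply hf, conv_apply hf, ← (mulOp b).integral_comp_comm (integrable_smul_shift hf v)]
    simp only [map_smul]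
    refine (integral_sub ?_ (integrable_smul_shift hf _)).symm
    have := (mulOp b).integrable_comp (integrable_smul_shift hf v)
    simpa only [map_smul] using this
  rw [e, mul_assoc, ← integral_mul_const, ← integral_const_mul]
  refine norm_integral_le_of_norm_le ((hf1.mul_const _).const_mul _)
    (Eventually.of_forall fun z => ?_)
  rw [norm_smul]
  have : ‖mulOp b (shift z v) - shift z (mulOp b v)‖ ≤ (K * ‖z‖) * ‖shift z v‖ := by
    refine Lp.norm_le_mul_norm_of_ae_le_mul ?_
    have h1 := (measurePreserving_sub_right (volume : Measure (Rd d)) z).quasiMeasurePreserving.ae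
      (coeFn_mulOp hb v)
    filter_upwards [Lp.coeFn_sub (mulOp b (shift z v)) (shift z (mulOp b v)),
      coeFn_mulOp hb (shift z v), coeFn_shift z (mulOp b v), coeFn_shift z v, h1]
      with x h2 h3 h4 h5 h6
    rw [h2, Pi.sub_apply, h3, h4, h6, h5, ← sub_mul, norm_mul]
    refine mul_le_mul_of_nonneg_right ?_ (norm_nonneg _)
    simpa using hK x (x - z)
  rw [norm_shift] at this
  calc ‖f z‖ * _ ≤ ‖f z‖ * (K * ‖z‖ * ‖v‖) := by gcongr
    _ = _ := by ring

/-- Multiplication operators depending measurably on a parameter. -/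
lemma aestronglyMeasurable_mulOp {b : ℝ → Rd d → ℝ} (hb : ∀ t, IsBddCont (b t))
    (hm : ∀ x, Measurable fun t => b t x) (u : L2 d) :
    AEStronglyMeasurable fun t => mulOp (b t) u := by
  refine aestronglyMeasurable_of_inner fun v => ?_
  -- A Carathéodory function, continuous in `x` and measurable in `t`, is jointly measurable.
  have hj : StronglyMeasurable (Function.uncurry fun t x => b t x) := by
    have := stronglyMeasurable_uncurry_of_continuous_of_stronglyMeasurable
      (u := fun x t => b t x) (fun t => (hb t).1) (fun x => (hm x).stronglyMeasurable)
    exact this.comp_measurable measurable_swap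
  have e : (fun t => inner ℝ v (mulOp (b t) u)) = fun t => ∫ x, b t x * (u x * v x) := by
    ext t
    rw [inner_L2_eq]
    refine integral_congr_ae ?_
    filter_upwards [coeFn_mulOp (hb t) u] with x hx
    rw [hx]; ring
  rw [e]
  have hw : AEStronglyMeasurable (fun x => u x * v x) (volume : Measure (Rd d)) :=
    (Lp.aestronglyMeasurable u).mul (Lp.aestronglyMeasurable v)
  have e2 : (fun t => ∫ x, b t x * (u x * v x)) = fun t => ∫ x, b t x * hw.mk _ x := by
    ext t
    refine integral_congr_ae ?_
    filter_upwards [hw.ae_eq_mk] with x hx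
    rw [hx]
  rw [e2]
  have : StronglyMeasurable (Function.uncurry fun t x => b t x * hw.mk _ x) :=
    hj.mul (hw.stronglyMeasurable_mk.comp_measurable measurable_snd)
  exact this.integral_prod_right.aestronglyMeasurable

end L2Operators

/-! ### Iterated partial derivatives, multi-indices and Fréchet derivatives. -/

section Words

variable {d : ℕ} {F : Type*} [NormedAddCommGroup F] [NormedSpace ℝ F]

/-- The iterated partial derivative along a word of coordinate directions. -/
def wordD (l : List (Fin d)) (f : Rd d → F) : Rd d → F := l.foldr partialD f

/-- The word `0^{α_0} 1^{α_1} ⋯` of a multi-index. -/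
def word (α : Fin d → ℕ) : List (Fin d) :=
  (List.finRange d).flatMap fun i => List.replicate (α i) i

@[simp] lemma wordD_nil (f : Rd d → F) : wordD [] f = f := rfl

@[simp] lemma wordD_cons (i : Fin d) (l : List (Fin d)) (f : Rd d → F) :
    wordD (i :: l) f = partialD i (wordD l f) := rfl

lemma wordD_append (l l' : List (Fin d)) (f : Rd d → F) :
    wordD (l ++ l') f = wordD l (wordD l' f) := by
  simp [wordD, List.foldr_append]

lemma wordD_replicate (n : ℕ) (i : Fin d) (f : Rd d → F) :
    wordD (List.replicate n i) f = (partialD i)^[n] f := by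
  induction n with
  | zero => rfl
  | succ n ih => rw [List.replicate_succ, wordD_cons, ih, Function.iterate_succ_apply']

lemma multiD_eq_wordD (α : Fin d → ℕ) (f : Rd d → F) : multiD α f = wordD (word α) f := by
  unfold multiD word
  induction List.finRange d with
  | nil => rfl
  | cons i l ih =>
    rw [List.foldr_cons, ih, List.flatMap_cons, wordD_append, wordD_replicate]

lemma count_word (α : Fin d → ℕ) (i : Fin d) : (word α).count i = α i := by
  unfold word
  rw [List.count_flatMap, ← Fin.sum_univ_def]
  simp [List.count_replicate]

lemma length_word (α : Fin d → ℕ) : (word α).length = ∑ i, α i := by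
  unfold word
  rw [List.length_flatMap, ← Fin.sum_univ_def]
  simp

lemma contDiff_partialD {k : ℕ} (i : Fin d) {f : Rd d → F} (hf : ContDiff ℝ (k + 1 : ℕ) f) :
    ContDiff ℝ k (partialD i f) :=
  (hf.fderiv_right (m := k) (by norm_cast)).clm_apply contDiff_const

lemma contDiff_wordD {k : ℕ} (l : List (Fin d)) {f : Rd d → F}
    (hf : ContDiff ℝ (k + l.length : ℕ) f) : ContDiff ℝ k (wordD l f) := by
  induction l generalizing k with
  | nil => simpa using hf
  | cons i l ih =>
    refine contDiff_partialD i (ih ?_)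
    convert hf using 2
    simp; ring

lemma contDiff_infty_wordD (l : List (Fin d)) {f : Rd d → F} (hf : ContDiff ℝ ∞ f) :
    ContDiff ℝ ∞ (wordD l f) :=
  contDiff_infty.2 fun _ => contDiff_wordD l (contDiff_infty.1 hf _)

lemma hasCompactSupport_wordD (l : List (Fin d)) {f : Rd d → F} (hf : HasCompactSupport f) :
    HasCompactSupport (wordD l f) := by
  induction l with
  | nil => exact hf
  | cons i l ih => exact ih.fderiv_apply ℝ _

lemma partialD_comm (i j : Fin d) {f : Rd d → F} (hf : ContDiff ℝ 2 f) :
    partialD i (partialD j f) = partialD j (partialD i f) := by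
  ext x
  have hs : IsSymmSndFDerivAt ℝ f x := hf.contDiffAt.isSymmSndFDerivAt (by simp)
  have hd : DifferentiableAt ℝ (fderiv ℝ f) x :=
    ((hf.fderiv_right (m := 1) (by norm_num)).differentiable (by simp)).differentiableAt
  have h : ∀ i j : Fin d, partialD i (partialD j f) x
      = fderiv ℝ (fderiv ℝ f) x (EuclideanSpace.single i 1) (EuclideanSpace.single j 1) := by
    intro i j
    change fderiv ℝ (fun y => fderiv ℝ f y (EuclideanSpace.single j 1)) x _ = _
    rw [fderiv_clm_apply hd (differentiableAt_const _)]
    simp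
  rw [h, h]
  exact hs _ _

/-- Schwarz' theorem for adjacent letters generates all permutations; words allow derivatives to be
composed freely before returning to multi-indices. -/
lemma wordD_perm {l l' : List (Fin d)} (h : l.Perm l') {f : Rd d → F}
    (hf : ContDiff ℝ l.length f) : wordD l f = wordD l' f := by
  induction h with
  | nil => rfl
  | cons i h ih =>
    rw [wordD_cons, wordD_cons, ih (hf.of_le (by simp))]
  | swap i j l =>
    simp only [wordD_cons]
    refine partialD_comm _ _ (contDiff_wordD (k := 2) l (hf.of_le ?_))
    norm_cast
    simp; omega
  | trans h1 h2 ih1 ih2 =>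
    rw [ih1 hf, ih2 (by rwa [← h1.length_eq])]

lemma wordD_eq_multiD {l : List (Fin d)} {f : Rd d → F} (hf : ContDiff ℝ l.length f) :
    wordD l f = multiD (fun i => l.count i) f := by
  rw [multiD_eq_wordD]
  refine wordD_perm (List.perm_iff_count.2 fun i => ?_) hf
  rw [count_word]

lemma wordD_eq_iteratedFDeriv (l : List (Fin d)) {f : Rd d → F} (hf : ContDiff ℝ l.length f)
    (x : Rd d) : wordD l f x
      = iteratedFDeriv ℝ l.length f x (fun i => EuclideanSpace.single (l.get i) 1) := by
  induction l generalizing x with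
  | nil => simp
  | cons i l ih =>
    have hf' : ContDiff ℝ l.length f := hf.of_le (by simp)
    rw [wordD_cons]
    have e : wordD l f = fun y => iteratedFDeriv ℝ l.length f y
        (fun i => EuclideanSpace.single (l.get i) 1) := funext fun y => ih hf' y
    have hd : DifferentiableAt ℝ (iteratedFDeriv ℝ l.length f) x :=
      (hf.differentiable_iteratedFDeriv (m := l.length) (by
        simp only [List.length_cons]; norm_cast; omega)).differentiableAt
    rw [partialD, e]
    simp only [List.length_cons]
    rw [iteratedFDeriv_succ_apply_left]
    have := (hd.hasFDerivAt.continuousMultilinear_apply_const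
      (fun i => EuclideanSpace.single (l.get i) (1 : ℝ))).fderiv
    rw [this]
    rfl

lemma norm_wordD_le (l : List (Fin d)) {f : Rd d → F} (hf : ContDiff ℝ l.length f)
    (x : Rd d) : ‖wordD l f x‖ ≤ ‖iteratedFDeriv ℝ l.length f x‖ := by
  rw [wordD_eq_iteratedFDeriv l hf]
  refine (ContinuousMultilinearMap.le_opNorm _ _).trans (le_of_eq ?_)
  simp

/-- Expand every argument in the standard basis, whose coordinates are bounded by the norm. -/
lemma norm_iteratedFDeriv_le_sum (n : ℕ) (f : Rd d → F) (x : Rd d) :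
    ‖iteratedFDeriv ℝ n f x‖ ≤ ∑ w : Fin n → Fin d,
      ‖iteratedFDeriv ℝ n f x (fun i => EuclideanSpace.single (w i) 1)‖ := by
  refine ContinuousMultilinearMap.opNorm_le_bound (Finset.sum_nonneg fun _ _ => norm_nonneg _)
    fun m => ?_
  have hm : m = fun i => ∑ j, (m i j) • EuclideanSpace.single j (1 : ℝ) := by
    ext i j
    simp [Pi.single_apply]
  conv_lhs => rw [hm]
  rw [ContinuousMultilinearMap.map_sum, Finset.sum_mul]
  refine (norm_sum_le _ _).trans (Finset.sum_le_sum fun w _ => ?_)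
  rw [ContinuousMultilinearMap.map_smul_univ, norm_smul, mul_comm, norm_prod]
  gcongr with i
  exact PiLp.norm_apply_le _ _

/-- The derivatives of order at most `k` are controlled by those along multi-indices. -/
lemma norm_iteratedFDeriv_le_multiD {n k : ℕ} (hn : n ≤ k) {f : Rd d → F} (hf : ContDiff ℝ k f)
    (x : Rd d) : ‖iteratedFDeriv ℝ n f x‖
      ≤ (d + 1) ^ k * ∑ α : MultiIndex d k, ‖multiD α.toFun f x‖ := by
  have hf' : ContDiff ℝ n f := hf.of_le (by exact_mod_cast hn)
  have hS : 0 ≤ ∑ α : MultiIndex d k, ‖multiD α.toFun f x‖ :=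
    Finset.sum_nonneg fun _ _ => norm_nonneg _
  refine (norm_iteratedFDeriv_le_sum n f x).trans ?_
  have key : ∀ w : Fin n → Fin d,
      ‖iteratedFDeriv ℝ n f x (fun i => EuclideanSpace.single (w i) 1)‖
        ≤ ∑ α : MultiIndex d k, ‖multiD α.toFun f x‖ := by
    intro w
    set l := List.ofFn w with hl
    have hlen : l.length = n := by simp [hl]
    have e1 : iteratedFDeriv ℝ n f x (fun i => EuclideanSpace.single (w i) 1) = wordD l f x := by
      rw [wordD_eq_iteratedFDeriv l (by rw [hlen]; exact hf')]
      have : ∀ (p : ℕ) (hp : p = n), iteratedFDeriv ℝ n f x (fun i => EuclideanSpace.single (w i) 1)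
          = iteratedFDeriv ℝ p f x
            (fun i => EuclideanSpace.single (w (Fin.cast hp i)) (1 : ℝ)) := by
        rintro p rfl; rfl
      rw [this l.length hlen]
      congr 1
      funext i
      congr 1
      simp only [hl, List.get_eq_getElem, List.getElem_ofFn]
      rfl
    have hcount : ∑ i, l.count i = n := by
      rw [← hlen, ← Multiset.coe_card, ← Multiset.toFinset_sum_count_eq]
      simp only [Multiset.coe_count]
      refine (Finset.sum_subset (Finset.subset_univ _) fun i _ hi => ?_).symm
      simpa [List.count_eq_zero] using hi
    let α : MultiIndex d k := ⟨fun i => ⟨l.count i, by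
      have : l.count i ≤ l.length := List.count_le_length
      omega⟩, by simp only [hcount]; exact hn⟩
    rw [e1, wordD_eq_multiD (by rw [hlen]; exact hf')]
    exact Finset.single_le_sum (f := fun α : MultiIndex d k => ‖multiD α.toFun f x‖)
      (fun _ _ => norm_nonneg _) (Finset.mem_univ α)
  refine (Finset.sum_le_sum fun w _ => key w).trans ?_
  rw [Finset.sum_const, nsmul_eq_mul]
  gcongr
  rw [Finset.card_univ, Fintype.card_fun, Fintype.card_fin, Fintype.card_fin]
  push_cast
  -- The base `d + 1` is at least `1`, which keeps the power monotone in the exponent even for `d =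
  -- 0`.
  calc (d : ℝ) ^ n ≤ (d + 1) ^ n := by gcongr; linarith
    _ ≤ (d + 1) ^ k := pow_le_pow_right₀ (by linarith [d.cast_nonneg (α := ℝ)]) hn

lemma integral_mul_partialD (i : Fin d) {f φ : Rd d → ℝ} (hf : ContDiff ℝ 1 f)
    (hφ : ContDiff ℝ 1 φ) (hc : HasCompactSupport φ) :
    ∫ x, f x * partialD i φ x = - ∫ x, partialD i f x * φ x := by
  have cf : Continuous (partialD i f) :=
    (contDiff_partialD (k := 0) i (by simpa using hf)).continuous
  have cφ : Continuous (partialD i φ) :=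
    (contDiff_partialD (k := 0) i (by simpa using hφ)).continuous
  refine integral_mul_fderiv_eq_neg_fderiv_mul_of_integrable
    ((cf.mul hφ.continuous).integrable_of_hasCompactSupport hc.mul_left)
    ((hf.continuous.mul cφ).integrable_of_hasCompactSupport
      (hasCompactSupport_wordD [i] hc).mul_left)
    ((hf.continuous.mul hφ.continuous).integrable_of_hasCompactSupport hc.mul_left)
    (fun x _ => hf.differentiable (by simp) x) (fun x _ => hφ.differentiable (by simp) x)

/-- Each integration by parts takes the outermost derivative off `φ` and makes it the innermost one
on `f`; the order is repaired by `wordD_perm`. -/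
lemma integral_mul_wordD (l : List (Fin d)) {f φ : Rd d → ℝ} (hf : ContDiff ℝ ∞ f)
    (hφ : ContDiff ℝ ∞ φ) (hc : HasCompactSupport φ) :
    ∫ x, f x * wordD l φ x = (-1) ^ l.length * ∫ x, wordD l f x * φ x := by
  induction l generalizing f with
  | nil => simp
  | cons i l ih =>
    have h1 : ∀ {g : Rd d → ℝ}, ContDiff ℝ ∞ g → ContDiff ℝ 1 g := fun hg => hg.of_le (by
      exact_mod_cast le_top)
    rw [wordD_cons, integral_mul_partialD i (h1 hf) (h1 (contDiff_infty_wordD l hφ))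
      (hasCompactSupport_wordD l hc), ih (f := partialD i f) (contDiff_infty_wordD [i] hf)]
    have : wordD l (partialD i f) = wordD (i :: l) f := by
      change wordD l (wordD [i] f) = _
      rw [← wordD_append]
      exact wordD_perm (List.perm_append_singleton i l) (contDiff_infty.1 hf _)
    rw [this, List.length_cons, pow_succ]
    ring

lemma wordD_smear (l : List (Fin d)) {f u : Rd d → ℝ} (hf : ContDiff ℝ l.length f)
    (hc : HasCompactSupport f) (hu : LocallyIntegrable u volume) :
    wordD l (smear f u) = smear (wordD l f) u := by
  induction l with
  | nil => rfl
  | cons i l ih =>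
    rw [wordD_cons, ih (hf.of_le (by simp)), wordD_cons]
    refine partialD_smear i (contDiff_wordD (k := 1) l (hf.of_le ?_))
      (hasCompactSupport_wordD l hc) hu
    simp [add_comm]

/-- Derivatives can be moved from one factor of a convolution to the other. -/
lemma smear_wordD_comm (l : List (Fin d)) {f h : Rd d → ℝ} (hf : ContDiff ℝ l.length f)
    (hfc : HasCompactSupport f) (hh : ContDiff ℝ l.length h) (hhc : HasCompactSupport h) :
    smear (wordD l f) h = smear f (wordD l h) := by
  rw [← wordD_smear l hf hfc hh.continuous.locallyIntegrable, smear_comm f h,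
    wordD_smear l hh hhc hf.continuous.locallyIntegrable, smear_comm]

/-- Gives the sign in a weak derivative tested against the kernel `y ↦ f (c - y)` of a convolution.
-/
lemma wordD_comp_const_sub (l : List (Fin d)) {f : Rd d → ℝ} (hf : ContDiff ℝ ∞ f) (c : Rd d) :
    wordD l (fun y => f (c - y)) = fun y => (-1) ^ l.length * wordD l f (c - y) := by
  induction l with
  | nil => simp
  | cons i l ih =>
    ext y
    rw [wordD_cons, ih]
    have hd : DifferentiableAt ℝ (wordD l f) (c - y) :=
      ((contDiff_infty_wordD l hf).differentiable (by simp)) _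
    have h2 := (hd.hasFDerivAt.comp y ((hasFDerivAt_id y).const_sub c)).const_mul
      ((-1 : ℝ) ^ l.length)
    have h3 : fderiv ℝ (fun y => (-1 : ℝ) ^ l.length * wordD l f (c - y)) y = _ := h2.fderiv
    rw [partialD, h3, wordD_cons, List.length_cons, pow_succ]
    simp [partialD]

end Words

/-! ### The Sobolev space as a separable Hilbert space. -/

section SobolevHilbert

variable {d m : ℕ}

lemma isWeakDeriv_iff {α : MultiIndex d m} {u v : L2 d} :
    IsWeakDeriv α u v ↔ ∀ φ : Rd d → ℝ, ContDiff ℝ ∞ φ → HasCompactSupport φ →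
      inner ℝ u (toL2 (multiD α.toFun φ)) = (-1) ^ α.length * inner ℝ v (toL2 φ) := by
  refine forall_congr' fun φ => forall_congr' fun hφ => forall_congr' fun hc => ?_
  have h1 := multiD_smooth_compact α.toFun ⟨hφ, hc⟩
  rw [inner_toL2_right _ (memLp_of_compact h1.1.continuous h1.2),
    inner_toL2_right _ (memLp_of_compact hφ.continuous hc)]

/-- The change of norm from the `ℓ²` to the `ℓ¹` sum. -/
def normChange (d m : ℕ) : PiLp 2 (fun _ : MultiIndex d m => L2 d) ≃L[ℝ]
    PiLp 1 (fun _ : MultiIndex d m => L2 d) :=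
  (PiLp.continuousLinearEquiv 2 ℝ _).trans (PiLp.continuousLinearEquiv 1 ℝ _).symm

/-- The Sobolev space as a subspace of the Hilbert sum of copies of `L²`. -/
def sobolevHilbert (d m : ℕ) : Submodule ℝ (PiLp 2 (fun _ : MultiIndex d m => L2 d)) :=
  (sobolevSubmodule d m).comap (normChange d m).toLinearMap

/-- The Sobolev space `H^m` with its Hilbert norm. -/
abbrev HS (d m : ℕ) : Type := sobolevHilbert d m

lemma mem_sobolevHilbert {U : PiLp 2 (fun _ : MultiIndex d m => L2 d)} :
    U ∈ sobolevHilbert d m ↔ ∀ α, IsWeakDeriv α (U (MultiIndex.zero d m)) (U α) := Iff.rfl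

/-- Each defining identity of a weak derivative equates two continuous functionals. Closedness is
what makes `HS` complete. -/
lemma isClosed_sobolevHilbert (d m : ℕ) :
    IsClosed (sobolevHilbert d m : Set (PiLp 2 (fun _ : MultiIndex d m => L2 d))) := by
  have e : (sobolevHilbert d m : Set (PiLp 2 (fun _ : MultiIndex d m => L2 d)))
      = ⋂ α : MultiIndex d m, ⋂ φ : Rd d → ℝ, ⋂ _ : ContDiff ℝ ∞ φ, ⋂ _ : HasCompactSupport φ,
        {U | inner ℝ (U (MultiIndex.zero d m)) (toL2 (multiD α.toFun φ))
          = (-1) ^ α.length * inner ℝ (U α) (toL2 φ)} := by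
    ext U
    simp only [SetLike.mem_coe, mem_sobolevHilbert, isWeakDeriv_iff, mem_iInter, mem_ofPred_eq]
  rw [e]
  refine isClosed_iInter fun α => isClosed_iInter fun φ => isClosed_iInter fun _ =>
    isClosed_iInter fun _ => isClosed_eq ?_ ?_ <;> fun_prop

instance : CompleteSpace (HS d m) := (isClosed_sobolevHilbert d m).completeSpace_coe

/-- Separability is required by the weak measurability criterion and by the diagonal extraction. -/
instance : SecondCountableTopology (PiLp 2 (fun _ : MultiIndex d m => L2 d)) :=
  (PiLp.continuousLinearEquiv 2 ℝ (fun _ : MultiIndex d m => L2 d)).toHomeomorph.secondCountableTopology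

/-- The identity from the Hilbert to the normed version of `H^m`. -/
def toHm : HS d m →L[ℝ] Hm d m :=
  ((normChange d m).toContinuousLinearMap ∘L (sobolevHilbert d m).subtypeL).codRestrict _
    fun U => U.2

/-- The identity from the normed to the Hilbert version of `H^m`. -/
def ofHm : Hm d m →L[ℝ] HS d m :=
  ((normChange d m).symm.toContinuousLinearMap ∘L (sobolevSubmodule d m).subtypeL).codRestrict _
    fun U => U.2

/-- The component `D^α U`. -/
def comp (α : MultiIndex d m) : HS d m →L[ℝ] L2 d :=
  (PiLp.proj 2 (fun _ : MultiIndex d m => L2 d) α : _ →L[ℝ] L2 d) ∘L (sobolevHilbert d m).subtypeL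

/-- The inclusion of `H^m` in `L²`. -/
def incl (d m : ℕ) : HS d m →L[ℝ] L2 d := comp (MultiIndex.zero d m)

lemma incl_ofHm (U : Hm d m) : incl d m (ofHm U) = U.toL2 := rfl

lemma comp_weakDeriv (U : HS d m) (α : MultiIndex d m) :
    IsWeakDeriv α (incl d m U) (comp α U) := U.2 α

lemma inner_HS (U V : HS d m) : inner ℝ U V = ∑ α, inner ℝ (comp α U) (comp α V) :=
  PiLp.inner_apply _ _

lemma norm_sq_HS (U : HS d m) : ‖U‖ ^ 2 = ∑ α, ‖comp α U‖ ^ 2 :=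
  PiLp.norm_sq_eq_of_L2 _ _

lemma norm_Hm (U : HS d m) : ‖toHm U‖ = ∑ α, ‖comp α U‖ := by
  change ‖(normChange d m) U.1‖ = _
  rw [PiLp.norm_eq_sum (by simp)]
  simp only [ENNReal.toReal_one, Real.rpow_one, div_one]
  rfl

lemma norm_comp_le (α : MultiIndex d m) (U : HS d m) : ‖comp α U‖ ≤ ‖U‖ :=
  PiLp.norm_apply_le U.1 α

lemma norm_toHm_le (U : HS d m) : ‖toHm U‖ ≤ Fintype.card (MultiIndex d m) * ‖U‖ := by
  rw [norm_Hm]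
  refine (Finset.sum_le_sum fun α _ => norm_comp_le α U).trans (le_of_eq ?_)
  simp

lemma norm_le_norm_toHm (U : HS d m) : ‖U‖ ≤ ‖toHm U‖ := by
  rw [← sq_le_sq₀ (norm_nonneg _) (norm_nonneg _), norm_sq_HS, norm_Hm]
  exact Finset.sum_sq_le_sq_sum_of_nonneg fun α _ => norm_nonneg _

lemma norm_ofHm_le (U : Hm d m) : ‖ofHm U‖ ≤ ‖U‖ := norm_le_norm_toHm (ofHm U)

lemma incl_injective : Function.Injective (incl d m) := by
  rw [injective_iff_map_eq_zero]
  intro U hU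
  have : ∀ α, comp α U = 0 := by
    intro α
    refine L2_ext_test fun φ hφ hc => ?_
    have := isWeakDeriv_iff.1 (comp_weakDeriv U α) φ hφ hc
    rw [hU, inner_zero_left] at this
    rw [inner_zero_left]
    have h1 : ((-1 : ℝ) ^ α.length) ≠ 0 := by simp
    rcases mul_eq_zero.1 this.symm with h | h
    · exact absurd h h1
    · exact h
  have h0 : ‖U‖ ^ 2 = 0 := by rw [norm_sq_HS]; simp [this]
  simpa using h0

/-- The vectors of `H^m` that represent the functionals `U ↦ ∫ U φ` of test functions `φ`. -/
def testVectors (d m : ℕ) : Submodule ℝ (HS d m) where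
  carrier := {v | ∃ φ : Rd d → ℝ, ContDiff ℝ ∞ φ ∧ HasCompactSupport φ ∧
    v = (incl d m).adjoint (toL2 φ)}
  zero_mem' := ⟨fun _ => 0, contDiff_const, HasCompactSupport.zero, by
    have : toL2 (fun _ : Rd d => (0 : ℝ)) = 0 := (eq_toL2 (Lp.coeFn_zero _ _ _)).symm
    rw [this, map_zero]⟩
  add_mem' := by
    rintro _ _ ⟨φ, hφ, hc, rfl⟩ ⟨ψ, hψ, hc', rfl⟩
    refine ⟨fun x => φ x + ψ x, hφ.add hψ, hc.add hc', ?_⟩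
    rw [← toL2_add (memLp_of_compact hφ.continuous hc) (memLp_of_compact hψ.continuous hc'),
      map_add]
  smul_mem' := by
    rintro r _ ⟨φ, hφ, hc, rfl⟩
    refine ⟨fun x => r * φ x, contDiff_const.mul hφ, hc.mul_left, ?_⟩
    rw [← toL2_smul r (memLp_of_compact hφ.continuous hc), map_smul]

/-- A vector orthogonal to all of them has zero integral against every test function, so its
underlying function vanishes. On these vectors the adjoint generators are controlled uniformly in
`n`. -/
lemma dense_testVectors : Dense (testVectors d m : Set (HS d m)) := by
  rw [Submodule.dense_iff_topologicalClosure_eq_top, Submodule.topologicalClosure_eq_top_iff,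
    Submodule.eq_bot_iff]
  intro U hU
  refine incl_injective (d := d) (m := m) ?_
  rw [map_zero]
  refine L2_ext_test fun φ hφ hc => ?_
  have := (Submodule.mem_orthogonal' _ _).1 hU _ ⟨φ, hφ, hc, rfl⟩
  rw [ContinuousLinearMap.adjoint_inner_right] at this
  rw [this, inner_zero_left]

/-- The element of `H^m` given by a smooth function with square integrable derivatives. -/
lemma isWeakDeriv_of_smooth {f : Rd d → ℝ} (hf : ContDiff ℝ ∞ f) (h0 : MemLp f 2 volume)
    {α : MultiIndex d m} (hα : MemLp (multiD α.toFun f) 2 volume) :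
    IsWeakDeriv α (toL2 f) (toL2 (multiD α.toFun f)) := by
  rw [isWeakDeriv_iff]
  intro φ hφ hc
  have h1 := multiD_smooth_compact α.toFun ⟨hφ, hc⟩
  rw [inner_toL2_toL2 h0 (memLp_of_compact h1.1.continuous h1.2),
    inner_toL2_toL2 hα (memLp_of_compact hφ.continuous hc), multiD_eq_wordD, multiD_eq_wordD,
    integral_mul_wordD _ hf hφ hc, length_word]
  rfl

end SobolevHilbert

/-! ### Mollifiers at scale `1 / (n + 1)`. -/

section Mollifier

/-- A fixed smooth even probability density supported in the unit ball. -/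
def baseBump (d : ℕ) : Rd d → ℝ :=
  (⟨1 / 2, 1, by norm_num, by norm_num⟩ : ContDiffBump (0 : Rd d)).normed volume

/-- The mollifier at scale `1 / (n + 1)`. -/
def moll (d n : ℕ) : Rd d → ℝ := fun x => (n + 1 : ℝ) ^ d * baseBump d ((n + 1 : ℝ) • x)

variable {d : ℕ}

lemma baseBump_smooth : ContDiff ℝ ∞ (baseBump d) := ContDiffBump.contDiff_normed _

lemma baseBump_compact : HasCompactSupport (baseBump d) := ContDiffBump.hasCompactSupport_normed _

lemma moll_smooth (n : ℕ) : ContDiff ℝ ∞ (moll d n) :=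
  contDiff_const.mul (baseBump_smooth.comp (contDiff_const_smul (n + 1 : ℝ)))

lemma moll_compact (n : ℕ) : HasCompactSupport (moll d n) := by
  have h : (n + 1 : ℝ) ≠ 0 := by positivity
  exact (baseBump_compact.comp_homeomorph (Homeomorph.smulOfNeZero (n + 1 : ℝ) h)).mul_left

lemma moll_nonneg (n : ℕ) (x : Rd d) : 0 ≤ moll d n x :=
  mul_nonneg (by positivity) (ContDiffBump.nonneg_normed _ _)

lemma moll_even (n : ℕ) (x : Rd d) : moll d n (-x) = moll d n x := by
  unfold moll baseBump
  rw [smul_neg, ContDiffBump.normed_neg]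

lemma moll_integrable (n : ℕ) : Integrable (moll d n) :=
  (moll_smooth n).continuous.integrable_of_hasCompactSupport (moll_compact n)

lemma integral_scaled (n : ℕ) (f : Rd d → ℝ) :
    ∫ x, (n + 1 : ℝ) ^ d * f ((n + 1 : ℝ) • x) = ∫ x, f x := by
  rw [integral_const_mul, Measure.integral_comp_smul]
  have h : (0 : ℝ) < (n + 1 : ℝ) ^ d := by positivity
  rw [finrank_euclideanSpace, Fintype.card_fin, abs_of_pos (inv_pos.2 h), smul_eq_mul,
    ← mul_assoc, mul_inv_cancel₀ h.ne', one_mul]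

lemma moll_integral (n : ℕ) : ∫ x, moll d n x = 1 := by
  unfold moll
  rw [integral_scaled]
  exact ContDiffBump.integral_normed _

lemma moll_eq_zero (n : ℕ) {x : Rd d} (hx : 1 / ((n : ℝ) + 1) ≤ ‖x‖) : moll d n x = 0 := by
  unfold moll baseBump
  have h : (0 : ℝ) < n + 1 := by positivity
  rw [div_le_iff₀ h] at hx
  refine mul_eq_zero_of_right _ (Function.notMem_support.1 ?_)
  rw [ContDiffBump.support_normed_eq, mem_ball_zero_iff, norm_smul, Real.norm_of_nonneg h.le,
    mul_comm]
  exact not_lt.2 hx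

lemma tendsto_moll (u : L2 d) : Tendsto (fun n => conv (moll d n) u) atTop (𝓝 u) :=
  tendsto_conv moll_integrable moll_nonneg moll_integral
    (tendsto_one_div_add_atTop_nhds_zero_nat (𝕜 := ℝ)) (fun n _ hx => moll_eq_zero n hx) u

lemma norm_moll_conv_le (n : ℕ) (u : L2 d) : ‖conv (moll d n) u‖ ≤ ‖u‖ := by
  refine (norm_conv_apply_le (moll_integrable n) u).trans (le_of_eq ?_)
  simp only [Real.norm_of_nonneg (moll_nonneg n _), moll_integral, one_mul]

lemma inner_moll_conv (n : ℕ) (u v : L2 d) :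
    inner ℝ (conv (moll d n) u) v = inner ℝ u (conv (moll d n) v) := by
  rw [inner_conv (moll_integrable n)]
  simp only [moll_even]

lemma partialD_moll (n : ℕ) (j : Fin d) (x : Rd d) : partialD j (moll d n) x
    = (n + 1 : ℝ) ^ d * ((n + 1 : ℝ) * partialD j (baseBump d) ((n + 1 : ℝ) • x)) := by
  have hd : DifferentiableAt ℝ (baseBump d) ((n + 1 : ℝ) • x) :=
    baseBump_smooth.differentiable (by simp) _
  have h := (hd.hasFDerivAt.comp x ((hasFDerivAt_id x).const_smul (n + 1 : ℝ))).const_mul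
    ((n + 1 : ℝ) ^ d)
  have h3 : fderiv ℝ (moll d n) x = _ := h.fderiv
  rw [partialD, h3]
  simp [partialD]

/-- The derivative of an even function is odd, so convolution with it is skew-adjoint. -/
lemma partialD_moll_neg (n : ℕ) (j : Fin d) (x : Rd d) :
    partialD j (moll d n) (-x) = - partialD j (moll d n) x := by
  have h := congrFun (wordD_comp_const_sub [j] (moll_smooth (d := d) n) 0) x
  simp only [zero_sub, moll_even, List.length_singleton, pow_one, wordD_cons, wordD_nil] at h
  rw [← neg_eq_iff_eq_neg.2 (h.trans (neg_one_mul _))]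

/-- The first moments of the gradients of the mollifiers do not depend on the scale. -/
lemma moment_moll (n : ℕ) (j : Fin d) : ∫ z, ‖z‖ * ‖partialD j (moll d n) z‖
    = ∫ z, ‖z‖ * ‖partialD j (baseBump d) z‖ := by
  rw [← integral_scaled n (fun z => ‖z‖ * ‖partialD j (baseBump d) z‖)]
  refine integral_congr_ae (Eventually.of_forall fun x => ?_)
  have h : (0 : ℝ) < n + 1 := by positivity
  simp only
  rw [partialD_moll, norm_smul, norm_mul, norm_mul, norm_pow, Real.norm_of_nonneg h.le]
  ring

end Mollifier

/-! ### Cutoffs at scale `n + 1`. -/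

section Cutoff

/-- A fixed smooth cutoff, equal to `1` on the unit ball and supported in the ball of radius `2`. -/
def baseCut (d : ℕ) : Rd d → ℝ :=
  (⟨1, 2, by norm_num, by norm_num⟩ : ContDiffBump (0 : Rd d))

/-- The cutoff at scale `n + 1`. -/
def cut (d n : ℕ) : Rd d → ℝ := fun x => baseCut d ((n + 1 : ℝ)⁻¹ • x)

variable {d : ℕ}

lemma baseCut_smooth : ContDiff ℝ ∞ (baseCut d) := ContDiffBump.contDiff _

lemma baseCut_compact : HasCompactSupport (baseCut d) := ContDiffBump.hasCompactSupport _

lemma cut_smooth (n : ℕ) : ContDiff ℝ ∞ (cut d n) :=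
  baseCut_smooth.comp (contDiff_const_smul (n + 1 : ℝ)⁻¹)

lemma cut_compact (n : ℕ) : HasCompactSupport (cut d n) := by
  have h : (n + 1 : ℝ)⁻¹ ≠ 0 := by positivity
  exact baseCut_compact.comp_homeomorph (Homeomorph.smulOfNeZero (n + 1 : ℝ)⁻¹ h)

lemma cut_nonneg (n : ℕ) (x : Rd d) : 0 ≤ cut d n x := ContDiffBump.nonneg _

lemma cut_le_one (n : ℕ) (x : Rd d) : cut d n x ≤ 1 := ContDiffBump.le_one _

lemma abs_cut_le_one (n : ℕ) (x : Rd d) : |cut d n x| ≤ 1 := by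
  rw [abs_of_nonneg (cut_nonneg n x)]; exact cut_le_one n x

lemma cut_eq_one (n : ℕ) {x : Rd d} (hx : ‖x‖ ≤ n + 1) : cut d n x = 1 := by
  refine ContDiffBump.one_of_mem_closedBall _ ?_
  have h : (0 : ℝ) < n + 1 := by positivity
  rw [mem_closedBall_zero_iff, norm_smul, norm_inv, Real.norm_of_nonneg h.le,
    inv_mul_le_iff₀ h, mul_one]
  exact hx

lemma cut_eq_zero (n : ℕ) {x : Rd d} (hx : 2 * (n + 1 : ℝ) ≤ ‖x‖) : cut d n x = 0 := by
  refine ContDiffBump.zero_of_le_dist _ ?_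
  have h : (0 : ℝ) < n + 1 := by positivity
  rw [dist_zero_right, norm_smul, norm_inv, Real.norm_of_nonneg h.le, le_inv_mul_iff₀ h]
  linarith

lemma cut_isBddCont (n : ℕ) : IsBddCont (cut d n) :=
  IsBddCont.of_compact (cut_smooth n).continuous (cut_compact n)

/-- Bounds for the derivatives of the cutoffs. -/
lemma exists_cut_bound (d k : ℕ) : ∃ c : ℝ, 0 ≤ c ∧ ∀ (n i : ℕ), i ≤ k → ∀ x : Rd d,
    ‖iteratedFDeriv ℝ i (cut d n) x‖ ≤ c / (n + 1) ^ i := by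
  have h : ∀ i : ℕ, ∃ c : ℝ, ∀ x : Rd d, ‖iteratedFDeriv ℝ i (baseCut d) x‖ ≤ c := fun i =>
    (baseCut_compact.iteratedFDeriv i).exists_bound_of_continuous
      (baseCut_smooth.continuous_iteratedFDeriv (by exact_mod_cast le_top))
  choose c hc using h
  have hc0 : ∀ i, 0 ≤ c i := fun i => (norm_nonneg _).trans (hc i 0)
  refine ⟨∑ i ∈ Finset.range (k + 1), c i, Finset.sum_nonneg fun i _ => hc0 i,
    fun n i hi x => ?_⟩
  have hn : (0 : ℝ) < n + 1 := by positivity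
  set L : Rd d →L[ℝ] Rd d := (n + 1 : ℝ)⁻¹ • ContinuousLinearMap.id ℝ (Rd d) with hL
  have e : cut d n = baseCut d ∘ L := by ext x; simp [cut, hL]
  rw [e, L.iteratedFDeriv_comp_right baseCut_smooth x (by exact_mod_cast le_top)]
  refine (ContinuousMultilinearMap.norm_compContinuousLinearMap_le _ _).trans ?_
  have hLn : ‖L‖ ≤ (n + 1 : ℝ)⁻¹ := by
    rw [hL, norm_smul, norm_inv, Real.norm_of_nonneg hn.le]
    exact mul_le_of_le_one_right (by positivity) ContinuousLinearMap.norm_id_le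
  rw [Finset.prod_const, Finset.card_univ, Fintype.card_fin, div_eq_mul_inv, ← inv_pow]
  have h1 : c i ≤ ∑ i ∈ Finset.range (k + 1), c i :=
    Finset.single_le_sum (fun i _ => hc0 i) (Finset.mem_range.2 (by omega))
  exact mul_le_mul ((hc i (L x)).trans h1) (by gcongr) (by positivity)
    (Finset.sum_nonneg fun i _ => hc0 i)

end Cutoff

/-! ### The `H^m` energy estimate for smooth functions. -/

section Energy

variable {d m : ℕ}

/-- Pointwise bound for the commutator of a differential monomial and a multiplication. -/
lemma abs_wordD_mul_sub_le {l : List (Fin d)} {f w : Rd d → ℝ} (hf : ContDiff ℝ l.length f)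
    (hw : ContDiff ℝ l.length w) {κ S : ℝ} (hκ0 : 0 ≤ κ) (hS0 : 0 ≤ S) (x : Rd d)
    (hκ : ∀ i, 1 ≤ i → i ≤ l.length → ‖iteratedFDeriv ℝ i f x‖ ≤ κ)
    (hS : ∀ i, i < l.length → ‖iteratedFDeriv ℝ i w x‖ ≤ S) :
    |wordD l (fun y => f y * w y) x - f x * wordD l w x| ≤ 2 ^ l.length * κ * S := by
  set N := l.length with hN
  have hfc : ContDiff ℝ N (fun y => f y - f x) := hf.sub contDiff_const
  -- Subtracting the constant `f x` kills the Leibniz term in which all derivatives fall on `w`, so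
  -- at most `l.length - 1` derivatives of `w` remain.
  have e : wordD l (fun y => f y * w y) x - f x * wordD l w x
      = wordD l (fun y => (f y - f x) * w y) x := by
    rw [wordD_eq_iteratedFDeriv l (hf.mul hw), wordD_eq_iteratedFDeriv l hw,
      wordD_eq_iteratedFDeriv l (hfc.mul hw)]
    have e1 : (fun y => (f y - f x) * w y) = (fun y => f y * w y) - (f x • w) := by
      ext y; simp [sub_mul]
    have h2 : ContDiffAt ℝ N (f x • w) x := (hw.const_smul (f x)).contDiffAt
    rw [e1, iteratedFDeriv_sub_apply (hf.mul hw).contDiffAt h2,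
      iteratedFDeriv_const_smul_apply hw.contDiffAt]
    simp
    rfl
  rw [e, ← Real.norm_eq_abs]
  refine (norm_wordD_le l (hfc.mul hw) x).trans ?_
  refine (norm_iteratedFDeriv_mul_le hfc hw x (n := N) le_rfl).trans ?_
  have hterm : ∀ i ∈ Finset.range (N + 1), (N.choose i : ℝ)
      * ‖iteratedFDeriv ℝ i (fun y => f y - f x) x‖ * ‖iteratedFDeriv ℝ (N - i) w x‖
      ≤ (N.choose i : ℝ) * (κ * S) := by
    intro i hi
    rw [Finset.mem_range] at hi
    rcases Nat.eq_zero_or_pos i with rfl | hi0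
    · rw [norm_iteratedFDeriv_zero, sub_self, norm_zero, mul_zero, zero_mul]
      positivity
    · have h1 : iteratedFDeriv ℝ i (fun y => f y - f x) x = iteratedFDeriv ℝ i f x := by
        have e2 : (fun y => f y - f x) = f - (fun _ => f x) := rfl
        rw [e2, iteratedFDeriv_sub_apply
          (hf.contDiffAt.of_le (by exact_mod_cast (by omega : i ≤ N)))
          contDiffAt_const, iteratedFDeriv_const_of_ne (by omega)]
        simp
      rw [h1, mul_assoc]
      refine mul_le_mul_of_nonneg_left ?_ (by positivity)
      exact mul_le_mul (hκ i hi0 (by omega))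
        (hS (N - i) (by omega)) (norm_nonneg _) hκ0
  refine (Finset.sum_le_sum hterm).trans ?_
  rw [← Finset.sum_mul, ← Nat.cast_sum, Nat.sum_range_choose]
  push_cast
  rw [mul_assoc]

lemma integral_abs_mul_le {f g : Rd d → ℝ} (hf : MemLp f 2 volume) (hg : MemLp g 2 volume) :
    ∫ x, |f x| * |g x| ≤ ‖toL2 f‖ * ‖toL2 g‖ := by
  have habs : ∀ {h : Rd d → ℝ}, MemLp h 2 volume → ‖toL2 fun x => |h x|‖ = ‖toL2 h‖ := by
    intro h hh
    have h' : MemLp (fun x => |h x|) 2 volume := hh.abs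
    rw [← sq_eq_sq₀ (norm_nonneg _) (norm_nonneg _), norm_toL2_sq h', norm_toL2_sq hh]
    simp
  have hf' : MemLp (fun x => |f x|) 2 volume := hf.abs
  have hg' : MemLp (fun x => |g x|) 2 volume := hg.abs
  rw [← habs hf, ← habs hg, ← inner_toL2_toL2 hf' hg']
  exact real_inner_le_norm _ _

/-- The components of a vector field. -/
def coord (b : Rd d → Rd d) (j : Fin d) : Rd d → ℝ := fun x => b x j

lemma contDiff_coord {k : ℕ∞} {b : Rd d → Rd d} (hb : ContDiff ℝ k b) (j : Fin d) :
    ContDiff ℝ k (coord b j) :=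
  (EuclideanSpace.proj (𝕜 := ℝ) j : Rd d →L[ℝ] ℝ).contDiff.comp hb

lemma hasCompactSupport_coord {b : Rd d → Rd d} (hb : HasCompactSupport b) (j : Fin d) :
    HasCompactSupport (coord b j) :=
  hb.comp_left (g := fun v : Rd d => v j) rfl

lemma abs_coord_le (b : Rd d → Rd d) (j : Fin d) (x : Rd d) : |coord b j x| ≤ ‖b x‖ :=
  PiLp.norm_apply_le (b x) j

lemma norm_iteratedFDeriv_coord_le {k : ℕ} {b : Rd d → Rd d} (hb : ContDiff ℝ k b) (j : Fin d)
    (x : Rd d) : ‖iteratedFDeriv ℝ k (coord b j) x‖ ≤ ‖iteratedFDeriv ℝ k b x‖ := by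
  have h := (EuclideanSpace.proj (𝕜 := ℝ) j : Rd d →L[ℝ] ℝ).norm_iteratedFDeriv_comp_left
    hb.contDiffAt (x := x) (n := k) le_rfl
  refine h.trans (mul_le_of_le_one_left (norm_nonneg _) ?_)
  exact ContinuousLinearMap.opNorm_le_bound _ zero_le_one fun v => by
    rw [one_mul]; exact PiLp.norm_apply_le v j

lemma abs_partialD_coord_le {b : Rd d → Rd d} (hb : ContDiff ℝ 1 b) (i j : Fin d)
    (x : Rd d) : |partialD i (coord b j) x| ≤ ‖iteratedFDeriv ℝ 1 b x‖ :=
  (norm_wordD_le [i] (contDiff_coord (k := 1) (by exact_mod_cast hb) j) x).trans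
    (norm_iteratedFDeriv_coord_le (k := 1) (by exact_mod_cast hb) j x)

/-- The transport term does not contribute to the energy beyond the divergence. -/
lemma abs_integral_transport_le {b : Rd d → Rd d} (hb : ContDiff ℝ 1 b)
    (hbc : HasCompactSupport b) {κ : ℝ} (hκ : ∀ x, ‖iteratedFDeriv ℝ 1 b x‖ ≤ κ)
    {z : Rd d → ℝ} (hz : ContDiff ℝ 1 z) (hzL : MemLp z 2 volume) (j : Fin d) :
    |∫ x, coord b j x * partialD j z x * z x| ≤ κ * ‖toL2 z‖ ^ 2 := by
  have hbj : ContDiff ℝ 1 (coord b j) := contDiff_coord (k := 1) (by exact_mod_cast hb) j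
  have hbp := integral_mul_partialD j (f := fun x => z x * z x) (φ := coord b j) (hz.mul hz) hbj
    (hasCompactSupport_coord hbc j)
  have e : ∀ x, partialD j (fun x => z x * z x) x = 2 * (z x * partialD j z x) := by
    intro x
    have hd : DifferentiableAt ℝ z x := hz.differentiable (by simp) x
    have h3 : fderiv ℝ (fun x => z x * z x) x = _ := (hd.hasFDerivAt.mul hd.hasFDerivAt).fderiv
    rw [partialD, h3]
    simp [partialD]; ring
  -- Since `z ∂_j z = ∂_j (z²) / 2`, integration by parts moves the derivative to `b`.
  have e2 : ∫ x, coord b j x * partialD j z x * z x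
      = -(1 / 2) * ∫ x, z x * z x * partialD j (coord b j) x := by
    rw [hbp, mul_neg, neg_mul, neg_neg, ← integral_const_mul]
    refine integral_congr_ae (Eventually.of_forall fun x => ?_)
    simp only [e]; ring
  have hκ0 : 0 ≤ κ := (norm_nonneg _).trans (hκ 0)
  have hzz : Integrable fun x => z x ^ 2 := hzL.integrable_sq
  have h3 : ‖∫ x, z x * z x * partialD j (coord b j) x‖ ≤ ∫ x, κ * z x ^ 2 := by
    refine norm_integral_le_of_norm_le (hzz.const_mul _) (Eventually.of_forall fun x => ?_)
    rw [norm_mul, ← sq, norm_pow, Real.norm_eq_abs, sq_abs, mul_comm]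
    exact mul_le_mul_of_nonneg_right ((abs_partialD_coord_le hb j j x).trans (hκ x))
      (sq_nonneg _)
  rw [integral_const_mul, ← norm_toL2_sq hzL, Real.norm_eq_abs] at h3
  rw [e2, abs_mul]
  have h4 : 0 ≤ κ * ‖toL2 z‖ ^ 2 := by positivity
  rw [abs_neg, abs_of_pos (by norm_num : (0 : ℝ) < 1 / 2)]
  linarith

/-- The constant of the energy estimate in `H^m`. -/
def energyConst (d m : ℕ) : ℝ :=
  Fintype.card (MultiIndex d m) * (d * (1 + 2 ^ (m + 1) * ((d + 1) ^ m
    * Fintype.card (MultiIndex d m))))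

lemma energyConst_nonneg (d m : ℕ) : 0 ≤ energyConst d m := by unfold energyConst; positivity

lemma length_word_le (α : MultiIndex d m) : (word α.toFun).length ≤ m := by
  rw [length_word]; exact α.2

/-- The `H^m` energy estimate for the transport operator `w ↦ div (b w)`. -/
theorem abs_energy_le {b : Rd d → Rd d} (hb : ContDiff ℝ (m + 1 : ℕ) b)
    (hbc : HasCompactSupport b) {κ : ℝ}
    (hκ : ∀ i, 1 ≤ i → i ≤ m + 1 → ∀ x, ‖iteratedFDeriv ℝ i b x‖ ≤ κ)
    {w : Rd d → ℝ} (hw : ContDiff ℝ ∞ w)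
    (hwL : ∀ α : MultiIndex d m, MemLp (multiD α.toFun w) 2 volume) :
    |∑ α : MultiIndex d m, ∑ j, ∫ x, wordD (word α.toFun ++ [j]) (fun y => coord b j y * w y) x
      * multiD α.toFun w x|
      ≤ energyConst d m * κ * ∑ α : MultiIndex d m, ‖toL2 (multiD α.toFun w)‖ ^ 2 := by
  set Q := ∑ α : MultiIndex d m, ‖toL2 (multiD α.toFun w)‖ ^ 2 with hQ
  have hQ0 : 0 ≤ Q := Finset.sum_nonneg fun _ _ => sq_nonneg _
  have hκ0 : 0 ≤ κ := (norm_nonneg _).trans (hκ 1 le_rfl (by omega) 0)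
  have hle : ∀ α : MultiIndex d m, ‖toL2 (multiD α.toFun w)‖ ^ 2 ≤ Q := fun α =>
    Finset.single_le_sum (f := fun α : MultiIndex d m => ‖toL2 (multiD α.toFun w)‖ ^ 2)
      (fun _ _ => sq_nonneg _) (Finset.mem_univ α)
  have hw' : ∀ k : ℕ, ContDiff ℝ k w := fun k => contDiff_infty.1 hw k
  have hb1 : ContDiff ℝ 1 b := hb.of_le (by exact_mod_cast (by omega : 1 ≤ m + 1))
  have key : ∀ (α : MultiIndex d m) (j : Fin d),
      |∫ x, wordD (word α.toFun ++ [j]) (fun y => coord b j y * w y) x * multiD α.toFun w x|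
      ≤ (1 + 2 ^ (m + 1) * ((d + 1) ^ m * Fintype.card (MultiIndex d m))) * κ * Q := by
    intro α j
    set l := word α.toFun ++ [j] with hl
    set z := multiD α.toFun w with hz
    have hlen : l.length ≤ m + 1 := by
      rw [hl, List.length_append, List.length_singleton]
      have := length_word_le α; omega
    have hzs : ContDiff ℝ ∞ z := by rw [hz, multiD_eq_wordD]; exact contDiff_infty_wordD _ hw
    have hz1 : ContDiff ℝ 1 z := hzs.of_le (by exact_mod_cast le_top)
    have hbj : ContDiff ℝ (m + 1 : ℕ) (coord b j) :=
      contDiff_coord (k := (m + 1 : ℕ)) (by exact_mod_cast hb) j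
    have hbjl : ContDiff ℝ l.length (coord b j) := hbj.of_le (by exact_mod_cast hlen)
    have hbjc := hasCompactSupport_coord hbc j
    have hlw : wordD l w = partialD j z := by
      rw [hz, multiD_eq_wordD, ← wordD_cons, hl]
      exact wordD_perm (List.perm_append_singleton j _) (hw' _)
    -- The remainder after removing the transport term. The word has length at most `m + 1`, so `r`
    -- involves only derivatives of `w` of order at most `m`, which the `H^m` norm controls.
    set r : Rd d → ℝ := fun x => wordD l (fun y => coord b j y * w y) x
      - coord b j x * partialD j z x with hr
    set S : Rd d → ℝ := fun x => (d + 1) ^ m * ∑ β : MultiIndex d m, ‖multiD β.toFun w x‖ with hS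
    have hS0 : ∀ x, 0 ≤ S x := fun x =>
      mul_nonneg (by positivity) (Finset.sum_nonneg fun _ _ => norm_nonneg _)
    have hrb : ∀ x, |r x| ≤ 2 ^ (m + 1) * κ * S x := by
      intro x
      have h1 := abs_wordD_mul_sub_le hbjl (hw' l.length) hκ0 (hS0 x) x
        (fun i hi1 hi2 => (norm_iteratedFDeriv_coord_le
          (hb.of_le (by exact_mod_cast (by omega : i ≤ m + 1))) j x).trans
          (hκ i hi1 (by omega) x))
        (fun i hi => norm_iteratedFDeriv_le_multiD (by omega) (hw' m) x)
      rw [hlw] at h1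
      refine h1.trans ?_
      have h2 : (2 : ℝ) ^ l.length ≤ 2 ^ (m + 1) := pow_le_pow_right₀ (by norm_num) hlen
      have := hS0 x
      gcongr
    have hprodc : Continuous (wordD l (fun y => coord b j y * w y)) :=
      (contDiff_wordD (k := 0) l (by rw [zero_add]; exact hbjl.mul (hw' _))).continuous
    have hprods : HasCompactSupport (wordD l (fun y => coord b j y * w y)) :=
      hasCompactSupport_wordD l hbjc.mul_right
    have hzc : Continuous (partialD j z) :=
      (contDiff_partialD (k := 0) j (by simpa using hz1)).continuous
    have i1 : Integrable fun x => coord b j x * partialD j z x * z x :=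
      ((hbj.continuous.mul hzc).mul hzs.continuous).integrable_of_hasCompactSupport
        (hbjc.mul_right.mul_right)
    have i2 : Integrable fun x => wordD l (fun y => coord b j y * w y) x * z x :=
      (hprodc.mul hzs.continuous).integrable_of_hasCompactSupport hprods.mul_right
    have e : ∫ x, wordD l (fun y => coord b j y * w y) x * z x
        = (∫ x, coord b j x * partialD j z x * z x) + ∫ x, r x * z x := by
      have i3 : Integrable fun x => r x * z x := by
        have := i2.sub i1
        refine this.congr (Eventually.of_forall fun x => ?_)
        simp only [hr, Pi.sub_apply]; ring
      rw [← integral_add i1 i3]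
      refine integral_congr_ae (Eventually.of_forall fun x => ?_)
      simp only [hr]; ring
    have hzL : MemLp z 2 volume := hwL α
    have b1 := abs_integral_transport_le hb1 hbc (hκ 1 le_rfl (by omega)) hz1 hzL j
    have hint : ∀ β : MultiIndex d m, Integrable fun x => |multiD β.toFun w x| * |z x| :=
      fun β => (hwL β).abs.integrable_mul hzL.abs
    have b2 : |∫ x, r x * z x|
        ≤ 2 ^ (m + 1) * ((d + 1) ^ m * Fintype.card (MultiIndex d m)) * κ * Q := by
      have h1 : ‖∫ x, r x * z x‖ ≤ ∫ x, 2 ^ (m + 1) * κ * (d + 1) ^ m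
          * ∑ β : MultiIndex d m, |multiD β.toFun w x| * |z x| := by
        refine norm_integral_le_of_norm_le
          ((integrable_finsetSum _ fun β _ => hint β).const_mul _)
          (Eventually.of_forall fun x => ?_)
        rw [norm_mul, Real.norm_eq_abs, Real.norm_eq_abs, ← Finset.sum_mul]
        have := hrb x
        simp only [hS, Real.norm_eq_abs] at this
        calc |r x| * |z x| ≤ (2 ^ (m + 1) * κ * ((d + 1) ^ m
              * ∑ β : MultiIndex d m, |multiD β.toFun w x|)) * |z x| := by gcongr
          _ = _ := by ring
      rw [integral_const_mul, integral_finsetSum _ fun β _ => hint β] at h1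
      have h2 : ∑ β : MultiIndex d m, ∫ x, |multiD β.toFun w x| * |z x|
          ≤ Fintype.card (MultiIndex d m) * Q := by
        have : ∀ β : MultiIndex d m, ∫ x, |multiD β.toFun w x| * |z x| ≤ Q := by
          intro β
          refine (integral_abs_mul_le (hwL β) hzL).trans ?_
          have h3 := hle β
          have h4 := hle α
          -- A product of two norms is at most the mean of their squares, each bounded by `Q`.
          nlinarith [sq_nonneg (‖toL2 (multiD β.toFun w)‖ - ‖toL2 z‖)]
        refine (Finset.sum_le_sum fun β _ => this β).trans (le_of_eq ?_)
        simp
      rw [← Real.norm_eq_abs]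
      refine h1.trans ?_
      calc 2 ^ (m + 1) * κ * ((d : ℝ) + 1) ^ m
            * ∑ β : MultiIndex d m, ∫ x, |multiD β.toFun w x| * |z x|
          ≤ 2 ^ (m + 1) * κ * ((d : ℝ) + 1) ^ m * (Fintype.card (MultiIndex d m) * Q) := by
            gcongr
        _ = _ := by ring
    rw [e]
    refine (abs_add_le _ _).trans ?_
    have b3 : κ * ‖toL2 z‖ ^ 2 ≤ κ * Q := mul_le_mul_of_nonneg_left (hle α) hκ0
    linarith
  refine (Finset.abs_sum_le_sum_abs _ _).trans ?_
  refine (Finset.sum_le_sum fun α _ => (Finset.abs_sum_le_sum_abs _ _).trans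
    (Finset.sum_le_sum fun j _ => key α j)).trans (le_of_eq ?_)
  simp only [Finset.sum_const, Finset.card_univ, Fintype.card_fin, nsmul_eq_mul, energyConst]
  ring

end Energy

/-! ### The regularized transport operators on `H^m`. -/

section Regularized

variable {d m : ℕ}

lemma memLp_smear {f : Rd d → ℝ} (hf : Continuous f) (hc : HasCompactSupport f) (u : L2 d) :
    MemLp (smear f (fun x => u x)) 2 volume :=
  (memLp_congr_ae (coeFn_conv hf hc u)).1 (Lp.memLp _)

lemma multiD_smear (α : Fin d → ℕ) {f : Rd d → ℝ} (hf : ContDiff ℝ ∞ f) (hc : HasCompactSupport f)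
    (u : L2 d) : multiD α (smear f (fun x => u x)) = smear (multiD α f) (fun x => u x) := by
  rw [multiD_eq_wordD, multiD_eq_wordD]
  exact wordD_smear _ (contDiff_infty.1 hf _) hc (locallyIntegrable_L2 u)

lemma conv_weakDeriv {f : Rd d → ℝ} (hf : ContDiff ℝ ∞ f) (hc : HasCompactSupport f) (u : L2 d)
    (α : MultiIndex d m) : IsWeakDeriv α (conv f u) (conv (multiD α.toFun f) u) := by
  have hα := multiD_smooth_compact α.toFun ⟨hf, hc⟩
  have e := multiD_smear α.toFun hf hc u
  have hm := memLp_smear hα.1.continuous hα.2 u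
  rw [eq_toL2 (coeFn_conv hf.continuous hc u), eq_toL2 (coeFn_conv hα.1.continuous hα.2 u), ← e]
  refine isWeakDeriv_of_smooth ?_ (memLp_smear hf.continuous hc u) (by rw [e]; exact hm)
  exact contDiff_smear (n := ⊤) hf hc (locallyIntegrable_L2 u)

lemma multiD_zero (f : Rd d → ℝ) : multiD (MultiIndex.zero d m).toFun f = f := by
  rw [multiD_eq_wordD]
  have : word (MultiIndex.zero d m).toFun = [] := by
    rw [← List.length_eq_zero_iff, length_word]
    simp [MultiIndex.toFun, MultiIndex.zero]
  rw [this, wordD_nil]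

/-- Convolution with a test function, as an operator from `L²` to `H^m`. -/
def convHS (m : ℕ) {f : Rd d → ℝ} (hf : ContDiff ℝ ∞ f) (hc : HasCompactSupport f) :
    L2 d →L[ℝ] HS d m :=
  ((PiLp.continuousLinearEquiv 2 ℝ (fun _ : MultiIndex d m => L2 d)).symm.toContinuousLinearMap
    ∘L ContinuousLinearMap.pi fun α => conv (multiD α.toFun f)).codRestrict _ fun u => by
      rw [mem_sobolevHilbert]
      intro α
      have := conv_weakDeriv hf hc u α
      change IsWeakDeriv α (conv (multiD (MultiIndex.zero d m).toFun f) u)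
        (conv (multiD α.toFun f) u)
      rwa [multiD_zero]

lemma comp_convHS {f : Rd d → ℝ} (hf : ContDiff ℝ ∞ f) (hc : HasCompactSupport f) (u : L2 d)
    (α : MultiIndex d m) : comp α (convHS m hf hc u) = conv (multiD α.toFun f) u := rfl

lemma incl_convHS {f : Rd d → ℝ} (hf : ContDiff ℝ ∞ f) (hc : HasCompactSupport f) (u : L2 d) :
    incl d m (convHS m hf hc u) = conv f u := by
  rw [incl, comp_convHS, multiD_zero]

/-- Mollifying the weak derivative differentiates the mollification. -/
lemma smear_comp {f : Rd d → ℝ} (hf : ContDiff ℝ ∞ f) (hc : HasCompactSupport f) (U : HS d m)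
    (α : MultiIndex d m) :
    smear f (fun x => comp α U x) = multiD α.toFun (smear f (fun x => incl d m U x)) := by
  rw [multiD_smear _ hf hc]
  ext x
  have hφ : ContDiff ℝ ∞ fun y => f (x - y) := hf.comp (contDiff_const.sub contDiff_id)
  have hφc : HasCompactSupport fun y => f (x - y) :=
    hc.comp_homeomorph (Homeomorph.subLeft x)
  have h := comp_weakDeriv U α _ hφ hφc
  rw [multiD_eq_wordD, wordD_comp_const_sub _ hf, length_word] at h
  rw [smear_apply, smear_apply, multiD_eq_wordD]
  have e : α.length = ∑ i, α.toFun i := rfl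
  rw [e] at h
  have h1 : ((-1 : ℝ) ^ (∑ i, α.toFun i)) * (-1) ^ (∑ i, α.toFun i) = 1 := by
    rw [← mul_pow]; simp
  have h2 : ∫ y, incl d m U y * ((-1) ^ (∑ i, α.toFun i) * wordD (word α.toFun) f (x - y))
      = (-1) ^ (∑ i, α.toFun i) * ∫ y, incl d m U y * wordD (word α.toFun) f (x - y) := by
    rw [← integral_const_mul]
    refine integral_congr_ae (Eventually.of_forall fun y => ?_)
    simp only; ring
  rw [h2] at h
  exact (mul_left_cancel₀ (left_ne_zero_of_mul_eq_one h1) h).symm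

lemma moll_deriv_smooth (n : ℕ) (j : Fin d) : ContDiff ℝ ∞ (partialD j (moll d n)) :=
  contDiff_infty_wordD [j] (moll_smooth n)

lemma moll_deriv_compact (n : ℕ) (j : Fin d) : HasCompactSupport (partialD j (moll d n)) :=
  hasCompactSupport_wordD [j] (moll_compact n)

/-- The regularized transport operator `U ↦ - J div (b J U)` on `H^m`. -/
def regOp (m n : ℕ) (b : Rd d → Rd d) : HS d m →L[ℝ] HS d m :=
  - ∑ j, convHS m (moll_deriv_smooth n j) (moll_deriv_compact n j) ∘L mulOp (coord b j)
    ∘L conv (moll d n) ∘L incl d m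

lemma regOp_apply (n : ℕ) (b : Rd d → Rd d) (U : HS d m) : regOp m n b U
    = - ∑ j, convHS m (moll_deriv_smooth n j) (moll_deriv_compact n j)
      (mulOp (coord b j) (conv (moll d n) (incl d m U))) := by
  simp [regOp]

/-- The operators `regOp` are bounded in terms of the supremum of the field. -/
lemma exists_norm_regOp_le (d m n : ℕ) : ∃ c : ℝ, 0 ≤ c ∧ ∀ (b : Rd d → Rd d), Continuous b →
    ∀ B : ℝ, (∀ x, ‖b x‖ ≤ B) → ‖regOp m n b‖ ≤ c * B := by
  refine ⟨∑ j, ‖convHS m (moll_deriv_smooth (d := d) n j) (moll_deriv_compact n j)‖,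
    Finset.sum_nonneg fun _ _ => ContinuousLinearMap.opNorm_nonneg _, fun b hb B hB => ?_⟩
  have hB0 : 0 ≤ B := (norm_nonneg _).trans (hB 0)
  refine ContinuousLinearMap.opNorm_le_bound _
    (mul_nonneg (Finset.sum_nonneg fun _ _ => ContinuousLinearMap.opNorm_nonneg _) hB0) fun U => ?_
  rw [regOp_apply, norm_neg, Finset.sum_mul, Finset.sum_mul]
  refine (norm_sum_le _ _).trans (Finset.sum_le_sum fun j _ => ?_)
  have hbj : IsBddCont (coord b j) := ⟨by unfold coord; fun_prop, B, fun x =>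
    (abs_coord_le b j x).trans (hB x)⟩
  refine (ContinuousLinearMap.le_opNorm _ _).trans ?_
  rw [mul_assoc]
  refine mul_le_mul_of_nonneg_left ?_ (ContinuousLinearMap.opNorm_nonneg _)
  refine (norm_mulOp_le hbj (fun x => (abs_coord_le b j x).trans (hB x)) _).trans ?_
  refine mul_le_mul_of_nonneg_left ?_ hB0
  exact (norm_moll_conv_le n _).trans (norm_comp_le _ U)

/-- Dissipativity of the regularized transport operators in `H^m`. -/
theorem abs_inner_regOp_le (n : ℕ) {b : Rd d → Rd d} (hb : ContDiff ℝ (m + 1 : ℕ) b)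
    (hbc : HasCompactSupport b) {κ : ℝ}
    (hκ : ∀ i, 1 ≤ i → i ≤ m + 1 → ∀ x, ‖iteratedFDeriv ℝ i b x‖ ≤ κ) (U : HS d m) :
    |inner ℝ (regOp m n b U) U| ≤ energyConst d m * κ * ‖U‖ ^ 2 := by
  set η := moll d n with hη
  have hηs : ContDiff ℝ ∞ η := moll_smooth n
  have hηc : HasCompactSupport η := moll_compact n
  have hκ0 : 0 ≤ κ := (norm_nonneg _).trans (hκ 1 le_rfl (by omega) 0)
  set w := smear η (fun x => incl d m U x) with hw
  have hws : ContDiff ℝ ∞ w := contDiff_smear (n := ⊤) hηs hηc (locallyIntegrable_L2 _)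
  have hD : ∀ α : MultiIndex d m, conv η (comp α U) = toL2 (multiD α.toFun w) := fun α => by
    rw [hw, ← smear_comp hηs hηc U α]
    exact eq_toL2 (coeFn_conv hηs.continuous hηc _)
  have hDL : ∀ α : MultiIndex d m, MemLp (multiD α.toFun w) 2 volume := fun α => by
    rw [hw, ← smear_comp hηs hηc U α]
    exact memLp_smear hηs.continuous hηc _
  have hwL : MemLp w 2 volume := memLp_smear hηs.continuous hηc _
  have hw0 : conv η (incl d m U) = toL2 w := eq_toL2 (coeFn_conv hηs.continuous hηc _)
  -- The derivatives `D^α ∂_j` sit on the mollifier kernel. They are moved onto `b_j w`, and the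
  -- remaining symmetric mollification passes to `D^α U`, where it produces `D^α w`.
  have hterm : ∀ (α : MultiIndex d m) (j : Fin d),
      inner ℝ (comp α (convHS m (moll_deriv_smooth n j) (moll_deriv_compact n j)
        (mulOp (coord b j) (conv η (incl d m U))))) (comp α U)
      = ∫ x, wordD (word α.toFun ++ [j]) (fun y => coord b j y * w y) x * multiD α.toFun w x := by
    intro α j
    set l := word α.toFun ++ [j] with hl
    have hlen : l.length ≤ m + 1 := by
      rw [hl, List.length_append, List.length_singleton]
      have := length_word_le α; omega
    have hbj : ContDiff ℝ (m + 1 : ℕ) (coord b j) :=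
      contDiff_coord (k := (m + 1 : ℕ)) (by exact_mod_cast hb) j
    have hbjc := hasCompactSupport_coord hbc j
    have hhs : ContDiff ℝ l.length (fun y => coord b j y * w y) :=
      (hbj.of_le (by exact_mod_cast hlen)).mul (contDiff_infty.1 hws _)
    have hhc : HasCompactSupport (fun y => coord b j y * w y) := hbjc.mul_right
    have e1 : multiD α.toFun (partialD j η) = wordD l η := by
      rw [multiD_eq_wordD, hl, wordD_append]; rfl
    rw [hw0, mulOp_toL2 (IsBddCont.of_compact hbj.continuous hbjc) hwL, comp_convHS, e1,
      conv_toL2 (contDiff_infty_wordD l hηs).continuous (hasCompactSupport_wordD l hηc)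
        (memLp_of_compact hhs.continuous hhc),
      smear_wordD_comm l (contDiff_infty.1 hηs _) hηc hhs hhc]
    have hlc : Continuous (wordD l (fun y => coord b j y * w y)) :=
      (contDiff_wordD (k := 0) l (by rw [zero_add]; exact hhs)).continuous
    have hlL := memLp_of_compact hlc (hasCompactSupport_wordD l hhc)
    rw [← conv_toL2 hηs.continuous hηc hlL, hη, inner_moll_conv, ← hη, hD,
      inner_toL2_toL2 hlL (hDL α)]
  have e : inner ℝ (regOp m n b U) U = -∑ α : MultiIndex d m, ∑ j,
      ∫ x, wordD (word α.toFun ++ [j]) (fun y => coord b j y * w y) x * multiD α.toFun w x := by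
    rw [regOp_apply, inner_neg_left, inner_HS]
    congr 1
    refine Finset.sum_congr rfl fun α _ => ?_
    rw [map_sum, sum_inner]
    exact Finset.sum_congr rfl fun j _ => hterm α j
  rw [e, abs_neg]
  refine (abs_energy_le hb hbc hκ hws hDL).trans ?_
  rw [norm_sq_HS]
  have := energyConst_nonneg d m
  gcongr with α
  rw [← hD]
  exact norm_moll_conv_le n _

/-- The adjoint of `regOp` on test vectors. -/
lemma adjoint_regOp (n : ℕ) {b : Rd d → Rd d} (hb : ∀ j, IsBddCont (coord b j)) {φ : Rd d → ℝ}
    (hφ : ContDiff ℝ ∞ φ) (hφc : HasCompactSupport φ) :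
    (regOp m n b).adjoint ((incl d m).adjoint (toL2 φ)) = (incl d m).adjoint
      (∑ j, conv (moll d n) (mulOp (coord b j) (conv (moll d n) (toL2 (partialD j φ))))) := by
  refine ext_inner_left ℝ fun U => ?_
  rw [ContinuousLinearMap.adjoint_inner_right, ContinuousLinearMap.adjoint_inner_right,
    ContinuousLinearMap.adjoint_inner_right, regOp_apply, map_neg, map_sum, inner_neg_left,
    sum_inner, inner_sum, ← Finset.sum_neg_distrib]
  refine Finset.sum_congr rfl fun j _ => ?_
  have hi : Integrable (partialD j (moll d n)) :=
    (moll_deriv_smooth n j).continuous.integrable_of_hasCompactSupport (moll_deriv_compact n j)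
  have e : (fun z => partialD j (moll d n) (-z)) = fun z => - partialD j (moll d n) z :=
    funext fun z => partialD_moll_neg n j z
  have hφj : ContDiff ℝ ∞ (partialD j φ) := contDiff_infty_wordD [j] hφ
  -- The derivative passes from the kernel to `φ`. The sign from the oddness of the differentiated
  -- kernel cancels the one in `regOp`.
  have e2 : conv (partialD j (moll d n)) (toL2 φ) = conv (moll d n) (toL2 (partialD j φ)) := by
    rw [conv_toL2 (moll_deriv_smooth n j).continuous (moll_deriv_compact n j)
      (memLp_of_compact hφ.continuous hφc), conv_toL2 (moll_smooth n).continuous (moll_compact n)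
      (memLp_of_compact hφj.continuous (hasCompactSupport_wordD [j] hφc))]
    exact congrArg toL2 (smear_wordD_comm [j] (contDiff_infty.1 (moll_smooth n) _) (moll_compact n)
      (contDiff_infty.1 hφ _) hφc)
  rw [incl_convHS, inner_conv hi, e, conv_neg hi, inner_neg_right, neg_neg, e2, inner_mulOp (hb j),
    inner_moll_conv]

end Regularized

/-! ### Regular drifts, their truncations and the transport of test functions. -/

section Fields

variable {d m : ℕ}

/-- A time dependent vector field, defined for every time, with derivatives of order `1, …, m + 1`
bounded by `k t`, with `‖a t 0‖ ≤ b t`, and vanishing for `t ∉ [0,T]`. -/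
structure RegularDrift (m : ℕ) (T : ℝ) (a : ℝ → Rd d → Rd d) (k b : ℝ → ℝ) : Prop where
  meas : ∀ x, Measurable fun t => a t x
  contDiff : ∀ t, ContDiff ℝ (m + 1 : ℕ) (a t)
  integrable_k : Integrable k
  integrable_b : Integrable b
  k_nonneg : ∀ t, 0 ≤ k t
  b_nonneg : ∀ t, 0 ≤ b t
  deriv_le : ∀ t i, 1 ≤ i → i ≤ m + 1 → ∀ x, ‖iteratedFDeriv ℝ i (a t) x‖ ≤ k t
  zero_le : ∀ t, ‖a t 0‖ ≤ b t
  eq_zero : ∀ t, t ∉ Icc 0 T → a t = 0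

lemma norm_sub_le_of_iteratedFDeriv {f : Rd d → Rd d} (hf : ContDiff ℝ 1 f) {κ : ℝ}
    (hκ : ∀ x, ‖iteratedFDeriv ℝ 1 f x‖ ≤ κ) (x y : Rd d) : ‖f x - f y‖ ≤ κ * ‖x - y‖ := by
  refine Convex.norm_image_sub_le_of_norm_fderiv_le (𝕜 := ℝ) (s := univ)
    (fun z _ => hf.differentiable (by simp) z) (fun z _ => ?_) convex_univ (mem_univ _) (mem_univ _)
  rw [← norm_iteratedFDeriv_one]
  exact hκ z

/-- The truncation of a vector field. -/
def cutField (n : ℕ) (f : Rd d → Rd d) : Rd d → Rd d := fun x => cut d n x • f x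

lemma contDiff_cutField {k : ℕ} (n : ℕ) {f : Rd d → Rd d} (hf : ContDiff ℝ k f) :
    ContDiff ℝ k (cutField n f) := (contDiff_infty.1 (cut_smooth n) k).smul hf

lemma hasCompactSupport_cutField (n : ℕ) (f : Rd d → Rd d) : HasCompactSupport (cutField n f) :=
  (cut_compact n).smul_right

lemma coord_cutField (n : ℕ) (f : Rd d → Rd d) (j : Fin d) (x : Rd d) :
    coord (cutField n f) j x = cut d n x * coord f j x := by
  simp [coord, cutField]

lemma isBddCont_coord_cutField (n : ℕ) {f : Rd d → Rd d} (hf : Continuous f) (j : Fin d) :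
    IsBddCont (coord (cutField n f) j) := by
  refine IsBddCont.of_compact ?_ (hasCompactSupport_coord (hasCompactSupport_cutField n f) j)
  have h : Continuous (cutField n f) := (cut_smooth n).continuous.smul hf
  exact (contDiff_coord (k := 0) (by exact_mod_cast contDiff_zero.2 h) j).continuous

lemma iteratedFDeriv_cut_eq_zero (n i : ℕ) {x : Rd d} (hx : 2 * (n + 1 : ℝ) < ‖x‖) :
    iteratedFDeriv ℝ i (cut d n) x = 0 := by
  by_contra h
  have h1 : x ∈ tsupport (cut d n) := support_iteratedFDeriv_subset i (Function.mem_support.2 h)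
  have h2 : tsupport (cut d n) ⊆ Metric.closedBall 0 (2 * (n + 1 : ℝ)) := by
    refine closure_minimal (fun y hy => ?_) Metric.isClosed_closedBall
    rw [mem_closedBall_zero_iff]
    by_contra hlt
    exact hy (cut_eq_zero n (not_le.1 hlt).le)
  have h3 := h2 h1
  rw [mem_closedBall_zero_iff] at h3
  linarith

namespace RegularDrift

variable {T : ℝ} {a : ℝ → Rd d → Rd d} {k b : ℝ → ℝ}

lemma contDiff_one (h : RegularDrift m T a k b) (t : ℝ) : ContDiff ℝ 1 (a t) :=
  (h.contDiff t).of_le (by exact_mod_cast (by omega : 1 ≤ m + 1))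

lemma continuous (h : RegularDrift m T a k b) (t : ℝ) : Continuous (a t) :=
  (h.contDiff t).continuous

lemma norm_le (h : RegularDrift m T a k b) (t : ℝ) (x : Rd d) : ‖a t x‖ ≤ b t + k t * ‖x‖ := by
  have h1 := norm_sub_le_of_iteratedFDeriv (h.contDiff_one t)
    (fun x => h.deriv_le t 1 le_rfl (by omega) x) x 0
  rw [sub_zero] at h1
  have h2 : ‖a t x‖ ≤ ‖a t 0‖ + ‖a t x - a t 0‖ := by
    have := norm_add_le (a t 0) (a t x - a t 0)
    simpa using this
  linarith [h.zero_le t]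

lemma norm_le_of_norm_le (h : RegularDrift m T a k b) (t : ℝ) {x : Rd d} {R : ℝ} (hx : ‖x‖ ≤ R) :
    ‖a t x‖ ≤ b t + k t * R :=
  (h.norm_le t x).trans (by gcongr; exact h.k_nonneg t)

lemma norm_cutField_le (h : RegularDrift m T a k b) (n : ℕ) (t : ℝ) (x : Rd d) :
    ‖cutField n (a t) x‖ ≤ 2 * (n + 1) * (k t + b t) := by
  have hk := h.k_nonneg t
  have hb := h.b_nonneg t
  have hn : (0 : ℝ) ≤ n := n.cast_nonneg
  rcases le_total ‖x‖ (2 * (n + 1 : ℝ)) with hx | hx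
  · have h1 := h.norm_le_of_norm_le t hx
    rw [cutField, norm_smul]
    have h2 : ‖cut d n x‖ * ‖a t x‖ ≤ 1 * ‖a t x‖ :=
      mul_le_mul_of_nonneg_right (abs_cut_le_one n x) (norm_nonneg _)
    nlinarith
  · rw [cutField, cut_eq_zero n hx, zero_smul, norm_zero]
    positivity

/-- Derivatives of the cutoff are `O(1 / (n + 1))` and live in `‖x‖ ≤ 2 (n + 1)`, where the drift is
at most `b t + 2 (n + 1) k t`. Linear growth is absorbed, and the part due to `a t 0` tends to zero.
-/
lemma norm_iteratedFDeriv_cut_mul_le (h : RegularDrift m T a k b) {c : ℝ} (hc : 0 ≤ c) {n i : ℕ}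
    (hi : 1 ≤ i) (t : ℝ) (x : Rd d) (hcut : ‖iteratedFDeriv ℝ i (cut d n) x‖ ≤ c / (n + 1) ^ i) :
    ‖iteratedFDeriv ℝ i (cut d n) x‖ * ‖a t x‖ ≤ 2 * c * (k t + b t / (n + 1)) := by
  have hk := h.k_nonneg t
  have hb := h.b_nonneg t
  have hn : (1 : ℝ) ≤ n + 1 := by linarith [(n.cast_nonneg : (0 : ℝ) ≤ n)]
  rcases le_or_gt ‖x‖ (2 * (n + 1 : ℝ)) with hx | hx
  · have h1 := h.norm_le_of_norm_le t hx
    have h2 : c / (n + 1 : ℝ) ^ i ≤ c / (n + 1) := by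
      gcongr
      exact le_self_pow₀ hn (by omega)
    calc _ ≤ c / (n + 1 : ℝ) * (b t + k t * (2 * (n + 1))) :=
          mul_le_mul (hcut.trans h2) h1 (norm_nonneg _) (by positivity)
      _ = 2 * c * k t + c * (b t / (n + 1)) := by field_simp; ring
      _ ≤ _ := by
        have : 0 ≤ c * (b t / (n + 1 : ℝ)) := by positivity
        linarith
  · rw [iteratedFDeriv_cut_eq_zero n i hx, norm_zero, zero_mul]
    positivity

end RegularDrift

/-- The truncated fields inherit the bounds of the drift. -/
lemma exists_cutField_bound (d m : ℕ) : ∃ c : ℝ, 0 ≤ c ∧ ∀ {T : ℝ} {a : ℝ → Rd d → Rd d}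
    {k b : ℝ → ℝ}, RegularDrift m T a k b → ∀ (n : ℕ) (t : ℝ) (i : ℕ), 1 ≤ i → i ≤ m + 1 →
    ∀ x, ‖iteratedFDeriv ℝ i (cutField n (a t)) x‖ ≤ c * (k t + b t / (n + 1)) := by
  obtain ⟨c, hc, hcut⟩ := exists_cut_bound d (m + 1)
  refine ⟨2 ^ (m + 1) * (2 * c), by positivity, fun {T a k b} h n t i hi him x => ?_⟩
  have hk := h.k_nonneg t
  have hb := h.b_nonneg t
  have hq : 0 ≤ b t / (n + 1 : ℝ) := by positivity
  have hcd : ContDiff ℝ i (a t) := (h.contDiff t).of_le (by exact_mod_cast him)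
  refine (norm_iteratedFDeriv_smul_le (contDiff_infty.1 (cut_smooth n) i) hcd x
    (n := i) le_rfl).trans ?_
  have hterm : ∀ j ∈ Finset.range (i + 1), (i.choose j : ℝ) * ‖iteratedFDeriv ℝ j (cut d n) x‖
      * ‖iteratedFDeriv ℝ (i - j) (a t) x‖ ≤ (i.choose j : ℝ) * (2 * c * (k t + b t / (n + 1))) := by
    intro j hj
    rw [Finset.mem_range] at hj
    rw [mul_assoc]
    refine mul_le_mul_of_nonneg_left ?_ (by positivity)
    -- The term `j = i` is the only one with `a t` undifferentiated, and it needs the decay of the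
    -- derivatives of the cutoff.
    rcases (show j < i ∨ j = i by omega) with hji | rfl
    · have h1 : c / (n + 1 : ℝ) ^ j ≤ c :=
        div_le_self hc (one_le_pow₀ (by linarith [(n.cast_nonneg : (0 : ℝ) ≤ n)]))
      calc _ ≤ c * k t := mul_le_mul ((hcut n j (by omega) x).trans h1)
            (h.deriv_le t (i - j) (by omega) (by omega) x) (norm_nonneg _) hc
        _ ≤ _ := by nlinarith [mul_nonneg hc hk, mul_nonneg hc hq]
    · rw [Nat.sub_self, norm_iteratedFDeriv_zero]
      exact h.norm_iteratedFDeriv_cut_mul_le hc hi t x (hcut n j him x)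
  refine (Finset.sum_le_sum hterm).trans ?_
  rw [← Finset.sum_mul, ← Nat.cast_sum, Nat.sum_range_choose]
  push_cast
  have h2 : (2 : ℝ) ^ i ≤ 2 ^ (m + 1) := pow_le_pow_right₀ (by norm_num) him
  have h3 : 0 ≤ 2 * c * (k t + b t / (n + 1)) := by positivity
  calc _ ≤ (2 : ℝ) ^ (m + 1) * (2 * c * (k t + b t / (n + 1))) :=
        mul_le_mul_of_nonneg_right h2 h3
    _ = _ := by ring

/-- The directional derivative `f · ∇φ`. -/
def transport (f : Rd d → Rd d) (φ : Rd d → ℝ) : Rd d → ℝ := fun x => fderiv ℝ φ x (f x)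

lemma transport_eq_sum (f : Rd d → Rd d) (φ : Rd d → ℝ) (x : Rd d) :
    transport f φ x = ∑ j, coord f j x * partialD j φ x := by
  have h : f x = ∑ j, f x j • EuclideanSpace.single j (1 : ℝ) := by
    ext i
    simp [Finset.sum_apply, Pi.single_apply]
  rw [transport]
  conv_lhs => rw [h]
  rw [map_sum]
  simp [coord, partialD]

lemma memLp_transport {f : Rd d → Rd d} (hf : Continuous f) {φ : Rd d → ℝ}
    (hφ : ContDiff ℝ ∞ φ) (hφc : HasCompactSupport φ) : MemLp (transport f φ) 2 volume := by
  refine memLp_of_compact ?_ ?_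
  · exact (hφ.continuous_fderiv (by simp)).clm_apply hf
  · have h := hφc.fderiv (𝕜 := ℝ)
    refine h.mono fun x hx => ?_
    rw [Function.mem_support] at hx ⊢
    intro h0
    exact hx (by rw [transport, h0]; rfl)

lemma partialD_eq_zero_of_ball {φ : Rd d → ℝ} {R : ℝ} (hR : ∀ x, R < ‖x‖ → φ x = 0) (j : Fin d)
    {x : Rd d} (hx : R < ‖x‖) : partialD j φ x = 0 := by
  have h : φ =ᶠ[𝓝 x] fun _ => 0 := by
    filter_upwards [(isOpen_lt continuous_const continuous_norm).mem_nhds hx] with y hy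
    exact hR y hy
  rw [partialD, h.fderiv_eq]
  simp

/-- On functions supported in a ball, the transport operator only sees the truncated field. -/
lemma toL2_transport {f : Rd d → Rd d} (hf : Continuous f) {φ : Rd d → ℝ} (hφ : ContDiff ℝ ∞ φ)
    (hφc : HasCompactSupport φ) {N : ℕ} (hN : ∀ x, (N + 1 : ℝ) < ‖x‖ → φ x = 0) :
    toL2 (transport f φ) = ∑ j, mulOp (coord (cutField N f) j) (toL2 (partialD j φ)) := by
  have hp : ∀ j, MemLp (partialD j φ) 2 volume := fun j =>
    memLp_of_compact (contDiff_infty_wordD [j] hφ).continuous (hasCompactSupport_wordD [j] hφc)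
  simp_rw [fun j => mulOp_toL2 (isBddCont_coord_cutField N hf j) (hp j)]
  rw [toL2_sum _ fun j => (isBddCont_coord_cutField N hf j).memLp_mul (hp j)]
  congr 1
  ext x
  rw [transport_eq_sum]
  refine Finset.sum_congr rfl fun j _ => ?_
  rw [coord_cutField]
  rcases le_or_gt ‖x‖ (N + 1 : ℝ) with hx | hx
  · rw [cut_eq_one N hx, one_mul]
  · rw [partialD_eq_zero_of_ball hN j hx, mul_zero, mul_zero]

lemma norm_mulOp_le_of_ball {b : Rd d → ℝ} (hb : IsBddCont b) {B R : ℝ}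
    (hB : ∀ x, ‖x‖ ≤ R → |b x| ≤ B) {u : L2 d} (hu : ∀ᵐ x, R < ‖x‖ → u x = 0) :
    ‖mulOp b u‖ ≤ B * ‖u‖ := by
  refine Lp.norm_le_mul_norm_of_ae_le_mul ?_
  filter_upwards [coeFn_mulOp hb u, hu] with x hx hux
  rw [hx, norm_mul]
  rcases le_or_gt ‖x‖ R with h | h
  · exact mul_le_mul_of_nonneg_right (hB x h) (norm_nonneg _)
  · rw [hux h]; simp

lemma mulOp_congr_of_ball {b b' : Rd d → ℝ} (hb : IsBddCont b) (hb' : IsBddCont b') {R : ℝ}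
    (hB : ∀ x, ‖x‖ ≤ R → b x = b' x) {u : L2 d} (hu : ∀ᵐ x, R < ‖x‖ → u x = 0) :
    mulOp b u = mulOp b' u := by
  refine Lp.ext ?_
  filter_upwards [coeFn_mulOp hb u, coeFn_mulOp hb' u, hu] with x hx hx' hux
  rw [hx, hx']
  rcases le_or_gt ‖x‖ R with h | h
  · rw [hB x h]
  · rw [hux h]; simp

/-- All mollifiers have radius at most `1`. A mollified test function therefore stays in a ball
independent of `n`, on which the drift is bounded and the truncation is eventually invisible. -/
lemma conv_moll_eq_zero_of_ball (n : ℕ) {φ : Rd d → ℝ} (hφ : MemLp φ 2 volume) {R : ℝ}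
    (hR : ∀ x, R < ‖x‖ → φ x = 0) :
    ∀ᵐ x, R + 1 < ‖x‖ → conv (moll d n) (toL2 φ) x = 0 := by
  rw [conv_toL2 (moll_smooth n).continuous (moll_compact n) hφ]
  have hL : MemLp (smear (moll d n) φ) 2 volume := by
    have h := memLp_smear (moll_smooth (d := d) n).continuous (moll_compact n) (toL2 φ)
    refine h.ae_eq (Eventually.of_forall fun x => ?_)
    rw [smear_apply, smear_apply]
    refine integral_congr_ae ?_
    filter_upwards [coeFn_toL2 hφ] with y hy
    rw [hy]
  filter_upwards [coeFn_toL2 hL] with x hx hlt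
  rw [hx, smear_apply]
  refine (integral_congr_ae (Eventually.of_forall fun y => ?_)).trans (integral_zero _ _)
  rcases le_or_gt ‖y‖ R with h | h
  · have h1 : 1 ≤ ‖x - y‖ := by
      have := norm_sub_norm_le x y; linarith
    have h2 : 1 / ((n : ℝ) + 1) ≤ 1 := by
      rw [div_le_one (by positivity)]; linarith [(n.cast_nonneg : (0 : ℝ) ≤ n)]
    simp [moll_eq_zero n (h2.trans h1)]
  · simp [hR y h]

end Fields

/-! ### Space-time test functions as curves in `L²`. -/

section TestCurves

variable {d m : ℕ}

lemma toL2_zero : toL2 (fun _ : Rd d => (0 : ℝ)) = 0 := (eq_toL2 (Lp.coeFn_zero _ _ _)).symm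

/-- A function supported in the ball is dominated by `ε` times a fixed cutoff; `V` is the norm of
that cutoff. -/
lemma exists_norm_toL2_le (d : ℕ) (R : ℝ) : ∃ V : ℝ, 0 ≤ V ∧ ∀ h : Rd d → ℝ, MemLp h 2 volume →
    (∀ x, R < ‖x‖ → h x = 0) → ∀ ε : ℝ, (∀ x, |h x| ≤ ε) → ‖toL2 h‖ ≤ ε * V := by
  obtain ⟨N, hN⟩ := exists_nat_ge R
  have hc : MemLp (cut d N) 2 volume := memLp_of_compact (cut_smooth N).continuous (cut_compact N)
  refine ⟨‖toL2 (cut d N)‖, norm_nonneg _, fun h hh hR ε hε => ?_⟩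
  refine Lp.norm_le_mul_norm_of_ae_le_mul ?_
  filter_upwards [coeFn_toL2 hh, coeFn_toL2 hc] with x h1 h2
  rw [h1, h2]
  rcases le_or_gt ‖x‖ R with hx | hx
  · rw [cut_eq_one N (by linarith), norm_one, mul_one]; exact hε x
  · rw [hR x hx, norm_zero]
    exact mul_nonneg ((abs_nonneg _).trans (hε x)) (norm_nonneg _)

/-- The time derivative of a function on space-time. -/
def timeD (Φ : ℝ × Rd d → ℝ) : ℝ × Rd d → ℝ := fun p => fderiv ℝ Φ p (1, 0)

/-- A partial derivative in space of a function on space-time. -/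
def spaceD (j : Fin d) (Φ : ℝ × Rd d → ℝ) : ℝ × Rd d → ℝ :=
  fun p => fderiv ℝ Φ p (0, EuclideanSpace.single j 1)

/-- The function `Φ(t, ·)`. -/
def slice (Φ : ℝ × Rd d → ℝ) (t : ℝ) : Rd d → ℝ := fun x => Φ (t, x)

section

variable {Φ : ℝ × Rd d → ℝ}

lemma timeD_smooth (hΦ : ContDiff ℝ ∞ Φ) : ContDiff ℝ ∞ (timeD Φ) :=
  (hΦ.fderiv_right (m := ∞) (by simp)).clm_apply contDiff_const

lemma timeD_compact (hc : HasCompactSupport Φ) : HasCompactSupport (timeD Φ) :=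
  hc.fderiv_apply ℝ _

lemma spaceD_smooth (j : Fin d) (hΦ : ContDiff ℝ ∞ Φ) : ContDiff ℝ ∞ (spaceD j Φ) :=
  (hΦ.fderiv_right (m := ∞) (by simp)).clm_apply contDiff_const

lemma spaceD_compact (j : Fin d) (hc : HasCompactSupport Φ) : HasCompactSupport (spaceD j Φ) :=
  hc.fderiv_apply ℝ _

lemma exists_ball (hc : HasCompactSupport Φ) : ∃ R : ℝ, 0 ≤ R ∧
    (∀ t x, R < ‖x‖ → Φ (t, x) = 0) ∧ ∀ t x, R < |t| → Φ (t, x) = 0 := by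
  obtain ⟨R, hR⟩ := hc.isBounded.exists_norm_le
  have h : ∀ p, max R 0 < ‖p‖ → Φ p = 0 := fun p hp => by
    by_contra hne
    have := hR p (subset_tsupport _ hne)
    linarith [le_max_left R 0]
  refine ⟨max R 0, le_max_right _ _, fun t x hx => h _ ?_, fun t x hx => h _ ?_⟩
  · exact hx.trans_le (le_max_right _ _)
  · exact hx.trans_le (le_max_left _ _)

lemma slice_smooth (hΦ : ContDiff ℝ ∞ Φ) (t : ℝ) : ContDiff ℝ ∞ (slice Φ t) :=
  hΦ.comp (contDiff_const.prodMk contDiff_id)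

lemma slice_compact (hc : HasCompactSupport Φ) (t : ℝ) : HasCompactSupport (slice Φ t) := by
  obtain ⟨R, -, hR, -⟩ := exists_ball hc
  refine HasCompactSupport.intro (isCompact_closedBall (0 : Rd d) R) fun x hx => hR t x ?_
  simpa using hx

lemma slice_memLp (hΦ : ContDiff ℝ ∞ Φ) (hc : HasCompactSupport Φ) (t : ℝ) :
    MemLp (slice Φ t) 2 volume :=
  memLp_of_compact (slice_smooth hΦ t).continuous (slice_compact hc t)

lemma partialD_slice (hΦ : ContDiff ℝ ∞ Φ) (j : Fin d) (t : ℝ) :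
    partialD j (slice Φ t) = slice (spaceD j Φ) t := by
  ext x
  have h1 : HasFDerivAt (fun y : Rd d => (t, y)) (ContinuousLinearMap.inr ℝ ℝ (Rd d)) x :=
    hasFDerivAt_prodMk_right t x
  have h2 := ((hΦ.differentiable (by simp) (t, x)).hasFDerivAt.comp x h1).fderiv
  rw [partialD, slice, spaceD]
  change fderiv ℝ (Φ ∘ fun y => (t, y)) x _ = _
  rw [h2]
  simp

lemma hasDerivAt_time (hΦ : ContDiff ℝ ∞ Φ) (t : ℝ) (x : Rd d) :
    HasDerivAt (fun s => Φ (s, x)) (timeD Φ (t, x)) t := by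
  have h1 : HasDerivAt (fun s : ℝ => (s, x)) ((1 : ℝ), (0 : Rd d)) t :=
    (hasDerivAt_id t).prodMk (hasDerivAt_const t x)
  exact (hΦ.differentiable (by simp) (t, x)).hasFDerivAt.comp_hasDerivAt t h1

/-- Uniform continuity of the time derivative gives uniform convergence of the difference quotients,
and the common bounded support turns it into convergence in `L²`. -/
lemma hasDerivAt_toL2_slice (hΦ : ContDiff ℝ ∞ Φ) (hc : HasCompactSupport Φ) (t : ℝ) :
    HasDerivAt (fun s => toL2 (slice Φ s)) (toL2 (slice (timeD Φ) t)) t := by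
  obtain ⟨R, -, hR, -⟩ := exists_ball hc
  obtain ⟨R', -, hR', -⟩ := exists_ball (timeD_compact hc)
  obtain ⟨V, hV, hn⟩ := exists_norm_toL2_le d (max R R')
  have huc : UniformContinuous (timeD Φ) :=
    (timeD_compact hc).uniformContinuous_of_continuous (timeD_smooth hΦ).continuous
  rw [hasDerivAt_iff_isLittleO, Asymptotics.isLittleO_iff]
  intro c hc0
  obtain ⟨δ, hδ, hu⟩ := Metric.uniformContinuous_iff.1 huc (c / (V + 1)) (by positivity)
  filter_upwards [Metric.ball_mem_nhds t hδ] with s hs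
  have hm := slice_memLp hΦ hc
  have hm' := slice_memLp (timeD_smooth hΦ) (timeD_compact hc)
  have hms : MemLp (fun x => slice Φ s x - slice Φ t x) 2 volume := (hm s).sub (hm t)
  rw [toL2_sub (hm s) (hm t), toL2_smul _ (hm' t), toL2_sub hms ((hm' t).const_mul _)]
  -- The mean value inequality applied to `r ↦ Φ (r, x) - r * timeD Φ (t, x)`.
  have hb : ∀ x, |slice Φ s x - slice Φ t x - (s - t) * slice (timeD Φ) t x|
      ≤ c / (V + 1) * |s - t| := by
    intro x
    have hder : ∀ r ∈ Metric.ball t δ, HasDerivWithinAt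
        (fun r => Φ (r, x) - r * timeD Φ (t, x)) (timeD Φ (r, x) - 1 * timeD Φ (t, x))
        (Metric.ball t δ) r := fun r _ =>
      ((hasDerivAt_time hΦ r x).sub ((hasDerivAt_id r).mul_const _)).hasDerivWithinAt
    have h := Convex.norm_image_sub_le_of_norm_hasDerivWithin_le hder (C := c / (V + 1))
      (fun r hr => ?_) (convex_ball t δ) (Metric.mem_ball_self hδ) hs
    · rw [Real.norm_eq_abs, Real.norm_eq_abs] at h
      refine le_trans (le_of_eq ?_) h
      simp only [slice]
      congr 1; ring
    · rw [one_mul, ← dist_eq_norm]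
      refine (hu ?_).le
      rw [Prod.dist_eq]
      simpa using hr
  refine (hn _ (hms.sub ((hm' t).const_mul _)) (fun x hx => ?_) _ hb).trans ?_
  · change Φ (s, x) - Φ (t, x) - (s - t) * timeD Φ (t, x) = 0
    rw [hR _ _ ((le_max_left _ _).trans_lt hx), hR _ _ ((le_max_left _ _).trans_lt hx),
      hR' _ _ ((le_max_right _ _).trans_lt hx)]
    simp
  · rw [Real.norm_eq_abs]
    have : c / (V + 1) * |s - t| * V = c * |s - t| * (V / (V + 1)) := by ring
    rw [this]
    refine mul_le_of_le_one_right (by positivity) ?_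
    rw [div_le_one (by positivity)]; linarith

lemma continuous_toL2_slice (hΦ : ContDiff ℝ ∞ Φ) (hc : HasCompactSupport Φ) :
    Continuous fun t => toL2 (slice Φ t) :=
  continuous_iff_continuousAt.2 fun t => (hasDerivAt_toL2_slice hΦ hc t).continuousAt

lemma hasCompactSupport_toL2_slice (hc : HasCompactSupport Φ) :
    HasCompactSupport fun t => toL2 (slice Φ t) := by
  obtain ⟨R, -, -, hR⟩ := exists_ball hc
  refine HasCompactSupport.intro (isCompact_Icc (a := -R) (b := R)) fun t ht => ?_
  have h : slice Φ t = fun _ => 0 := by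
    ext x
    refine hR t x (not_le.1 fun h => ht ?_)
    exact abs_le.1 h
  rw [h, toL2_zero]

lemma integrable_toL2_slice (hΦ : ContDiff ℝ ∞ Φ) (hc : HasCompactSupport Φ) :
    Integrable fun t => toL2 (slice Φ t) :=
  (continuous_toL2_slice hΦ hc).integrable_of_hasCompactSupport (hasCompactSupport_toL2_slice hc)

lemma toL2_slice_sub (hΦ : ContDiff ℝ ∞ Φ) (hc : HasCompactSupport Φ) (s t : ℝ) :
    toL2 (slice Φ t) - toL2 (slice Φ s) = ∫ τ in s..t, toL2 (slice (timeD Φ) τ) :=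
  (intervalIntegral.integral_eq_sub_of_hasDerivAt (fun τ _ => hasDerivAt_toL2_slice hΦ hc τ)
    ((continuous_toL2_slice (timeD_smooth hΦ) (timeD_compact hc)).intervalIntegrable _ _)).symm

end

end TestCurves

/-! ### The approximate generators and the limit of their adjoints. -/

section Approximation

variable {d m : ℕ} {T : ℝ} {a : ℝ → Rd d → Rd d} {k b : ℝ → ℝ}

/-- A damping factor which makes the approximate operators uniformly bounded in time. -/
def damp (k b : ℝ → ℝ) (n : ℕ) (t : ℝ) : ℝ := (n + 1) / (n + 1 + (k t + b t))

/-- The approximate generators. -/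
def approx (m : ℕ) (a : ℝ → Rd d → Rd d) (k b : ℝ → ℝ) (n : ℕ) (t : ℝ) : HS d m →L[ℝ] HS d m :=
  damp k b n t • regOp m n (cutField n (a t))

lemma damp_nonneg (hk : ∀ t, 0 ≤ k t) (hb : ∀ t, 0 ≤ b t) (n : ℕ) (t : ℝ) : 0 ≤ damp k b n t := by
  have := hk t; have := hb t; unfold damp; positivity

lemma damp_le_one (hk : ∀ t, 0 ≤ k t) (hb : ∀ t, 0 ≤ b t) (n : ℕ) (t : ℝ) : damp k b n t ≤ 1 := by
  have := hk t; have := hb t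
  unfold damp
  rw [div_le_one (by positivity)]; linarith

/-- For fixed `n`, the norm of `regOp` at time `t` is of size `k t + b t`, only integrable in time;
damping makes it bounded, as `exists_linear_ode` demands. -/
lemma damp_mul_le (hk : ∀ t, 0 ≤ k t) (hb : ∀ t, 0 ≤ b t) (n : ℕ) (t : ℝ) :
    damp k b n t * (k t + b t) ≤ n + 1 := by
  have := hk t; have := hb t
  unfold damp
  rw [div_mul_eq_mul_div, div_le_iff₀ (by positivity)]
  refine mul_le_mul_of_nonneg_left ?_ (by positivity)
  linarith [(n.cast_nonneg : (0 : ℝ) ≤ n)]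

lemma tendsto_damp (hk : ∀ t, 0 ≤ k t) (hb : ∀ t, 0 ≤ b t) (t : ℝ) :
    Tendsto (fun n => damp k b n t) atTop (𝓝 1) := by
  have hkt := hk t; have hbt := hb t
  have h1 : Tendsto (fun n : ℕ => (k t + b t) * (1 / ((n : ℝ) + 1))) atTop (𝓝 ((k t + b t) * 0)) :=
    tendsto_one_div_add_atTop_nhds_zero_nat.const_mul _
  have h2 : Tendsto (fun n : ℕ => (1 + (k t + b t) * (1 / ((n : ℝ) + 1)))⁻¹) atTop (𝓝 1) := by
    have := ((tendsto_const_nhds (x := (1 : ℝ))).add h1).inv₀ (by simp)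
    simpa using this
  refine h2.congr fun n => ?_
  unfold damp
  have : (0 : ℝ) < n + 1 := by positivity
  field_simp

lemma aestronglyMeasurable_damp (hk : Integrable k) (hb : Integrable b) (n : ℕ) :
    AEStronglyMeasurable (damp k b n) := by
  have h : AEMeasurable fun t => ((n : ℝ) + 1) / (n + 1 + (k t + b t)) :=
    aemeasurable_const.div (aemeasurable_const.add (hk.aemeasurable.add hb.aemeasurable))
  exact h.aestronglyMeasurable

namespace RegularDrift

lemma measurable_coord_cutField (h : RegularDrift m T a k b) (n : ℕ) (j : Fin d) (x : Rd d) :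
    Measurable fun t => coord (cutField n (a t)) j x := by
  simp_rw [coord_cutField]
  refine measurable_const.mul ?_
  exact (EuclideanSpace.proj (𝕜 := ℝ) j : Rd d →L[ℝ] ℝ).continuous.measurable.comp (h.meas x)

lemma aestronglyMeasurable_mulOp_cutField (h : RegularDrift m T a k b) (n : ℕ) (j : Fin d)
    (u : L2 d) : AEStronglyMeasurable fun t => mulOp (coord (cutField n (a t)) j) u :=
  aestronglyMeasurable_mulOp (fun t => isBddCont_coord_cutField n (h.continuous t) j)
    (fun x => h.measurable_coord_cutField n j x) u

lemma aestronglyMeasurable_approx (h : RegularDrift m T a k b) (n : ℕ) (u : HS d m) :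
    AEStronglyMeasurable fun t => approx m a k b n t u := by
  refine (aestronglyMeasurable_damp h.integrable_k h.integrable_b n).smul ?_
  refine AEStronglyMeasurable.congr ?_
    (Eventually.of_forall fun t => (regOp_apply n (cutField n (a t)) u).symm)
  refine AEStronglyMeasurable.neg ?_
  refine Finset.aestronglyMeasurable_fun_sum _ fun j _ => ?_
  exact (ContinuousLinearMap.continuous _).comp_aestronglyMeasurable
    (h.aestronglyMeasurable_mulOp_cutField n j _)

lemma approx_eq_zero (h : RegularDrift m T a k b) (n : ℕ) (t : ℝ) (ht : t ∉ Icc 0 T) :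
    approx m a k b n t = 0 := by
  have h0 : cutField n (a t) = 0 := by
    ext x; simp [cutField, h.eq_zero t ht]
  have h1 : ‖regOp m n (cutField n (a t))‖ ≤ 0 := by
    obtain ⟨c, -, hc⟩ := exists_norm_regOp_le d m n
    have := hc (cutField n (a t)) (by rw [h0]; exact continuous_const) 0 (by simp [h0])
    simpa using this
  ext1 u
  have h2 : ‖regOp m n (cutField n (a t)) u‖ ≤ 0 :=
    (ContinuousLinearMap.le_of_opNorm_le _ h1 u).trans (by simp)
  change damp k b n t • regOp m n (cutField n (a t)) u = 0
  rw [norm_le_zero_iff.1 h2, smul_zero]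

lemma exists_norm_approx_le (h : RegularDrift m T a k b) (n : ℕ) :
    ∃ c : ℝ, ∀ t, ‖approx m a k b n t‖ ≤ c := by
  obtain ⟨c, hc0, hc⟩ := exists_norm_regOp_le d m n
  refine ⟨c * (2 * (n + 1) * (n + 1)), fun t => ?_⟩
  have h1 := hc _ ((contDiff_cutField n (h.contDiff t)).continuous) _
    (fun x => h.norm_cutField_le n t x)
  have h2 := damp_nonneg h.k_nonneg h.b_nonneg n t
  have h3 := damp_mul_le h.k_nonneg h.b_nonneg n t
  refine ContinuousLinearMap.opNorm_le_bound _ (by positivity) fun u => ?_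
  change ‖damp k b n t • regOp m n (cutField n (a t)) u‖ ≤ _
  rw [norm_smul, Real.norm_of_nonneg h2]
  refine (mul_le_mul_of_nonneg_left (ContinuousLinearMap.le_opNorm _ u) h2).trans ?_
  rw [← mul_assoc]
  refine mul_le_mul_of_nonneg_right ?_ (norm_nonneg _)
  calc damp k b n t * ‖regOp m n (cutField n (a t))‖
      ≤ damp k b n t * (c * (2 * (n + 1) * (k t + b t))) := mul_le_mul_of_nonneg_left h1 h2
    _ = c * (2 * (n + 1)) * (damp k b n t * (k t + b t)) := by ring
    _ ≤ c * (2 * (n + 1)) * (n + 1) := mul_le_mul_of_nonneg_left h3 (by positivity)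
    _ = _ := by ring

lemma adjoint_approx (h : RegularDrift m T a k b) (n : ℕ) (t : ℝ) {φ : Rd d → ℝ}
    (hφ : ContDiff ℝ ∞ φ) (hφc : HasCompactSupport φ) :
    (approx m a k b n t).adjoint ((incl d m).adjoint (toL2 φ)) = damp k b n t •
      (incl d m).adjoint (∑ j, conv (moll d n) (mulOp (coord (cutField n (a t)) j)
        (conv (moll d n) (toL2 (partialD j φ))))) := by
  rw [← adjoint_regOp n (fun j => isBddCont_coord_cutField n (h.continuous t) j) hφ hφc, approx,
    map_smulₛₗ]
  simp

lemma memLp_partialD {φ : Rd d → ℝ} (hφ : ContDiff ℝ ∞ φ) (hφc : HasCompactSupport φ) (j : Fin d) :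
    MemLp (partialD j φ) 2 volume :=
  memLp_of_compact (contDiff_infty_wordD [j] hφ).continuous (hasCompactSupport_wordD [j] hφc)

/-- The mollified derivatives of `φ` live in the ball of radius `R + 1`, where the truncated drift
is at most `b t + k t * (R + 1)`. The absence of `n` gives equicontinuity and domination. -/
lemma norm_adjoint_approx_le (h : RegularDrift m T a k b) (n : ℕ) (t : ℝ) {φ : Rd d → ℝ}
    (hφ : ContDiff ℝ ∞ φ) (hφc : HasCompactSupport φ) {R : ℝ} (hR : ∀ x, R < ‖x‖ → φ x = 0) :
    ‖(approx m a k b n t).adjoint ((incl d m).adjoint (toL2 φ))‖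
      ≤ ‖(incl d m).adjoint‖ * (∑ j, ‖toL2 (partialD j φ)‖) * (b t + k t * (R + 1)) := by
  rw [h.adjoint_approx n t hφ hφc, norm_smul,
    Real.norm_of_nonneg (damp_nonneg h.k_nonneg h.b_nonneg n t)]
  refine (mul_le_of_le_one_left (norm_nonneg _) (damp_le_one h.k_nonneg h.b_nonneg n t)).trans ?_
  refine (ContinuousLinearMap.le_opNorm _ _).trans ?_
  rw [mul_assoc]
  refine mul_le_mul_of_nonneg_left ?_ (ContinuousLinearMap.opNorm_nonneg _)
  rw [Finset.sum_mul]
  refine (norm_sum_le _ _).trans (Finset.sum_le_sum fun j _ => ?_)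
  refine (norm_moll_conv_le n _).trans ?_
  have hB : ∀ x : Rd d, ‖x‖ ≤ R + 1 → |coord (cutField n (a t)) j x| ≤ b t + k t * (R + 1) := by
    intro x hx
    rw [coord_cutField, abs_mul]
    exact (mul_le_of_le_one_left (abs_nonneg _) (abs_cut_le_one n x)).trans
      ((abs_coord_le _ _ _).trans (h.norm_le_of_norm_le t hx))
  have hz := conv_moll_eq_zero_of_ball n (memLp_partialD hφ hφc j)
    (fun x hx => partialD_eq_zero_of_ball hR j hx)
  -- If `R + 1 < 0` the asserted factor may be negative, but then `φ` vanishes everywhere.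
  by_cases hR0 : 0 ≤ R + 1
  · have hB0 : 0 ≤ b t + k t * (R + 1) :=
      add_nonneg (h.b_nonneg t) (mul_nonneg (h.k_nonneg t) hR0)
    refine (norm_mulOp_le_of_ball (isBddCont_coord_cutField n (h.continuous t) j) hB hz).trans ?_
    rw [mul_comm]
    exact mul_le_mul_of_nonneg_right (norm_moll_conv_le n _) hB0
  · have h0 : toL2 (partialD j φ) = 0 := by
      rw [← toL2_zero]
      congr 1
      ext x
      exact partialD_eq_zero_of_ball hR j (by linarith [norm_nonneg x])
    simp [h0]

lemma tendsto_adjoint_approx (h : RegularDrift m T a k b) (t : ℝ) {φ : Rd d → ℝ}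
    (hφ : ContDiff ℝ ∞ φ) (hφc : HasCompactSupport φ) :
    Tendsto (fun n => (approx m a k b n t).adjoint ((incl d m).adjoint (toL2 φ))) atTop
      (𝓝 ((incl d m).adjoint (toL2 (transport (a t) φ)))) := by
  obtain ⟨R, hR'⟩ := hφc.isBounded.exists_norm_le
  have hR : ∀ x, R < ‖x‖ → φ x = 0 := fun x hx => by
    by_contra hne
    linarith [hR' x (subset_tsupport _ hne)]
  obtain ⟨N, hN⟩ := exists_nat_ge R
  simp_rw [h.adjoint_approx _ t hφ hφc]
  rw [← one_smul ℝ ((incl d m).adjoint (toL2 (transport (a t) φ)))]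
  refine (tendsto_damp h.k_nonneg h.b_nonneg t).smul ?_
  refine ((incl d m).adjoint.continuous.tendsto _).comp ?_
  rw [toL2_transport (h.continuous t) hφ hφc (N := N) fun x hx => hR x (by linarith)]
  refine tendsto_finsetSum _ fun j _ => ?_
  have hb := fun n => isBddCont_coord_cutField n (h.continuous t) j
  have hlim : Tendsto (fun n => mulOp (coord (cutField n (a t)) j)
      (conv (moll d n) (toL2 (partialD j φ)))) atTop
      (𝓝 (mulOp (coord (cutField N (a t)) j) (toL2 (partialD j φ)))) := by
    have h1 : Tendsto (fun n => mulOp (coord (cutField N (a t)) j)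
        (conv (moll d n) (toL2 (partialD j φ)))) atTop
        (𝓝 (mulOp (coord (cutField N (a t)) j) (toL2 (partialD j φ)))) :=
      ((mulOp _).continuous.tendsto _).comp (tendsto_moll _)
    -- From `n = N` on, with `N ≥ R`, both cutoffs equal `1` on the ball of radius `R + 1`, so the
    -- truncation no longer depends on `n` there.
    refine h1.congr' ?_
    filter_upwards [eventually_ge_atTop N] with n hn
    have hn' : (N : ℝ) ≤ n := by exact_mod_cast hn
    refine mulOp_congr_of_ball (hb N) (hb n) (R := R + 1) (fun x hx => ?_)
      (conv_moll_eq_zero_of_ball n (memLp_partialD hφ hφc j)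
        fun x hx => partialD_eq_zero_of_ball hR j hx)
    rw [coord_cutField, coord_cutField, cut_eq_one N (by linarith), cut_eq_one n (by linarith)]
  have h2 : Tendsto (fun n => conv (moll d n) (mulOp (coord (cutField n (a t)) j)
      (conv (moll d n) (toL2 (partialD j φ))) - mulOp (coord (cutField N (a t)) j)
        (toL2 (partialD j φ)))) atTop (𝓝 0) := by
    refine squeeze_zero_norm (fun n => norm_moll_conv_le n _) ?_
    have := (hlim.sub_const (mulOp (coord (cutField N (a t)) j) (toL2 (partialD j φ)))).norm
    simpa using this
  have h3 := h2.add (tendsto_moll (mulOp (coord (cutField N (a t)) j) (toL2 (partialD j φ))))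
  rw [zero_add] at h3
  refine h3.congr fun n => ?_
  rw [map_sub, sub_add_cancel]

end RegularDrift

end Approximation

/-! ### Weakly continuous solutions in `H^m`. -/

section Evolution

variable {d m : ℕ} {T : ℝ} {a : ℝ → Rd d → Rd d} {k b : ℝ → ℝ}

/-- The equation `∂_t σ + div(a σ) = g` in integrated form, tested with functions of `x` only. -/
def SolvesFrom (a : ℝ → Rd d → Rd d) (g : ℝ → L2 d) (t₀ : ℝ) (σ : ℝ → L2 d) : Prop :=
  ∀ φ : Rd d → ℝ, ContDiff ℝ ∞ φ → HasCompactSupport φ → ∀ t,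
    inner ℝ (σ t) (toL2 φ) = inner ℝ (σ t₀) (toL2 φ) + ∫ τ in t₀..t,
      (inner ℝ (g τ) (toL2 φ) + inner ℝ (σ τ) (toL2 (transport (a τ) φ)))

lemma integrable_inner_of_bounded {H : Type*} [NormedAddCommGroup H] [InnerProductSpace ℝ H]
    {σ ψ : ℝ → H} {B : ℝ} (hB : ∀ t, ‖σ t‖ ≤ B) (hσ : AEStronglyMeasurable σ)
    (hψ : Integrable ψ) : Integrable fun t => inner ℝ (σ t) (ψ t) := by
  refine (hψ.norm.const_mul B).mono' (hσ.inner hψ.1) (Eventually.of_forall fun t => ?_)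
  exact (norm_inner_le_norm _ _).trans (mul_le_mul_of_nonneg_right (hB t) (norm_nonneg _))

lemma exists_ball_of_compact {φ : Rd d → ℝ} (hφc : HasCompactSupport φ) :
    ∃ N : ℕ, ∀ x, (N : ℝ) < ‖x‖ → φ x = 0 := by
  obtain ⟨R, hR⟩ := hφc.isBounded.exists_norm_le
  obtain ⟨N, hN⟩ := exists_nat_ge R
  refine ⟨N, fun x hx => ?_⟩
  by_contra hne
  linarith [hR x (subset_tsupport _ hne)]

lemma RegularDrift.integrable_transport_of_bound (h : RegularDrift m T a k b) {φ : ℝ → Rd d → ℝ}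
    (hφ : ∀ t, ContDiff ℝ ∞ (φ t)) (hφc : ∀ t, HasCompactSupport (φ t)) {N : ℕ}
    (hN : ∀ t x, (N : ℝ) < ‖x‖ → φ t x = 0)
    (hm : ∀ j, AEStronglyMeasurable fun t => toL2 (partialD j (φ t))) {S : ℝ}
    (hS : ∀ t j, ‖toL2 (partialD j (φ t))‖ ≤ S) :
    Integrable fun t => toL2 (transport (a t) (φ t)) := by
  have e := fun t => toL2_transport (h.continuous t) (hφ t) (hφc t) (N := N)
    fun x hx => hN t x (by linarith)
  simp_rw [e]
  refine integrable_finsetSum _ fun j _ => ?_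
  have hi : Integrable fun t => (k t + b t) * (2 * (N + 1) * S) :=
    (h.integrable_k.add h.integrable_b).mul_const _
  refine hi.mono' (aestronglyMeasurable_clm_apply
    (fun u => h.aestronglyMeasurable_mulOp_cutField N j u) (hm j))
    (Eventually.of_forall fun t => ?_)
  have hkb : 0 ≤ k t + b t := add_nonneg (h.k_nonneg t) (h.b_nonneg t)
  refine (norm_mulOp_le (isBddCont_coord_cutField N (h.continuous t) j)
    (fun x => (abs_coord_le _ _ _).trans (h.norm_cutField_le N t x)) _).trans
    ((mul_le_mul_of_nonneg_left (hS t j) (by positivity)).trans (le_of_eq ?_))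
  ring

lemma RegularDrift.integrable_transport (h : RegularDrift m T a k b) {φ : Rd d → ℝ}
    (hφ : ContDiff ℝ ∞ φ) (hφc : HasCompactSupport φ) :
    Integrable fun t => toL2 (transport (a t) φ) := by
  obtain ⟨N, hN⟩ := exists_ball_of_compact hφc
  exact h.integrable_transport_of_bound (fun _ => hφ) (fun _ => hφc) (fun _ => hN)
    (fun j => aestronglyMeasurable_const) (S := ∑ j, ‖toL2 (partialD j φ)‖)
    fun t j => Finset.single_le_sum (f := fun j => ‖toL2 (partialD j φ)‖)
      (fun _ _ => norm_nonneg _) (Finset.mem_univ j)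

lemma exists_norm_toL2_partialD_slice_le {Φ : ℝ × Rd d → ℝ} (hΦ : ContDiff ℝ ∞ Φ)
    (hΦc : HasCompactSupport Φ) : ∃ C : ℝ, ∀ t, ∑ j, ‖toL2 (partialD j (slice Φ t))‖ ≤ C := by
  have hj : ∀ j : Fin d, ∃ C : ℝ, ∀ t, ‖toL2 (partialD j (slice Φ t))‖ ≤ C := fun j => by
    simp_rw [partialD_slice hΦ j]
    exact (hasCompactSupport_toL2_slice (spaceD_compact j hΦc)).exists_bound_of_continuous
      (continuous_toL2_slice (spaceD_smooth j hΦ) (spaceD_compact j hΦc))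
  choose C hC using hj
  exact ⟨∑ j, C j, fun t => Finset.sum_le_sum fun j _ => hC j t⟩

lemma RegularDrift.integrable_transport_slice (h : RegularDrift m T a k b) {Φ : ℝ × Rd d → ℝ}
    (hΦ : ContDiff ℝ ∞ Φ) (hΦc : HasCompactSupport Φ) :
    Integrable fun t => toL2 (transport (a t) (slice Φ t)) := by
  obtain ⟨R, -, hR, -⟩ := exists_ball hΦc
  obtain ⟨N, hN⟩ := exists_nat_ge R
  obtain ⟨S, hS⟩ := exists_norm_toL2_partialD_slice_le hΦ hΦc
  refine h.integrable_transport_of_bound (fun t => slice_smooth hΦ t) (fun t => slice_compact hΦc t)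
    (fun t x hx => hR t x (hN.trans_lt hx)) (fun j => ?_) (S := S) fun t j =>
      (Finset.single_le_sum (f := fun j => ‖toL2 (partialD j (slice Φ t))‖)
        (fun _ _ => norm_nonneg _) (Finset.mem_univ j)).trans (hS t)
  simp_rw [partialD_slice hΦ j]
  exact (continuous_toL2_slice (spaceD_smooth j hΦ) (spaceD_compact j hΦc)).aestronglyMeasurable

/-- Additivity of the integral. It allows comparison with a solution started at an arbitrary time.
-/
lemma SolvesFrom.restart (h : RegularDrift m T a k b) {g σ : ℝ → L2 d} (hg : Integrable g) {t₀ : ℝ}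
    (hσ : SolvesFrom a g t₀ σ) {B : ℝ} (hB : ∀ t, ‖σ t‖ ≤ B) (hσm : AEStronglyMeasurable σ)
    (t₁ : ℝ) : SolvesFrom a g t₁ σ := by
  intro φ hφ hφc t
  have hi : Integrable fun τ => inner ℝ (g τ) (toL2 φ) + inner ℝ (σ τ) (toL2 (transport (a τ) φ)) :=
    (hg.inner_const _).add (integrable_inner_of_bounded hB hσm (h.integrable_transport hφ hφc))
  rw [hσ φ hφ hφc t, hσ φ hφ hφc t₁, add_assoc, intervalIntegral.integral_add_adjacent_intervals
    hi.intervalIntegrable hi.intervalIntegrable]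

lemma SolvesFrom.sub (h : RegularDrift m T a k b) {g σ σ' : ℝ → L2 d} (hg : Integrable g) {t₀ : ℝ}
    (hσ : SolvesFrom a g t₀ σ) (hσ' : SolvesFrom a g t₀ σ') {B B' : ℝ} (hB : ∀ t, ‖σ t‖ ≤ B)
    (hσm : AEStronglyMeasurable σ) (hB' : ∀ t, ‖σ' t‖ ≤ B') (hσm' : AEStronglyMeasurable σ') :
    SolvesFrom a 0 t₀ fun t => σ t - σ' t := by
  intro φ hφ hφc t
  have hi := (integrable_inner_of_bounded hB hσm (h.integrable_transport hφ hφc))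
  have hi' := (integrable_inner_of_bounded hB' hσm' (h.integrable_transport hφ hφc))
  have hgi : Integrable fun τ => inner ℝ (g τ) (toL2 φ) := hg.inner_const _
  simp only [inner_sub_left, Pi.zero_apply, inner_zero_left, zero_add]
  rw [hσ φ hφ hφc t, hσ' φ hφ hφc t,
    intervalIntegral.integral_add hgi.intervalIntegrable hi.intervalIntegrable,
    intervalIntegral.integral_add hgi.intervalIntegrable hi'.intervalIntegrable,
    intervalIntegral.integral_sub hi.intervalIntegrable hi'.intervalIntegrable]
  ring

/-- Existence of a weakly continuous solution with the energy estimate in both time directions. -/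
theorem exists_evolution (d m : ℕ) : ∃ K : ℝ, 0 ≤ K ∧ ∀ {T : ℝ} {a : ℝ → Rd d → Rd d}
    {k b : ℝ → ℝ}, RegularDrift m T a k b → ∀ {g : ℝ → HS d m}, Integrable g →
    ∀ (t₀ : ℝ) (u₀ : HS d m), ∃ ρ : ℝ → HS d m, (∀ v, Continuous fun t => inner ℝ (ρ t) v) ∧
      ρ t₀ = u₀ ∧
      (∀ t, ‖ρ t‖ ≤ (‖u₀‖ + 2 * |∫ τ in t₀..t, ‖g τ‖|)
        * Real.exp (2 * |∫ τ in t₀..t, K * k τ|)) ∧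
      SolvesFrom a (fun t => incl d m (g t)) t₀ (fun t => incl d m (ρ t)) ∧
      ∀ Φ : ℝ × Rd d → ℝ, ContDiff ℝ ∞ Φ → HasCompactSupport Φ → ∀ t,
        inner ℝ (incl d m (ρ t)) (toL2 (slice Φ t)) = inner ℝ (incl d m u₀) (toL2 (slice Φ t₀))
          + ∫ τ in t₀..t, (inner ℝ (incl d m (g τ)) (toL2 (slice Φ τ))
            + inner ℝ (incl d m (ρ τ)) (toL2 (slice (timeD Φ) τ))
            + inner ℝ (incl d m (ρ τ)) (toL2 (transport (a τ) (slice Φ τ)))) := by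
  obtain ⟨c, hc0, hc⟩ := exists_cutField_bound d m
  have hE := energyConst_nonneg d m
  refine ⟨energyConst d m * c, by positivity, fun {T a k b} h {g} hg t₀ u₀ => ?_⟩
  choose C hC using fun n => h.exists_norm_approx_le (m := m) n
  obtain ⟨ρ, hρc, hρ0, hρb, hρ⟩ := exists_weak_evolution (A := approx m a k b) (T := T) hC
    h.approx_eq_zero h.aestronglyMeasurable_approx
    (k := fun t => energyConst d m * c * k t) (b := fun t => energyConst d m * c * b t)
    (h.integrable_k.const_mul _) (h.integrable_b.const_mul _)
    (fun t => mul_nonneg (by positivity) (h.k_nonneg t))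
    (fun t => mul_nonneg (by positivity) (h.b_nonneg t))
    (fun n t U => by
      have h1 := abs_inner_regOp_le n (contDiff_cutField n (h.contDiff t))
        (hasCompactSupport_cutField n (a t)) (hc h n t) U
      have e : inner ℝ (approx m a k b n t U) U
          = damp k b n t * inner ℝ (regOp m n (cutField n (a t)) U) U :=
        real_inner_smul_left (F := HS d m) (regOp m n (cutField n (a t)) U) U (damp k b n t)
      rw [e, abs_mul, abs_of_nonneg (damp_nonneg h.k_nonneg h.b_nonneg n t)]
      refine (mul_le_of_le_one_left (abs_nonneg _)
        (damp_le_one h.k_nonneg h.b_nonneg n t)).trans (h1.trans (le_of_eq ?_))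
      ring)
    (dense_testVectors (d := d) (m := m))
    (by
      rintro v ⟨φ, hφ, hφc, rfl⟩
      obtain ⟨N, hN⟩ := exists_ball_of_compact hφc
      exact ⟨_, ((h.integrable_b.add (h.integrable_k.mul_const _)).const_mul _),
        fun n t => h.norm_adjoint_approx_le n t hφ hφc hN⟩)
    hg t₀ u₀
  refine ⟨ρ, hρc, hρ0, hρb, fun φ hφ hφc t => ?_, fun Φ hΦ hΦc t => ?_⟩
  · obtain ⟨N, hN⟩ := exists_ball_of_compact hφc
    -- A constant test curve gives the integrated equation; the moving curve below gives the form
    -- tested on space-time.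
    have := hρ (fun _ => (incl d m).adjoint (toL2 φ)) 0
      (fun t => (incl d m).adjoint (toL2 (transport (a t) φ))) (integrable_zero _ _ _)
      (fun s t => by simp)
      ⟨_, ((h.integrable_b.add (h.integrable_k.mul_const _)).const_mul _),
        fun n t => h.norm_adjoint_approx_le n t hφ hφc hN⟩
      (fun t => h.tendsto_adjoint_approx t hφ hφc) t
    simpa only [ContinuousLinearMap.adjoint_inner_right, Pi.zero_apply, inner_zero_right, add_zero,
      hρ0] using this
  · obtain ⟨R, hR0, hR, -⟩ := exists_ball hΦc
    obtain ⟨S, hS⟩ := exists_norm_toL2_partialD_slice_le hΦ hΦc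
    have := hρ (fun t => (incl d m).adjoint (toL2 (slice Φ t)))
      (fun t => (incl d m).adjoint (toL2 (slice (timeD Φ) t)))
      (fun t => (incl d m).adjoint (toL2 (transport (a t) (slice Φ t))))
      ((incl d m).adjoint.integrable_comp
        (integrable_toL2_slice (timeD_smooth hΦ) (timeD_compact hΦc)))
      (fun s t => by
        rw [← map_sub, toL2_slice_sub hΦ hΦc, ContinuousLinearMap.intervalIntegral_comp_comm]
        exact (integrable_toL2_slice (timeD_smooth hΦ) (timeD_compact hΦc)).intervalIntegrable)
      ⟨fun t => ‖(incl d m).adjoint‖ * S * (b t + k t * (R + 1)),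
        ((h.integrable_b.add (h.integrable_k.mul_const _)).const_mul _), fun n t => by
        refine (h.norm_adjoint_approx_le n t (slice_smooth hΦ t) (slice_compact hΦc t)
          (fun x hx => hR t x hx)).trans ?_
        have hk := h.k_nonneg t
        have hb := h.b_nonneg t
        have hn : 0 ≤ ‖(incl d m).adjoint‖ := ContinuousLinearMap.opNorm_nonneg _
        exact mul_le_mul_of_nonneg_right (mul_le_mul_of_nonneg_left (hS t) hn) (by positivity)⟩
      (fun t => h.tendsto_adjoint_approx t (slice_smooth hΦ t) (slice_compact hΦc t)) t
    simpa only [ContinuousLinearMap.adjoint_inner_right] using this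

end Evolution

/-! ### Uniqueness in `L²` through Friedrichs' commutator estimate. -/

section Uniqueness

variable {d m : ℕ} {T : ℝ} {a : ℝ → Rd d → Rd d} {k b : ℝ → ℝ}

lemma tendsto_mulOp_cut (u : L2 d) : Tendsto (fun n => mulOp (cut d n) u) atTop (𝓝 u) := by
  rw [tendsto_iff_norm_sub_tendsto_zero]
  have hu : MemLp (fun x => u x) 2 volume := Lp.memLp u
  have hm : ∀ n, MemLp (fun x => cut d n x * u x) 2 volume := fun n =>
    (cut_isBddCont n).memLp_mul hu
  have hm' : ∀ n, MemLp (fun x => cut d n x * u x - u x) 2 volume := fun n => (hm n).sub hu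
  have e : ∀ n, ‖mulOp (cut d n) u - u‖ ^ 2 = ∫ x, (cut d n x * u x - u x) ^ 2 := fun n => by
    rw [← norm_toL2_sq (hm' n), ← toL2_sub (hm n) hu, toL2_coeFn, mulOp_apply (cut_isBddCont n)]
  have hlim : Tendsto (fun n => ∫ x, (cut d n x * u x - u x) ^ 2) atTop
      (𝓝 (∫ _ : Rd d, (0 : ℝ))) := by
    refine tendsto_integral_of_dominated_convergence (fun x => u x ^ 2)
      (fun n => ((hm' n).1.pow 2)) hu.integrable_sq (fun n => Eventually.of_forall fun x => ?_)
      (Eventually.of_forall fun x => ?_)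
    · have h0 := cut_nonneg n x
      have h1 := cut_le_one n x
      rw [Real.norm_of_nonneg (sq_nonneg _)]
      have h2 : (cut d n x * u x - u x) ^ 2 = (1 - cut d n x) ^ 2 * u x ^ 2 := by ring
      rw [h2]
      refine mul_le_of_le_one_left (sq_nonneg _) ?_
      rw [sq_le_one_iff_abs_le_one, abs_le]
      constructor <;> linarith
    · obtain ⟨N, hN⟩ := exists_nat_ge ‖x‖
      refine tendsto_const_nhds.congr' ?_
      filter_upwards [eventually_ge_atTop N] with n hn
      have hn' : (N : ℝ) ≤ n := by exact_mod_cast hn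
      rw [cut_eq_one n (by linarith)]
      simp
  rw [integral_zero] at hlim
  have h2 := hlim.sqrt
  rw [Real.sqrt_zero] at h2
  refine h2.congr fun n => ?_
  rw [← e n, Real.sqrt_sq (norm_nonneg _)]

/-- Regularization by truncation and mollification. -/
def truncMoll (d n : ℕ) : L2 d →L[ℝ] L2 d := conv (moll d n) ∘L mulOp (cut d n)

lemma tendsto_truncMoll (u : L2 d) : Tendsto (fun n => truncMoll d n u) atTop (𝓝 u) := by
  have h1 : Tendsto (fun n => conv (moll d n) (mulOp (cut d n) u - u)) atTop (𝓝 0) := by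
    refine squeeze_zero_norm (fun n => norm_moll_conv_le n _) ?_
    have := ((tendsto_mulOp_cut u).sub_const u).norm
    simpa using this
  have h2 := h1.add (tendsto_moll u)
  rw [zero_add] at h2
  refine h2.congr fun n => ?_
  rw [map_sub, sub_add_cancel]
  rfl

/-- The product of a component of a field and of the corresponding derivative of the cutoff. -/
def cutTail (n : ℕ) (f : Rd d → Rd d) (j : Fin d) : Rd d → ℝ :=
  fun x => coord f j x * partialD j (cut d n) x

lemma isBddCont_cutTail (n : ℕ) {f : Rd d → Rd d} (hf : Continuous f) (j : Fin d) :
    IsBddCont (cutTail n f j) := by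
  refine IsBddCont.of_compact (.mul ?_ (contDiff_infty_wordD [j] (cut_smooth n)).continuous)
    (hasCompactSupport_wordD [j] (cut_compact n)).mul_left
  exact (contDiff_coord (k := 0) (by exact_mod_cast contDiff_zero.2 hf) j).continuous

/-- The transport operator composed with the adjoint regularization. -/
def transportReg (n : ℕ) (f : Rd d → Rd d) : L2 d →L[ℝ] L2 d :=
  ∑ j, (mulOp (cutTail n f j) ∘L conv (moll d n)
    + mulOp (coord (cutField n f) j) ∘L conv (partialD j (moll d n)))

lemma transportReg_apply (n : ℕ) (f : Rd d → Rd d) (u : L2 d) : transportReg n f u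
    = ∑ j, (mulOp (cutTail n f j) (conv (moll d n) u)
    + mulOp (coord (cutField n f) j) (conv (partialD j (moll d n)) u)) := by
  simp [transportReg]

lemma integrable_moll_deriv (n : ℕ) (j : Fin d) : Integrable (partialD j (moll d n)) :=
  (moll_deriv_smooth n j).continuous.integrable_of_hasCompactSupport (moll_deriv_compact n j)

lemma integrable_moment_moll_deriv (n : ℕ) (j : Fin d) :
    Integrable fun z => ‖z‖ * ‖partialD j (moll d n) z‖ := by
  have hc : Continuous fun z => ‖z‖ * ‖partialD j (moll d n) z‖ :=
    continuous_norm.mul (moll_deriv_smooth n j).continuous.norm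
  exact hc.integrable_of_hasCompactSupport (moll_deriv_compact n j).norm.mul_left

lemma conv_moll_deriv_eq (n : ℕ) (j : Fin d) (u : L2 d) : conv (partialD j (moll d n)) u
    = toL2 (partialD j (smear (moll d n) fun x => u x)) := by
  rw [partialD_smear j ((moll_smooth n).of_le (by simp)) (moll_compact n) (locallyIntegrable_L2 u)]
  exact eq_toL2 (coeFn_conv (moll_deriv_smooth n j).continuous (moll_deriv_compact n j) u)

lemma conv_moll_eq (n : ℕ) (u : L2 d) : conv (moll d n) u
    = toL2 (smear (moll d n) fun x => u x) :=
  eq_toL2 (coeFn_conv (moll_smooth n).continuous (moll_compact n) u)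

lemma smear_moll_smooth (n : ℕ) (u : L2 d) : ContDiff ℝ ∞ (smear (moll d n) fun x => u x) :=
  contDiff_smear (n := ⊤) (moll_smooth n) (moll_compact n) (locallyIntegrable_L2 u)

lemma memLp_partialD_smear (n : ℕ) (j : Fin d) (u : L2 d) :
    MemLp (partialD j (smear (moll d n) fun x => u x)) 2 volume := by
  rw [partialD_smear j ((moll_smooth n).of_le (by simp)) (moll_compact n) (locallyIntegrable_L2 u)]
  exact memLp_smear (moll_deriv_smooth n j).continuous (moll_deriv_compact n j) u

/-- The adjoint of `truncMoll` mollifies and then truncates. By the product rule, `transportReg` is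
`f · ∇` applied to that adjoint: testing the equation with it gives the derivative of the
regularized solution. -/
lemma toL2_transport_cut_smear (n : ℕ) {f : Rd d → Rd d} (hf : Continuous f) (u : L2 d) :
    toL2 (transport f fun x => cut d n x * smear (moll d n) (fun y => u y) x)
      = transportReg n f u := by
  set z := smear (moll d n) fun y => u y with hz
  have hzL : MemLp z 2 volume := memLp_smear (moll_smooth n).continuous (moll_compact n) u
  have hzs : ContDiff ℝ ∞ z := smear_moll_smooth n u
  have hm1 := fun j => (isBddCont_cutTail n hf j).memLp_mul hzL
  have hm2 := fun j => (isBddCont_coord_cutField n hf j).memLp_mul (memLp_partialD_smear n j u)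
  have e : ∀ j, mulOp (cutTail n f j) (conv (moll d n) u)
      + mulOp (coord (cutField n f) j) (conv (partialD j (moll d n)) u)
      = toL2 fun x => cutTail n f j x * z x + coord (cutField n f) j x * partialD j z x := by
    intro j
    rw [conv_moll_eq, conv_moll_deriv_eq, mulOp_toL2 (isBddCont_cutTail n hf j) hzL,
      mulOp_toL2 (isBddCont_coord_cutField n hf j) (memLp_partialD_smear n j u),
      toL2_add (hm1 j) (hm2 j)]
  rw [transportReg_apply]
  simp_rw [e]
  have hm3 : ∀ j, MemLp (fun x => cutTail n f j x * z x
      + coord (cutField n f) j x * partialD j z x) 2 volume := fun j => (hm1 j).add (hm2 j)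
  rw [toL2_sum _ hm3]
  congr 1
  ext x
  rw [transport_eq_sum]
  refine Finset.sum_congr rfl fun j _ => ?_
  have h1 : DifferentiableAt ℝ (cut d n) x := (cut_smooth n).differentiable (by simp) x
  have h2 : DifferentiableAt ℝ z x := hzs.differentiable (by simp) x
  have h3 : fderiv ℝ (fun x => cut d n x * z x) x = _ := (h1.hasFDerivAt.mul h2.hasFDerivAt).fderiv
  have h4 : partialD j (fun x => cut d n x * z x) x
      = cut d n x * partialD j z x + partialD j (cut d n) x * z x := by
    rw [partialD, h3]
    simp [partialD]; ring
  rw [h4, coord_cutField, cutTail]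
  ring

/-- The decay of the gradient of the cutoff offsets the linear growth of the drift. Keeping `b t`
whole is harmless, since uniqueness only needs some integrable Grönwall kernel. -/
lemma exists_cutTail_bound (d m : ℕ) : ∃ c : ℝ, 0 ≤ c ∧ ∀ {T : ℝ} {a : ℝ → Rd d → Rd d}
    {k b : ℝ → ℝ}, RegularDrift m T a k b → ∀ (n : ℕ) (t : ℝ) (j : Fin d) (x : Rd d),
    |cutTail n (a t) j x| ≤ c * (k t + b t) := by
  obtain ⟨c, hc, hcut⟩ := exists_cut_bound d 1
  refine ⟨2 * c, by positivity, fun {T a k b} h n t j x => ?_⟩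
  have hb := h.b_nonneg t
  have h1 := h.norm_iteratedFDeriv_cut_mul_le hc le_rfl t x (hcut n 1 le_rfl x)
  have h2 : |partialD j (cut d n) x| ≤ ‖iteratedFDeriv ℝ 1 (cut d n) x‖ :=
    norm_wordD_le [j] (contDiff_infty.1 (cut_smooth n) _) x
  rw [cutTail, abs_mul, mul_comm]
  refine (mul_le_mul h2 (abs_coord_le (a t) j x) (abs_nonneg _) (norm_nonneg _)).trans (h1.trans ?_)
  have h3 : b t / (n + 1 : ℝ) ≤ b t :=
    div_le_self hb (by linarith [(n.cast_nonneg : (0 : ℝ) ≤ n)])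
  gcongr

namespace RegularDrift

lemma measurable_cutTail (h : RegularDrift m T a k b) (n : ℕ) (j : Fin d) (x : Rd d) :
    Measurable fun t => cutTail n (a t) j x :=
  ((EuclideanSpace.proj (𝕜 := ℝ) j : Rd d →L[ℝ] ℝ).continuous.measurable.comp
    (h.meas x)).mul_const _

lemma aestronglyMeasurable_transportReg (h : RegularDrift m T a k b) (n : ℕ) (u : L2 d) :
    AEStronglyMeasurable fun t => transportReg n (a t) u := by
  simp_rw [transportReg_apply]
  refine Finset.aestronglyMeasurable_fun_sum _ fun j _ => ?_
  exact (aestronglyMeasurable_mulOp (fun t => isBddCont_cutTail n (h.continuous t) j)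
    (fun x => h.measurable_cutTail n j x) _).add (h.aestronglyMeasurable_mulOp_cutField n j _)

lemma exists_norm_transportReg_le (h : RegularDrift m T a k b) (n : ℕ) :
    ∃ c : ℝ, ∀ t, ‖transportReg n (a t)‖ ≤ c * (k t + b t) := by
  obtain ⟨c, hc, htail⟩ := exists_cutTail_bound d m
  refine ⟨∑ j : Fin d, (c + 2 * (n + 1) * ∫ z, ‖partialD j (moll d n) z‖), fun t => ?_⟩
  have hkb : 0 ≤ k t + b t := add_nonneg (h.k_nonneg t) (h.b_nonneg t)
  refine ContinuousLinearMap.opNorm_le_bound _ (mul_nonneg (Finset.sum_nonneg fun j _ =>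
    add_nonneg hc (mul_nonneg (by positivity)
      (integral_nonneg fun _ => norm_nonneg _))) hkb) fun u => ?_
  rw [transportReg_apply, Finset.sum_mul, Finset.sum_mul]
  refine (norm_sum_le _ _).trans (Finset.sum_le_sum fun j _ => ?_)
  have h1 := (norm_mulOp_le (isBddCont_cutTail n (h.continuous t) j) (htail h n t j)
    (conv (moll d n) u)).trans
    (mul_le_mul_of_nonneg_left (norm_moll_conv_le n u) (by positivity))
  have h2 := (norm_mulOp_le (isBddCont_coord_cutField n (h.continuous t) j)
    (fun x => (abs_coord_le _ _ _).trans (h.norm_cutField_le n t x))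
    (conv (partialD j (moll d n)) u)).trans
    (mul_le_mul_of_nonneg_left (norm_conv_apply_le (integrable_moll_deriv n j) u) (by positivity))
  refine (norm_add_le _ _).trans ((add_le_add h1 h2).trans (le_of_eq ?_))
  ring

end RegularDrift

/-- Friedrichs' lemma: the commutator of transport and regularization is bounded. -/
lemma exists_commutator_bound (d m : ℕ) : ∃ c : ℝ, 0 ≤ c ∧ ∀ {T : ℝ} {a : ℝ → Rd d → Rd d}
    {k b : ℝ → ℝ}, RegularDrift m T a k b → ∀ (n : ℕ) (t : ℝ) (u : L2 d),
    |inner ℝ u (transportReg n (a t) (truncMoll d n u))| ≤ c * (k t + b t) * ‖u‖ ^ 2 := by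
  obtain ⟨c₁, hc₁, htail⟩ := exists_cutTail_bound d m
  obtain ⟨c₂, hc₂, hfield⟩ := exists_cutField_bound d m
  have hM : ∀ j : Fin d, 0 ≤ ∫ z, ‖z‖ * ‖partialD j (baseBump d) z‖ := fun j =>
    integral_nonneg fun _ => by positivity
  refine ⟨∑ j : Fin d, (c₁ + (c₂ * (∫ z, ‖z‖ * ‖partialD j (baseBump d) z‖) + c₂)),
    Finset.sum_nonneg fun j _ => add_nonneg hc₁ (add_nonneg (mul_nonneg hc₂ (hM j)) hc₂),
    fun {T a k b} h n t u => ?_⟩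
  have hk := h.k_nonneg t
  have hb := h.b_nonneg t
  set w := mulOp (cut d n) u with hw
  set v := conv (moll d n) w with hv
  have hwu : ‖w‖ ≤ ‖u‖ := by
    have := norm_mulOp_le (cut_isBddCont n) (abs_cut_le_one n) u
    rwa [one_mul] at this
  have hvu : ‖v‖ ≤ ‖u‖ := (norm_moll_conv_le n w).trans hwu
  -- The cutoff of index `2 * n + 1` is `1` for `‖x‖ ≤ 2 (n + 1)`, hence on the support of `cut d
  -- n`. So `cut d n • a t = cut d n • f`, and the factor `cut d n` can be given to `u`, leaving a
  -- compactly supported Lipschitz field.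
  set f := cutField (2 * n + 1) (a t) with hf
  have hf1 : ContDiff ℝ 1 f := by
    exact_mod_cast contDiff_cutField (k := 1) (2 * n + 1) (by exact_mod_cast h.contDiff_one t)
  have hfd : ∀ x, ‖iteratedFDeriv ℝ 1 f x‖ ≤ c₂ * (k t + b t) := fun x => by
    refine (hfield h (2 * n + 1) t 1 le_rfl (by omega) x).trans ?_
    have h3 : b t / ((2 * n + 1 : ℕ) + 1 : ℝ) ≤ b t :=
      div_le_self hb (by linarith [((2 * n + 1 : ℕ).cast_nonneg : (0 : ℝ) ≤ (2 * n + 1 : ℕ))])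
    gcongr
  have hfb : ∀ j, IsBddCont (coord f j) := fun j =>
    isBddCont_coord_cutField (2 * n + 1) (h.continuous t) j
  have hterm : ∀ j : Fin d, |inner ℝ u (mulOp (cutTail n (a t) j) (conv (moll d n) v)
      + mulOp (coord (cutField n (a t)) j) (conv (partialD j (moll d n)) v))|
      ≤ (c₁ + (c₂ * (∫ z, ‖z‖ * ‖partialD j (baseBump d) z‖) + c₂)) * (k t + b t) * ‖u‖ ^ 2 := by
    intro j
    have h1 : |inner ℝ u (mulOp (cutTail n (a t) j) (conv (moll d n) v))|
        ≤ c₁ * (k t + b t) * ‖u‖ ^ 2 := by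
      refine (abs_real_inner_le_norm _ _).trans ?_
      have := (norm_mulOp_le (isBddCont_cutTail n (h.continuous t) j) (htail h n t j)
        (conv (moll d n) v)).trans (mul_le_mul_of_nonneg_left
          ((norm_moll_conv_le n v).trans hvu) (by positivity))
      calc _ ≤ ‖u‖ * (c₁ * (k t + b t) * ‖u‖) := mul_le_mul_of_nonneg_left this (norm_nonneg _)
        _ = _ := by ring
    have e2 : inner ℝ u (mulOp (coord (cutField n (a t)) j) (conv (partialD j (moll d n)) v))
        = inner ℝ w (mulOp (coord f j) (conv (partialD j (moll d n)) v)) := by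
      rw [hw, inner_mulOp (cut_isBddCont n)]
      congr 1
      refine Lp.ext ?_
      filter_upwards [coeFn_mulOp (isBddCont_coord_cutField n (h.continuous t) j)
        (conv (partialD j (moll d n)) v), coeFn_mulOp (hfb j) (conv (partialD j (moll d n)) v),
        coeFn_mulOp (cut_isBddCont n) (mulOp (coord f j) (conv (partialD j (moll d n)) v))]
        with x h1 h2 h3
      rw [h1, h3, h2, hf, coord_cutField, coord_cutField]
      rcases le_total ‖x‖ (2 * (n + 1 : ℝ)) with hx | hx
      · rw [cut_eq_one (2 * n + 1) (by push_cast; linarith)]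
        ring
      · rw [cut_eq_zero n hx]; ring
    -- The loss of `n + 1` in differentiating the mollifier is offset by the factor `‖z‖` of the
    -- Lipschitz bound: the first moment does not depend on the scale.
    have h3 : ‖mulOp (coord f j) (conv (partialD j (moll d n)) v)
        - conv (partialD j (moll d n)) (mulOp (coord f j) v)‖
        ≤ c₂ * (k t + b t) * (∫ z, ‖z‖ * ‖partialD j (baseBump d) z‖) * ‖v‖ := by
      rw [← moment_moll n j]
      refine norm_commutator_le (hfb j) (fun x y => ?_) (integrable_moll_deriv n j)
        (integrable_moment_moll_deriv n j) v
      refine le_trans ?_ (norm_sub_le_of_iteratedFDeriv hf1 hfd x y)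
      exact PiLp.norm_apply_le (f x - f y) j
    -- Once the skew-adjoint convolution is moved to `w`, this is the transport integral of `v`,
    -- controlled by one derivative of `f`.
    have h4 : |inner ℝ w (conv (partialD j (moll d n)) (mulOp (coord f j) v))|
        ≤ c₂ * (k t + b t) * ‖v‖ ^ 2 := by
      have hz := memLp_smear (moll_smooth (d := d) n).continuous (moll_compact n) w
      have e3 : inner ℝ w (conv (partialD j (moll d n)) (mulOp (coord f j) v))
          = - ∫ x, coord f j x * partialD j (smear (moll d n) fun y => w y) x
            * smear (moll d n) (fun y => w y) x := by
        rw [real_inner_comm, inner_conv (integrable_moll_deriv n j)]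
        simp_rw [partialD_moll_neg]
        rw [conv_neg (integrable_moll_deriv n j), inner_neg_right, conv_moll_deriv_eq, hv,
          conv_moll_eq, mulOp_toL2 (hfb j) hz,
          inner_toL2_toL2 ((hfb j).memLp_mul hz) (memLp_partialD_smear n j w)]
        congr 1
        refine integral_congr_ae (Eventually.of_forall fun x => ?_)
        simp only; ring
      rw [e3, abs_neg, hv, conv_moll_eq]
      exact abs_integral_transport_le hf1 (hasCompactSupport_cutField _ _) hfd
        ((smear_moll_smooth n w).of_le (by simp)) hz j
    rw [inner_add_right, e2]
    have e4 : inner ℝ w (mulOp (coord f j) (conv (partialD j (moll d n)) v))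
        = inner ℝ w (mulOp (coord f j) (conv (partialD j (moll d n)) v)
          - conv (partialD j (moll d n)) (mulOp (coord f j) v))
          + inner ℝ w (conv (partialD j (moll d n)) (mulOp (coord f j) v)) := by
      rw [← inner_add_right, sub_add_cancel]
    have h5 := (abs_real_inner_le_norm w (mulOp (coord f j) (conv (partialD j (moll d n)) v)
          - conv (partialD j (moll d n)) (mulOp (coord f j) v))).trans
          (mul_le_mul hwu h3 (norm_nonneg _) (norm_nonneg _))
    have h6 : ‖u‖ * (c₂ * (k t + b t) * (∫ z, ‖z‖ * ‖partialD j (baseBump d) z‖) * ‖v‖)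
        ≤ ‖u‖ * (c₂ * (k t + b t) * (∫ z, ‖z‖ * ‖partialD j (baseBump d) z‖) * ‖u‖) := by
      have := hM j
      gcongr
    have h7 : c₂ * (k t + b t) * ‖v‖ ^ 2 ≤ c₂ * (k t + b t) * ‖u‖ ^ 2 := by gcongr
    rw [e4]
    refine (abs_add_le _ _).trans ((add_le_add h1 (abs_add_le _ _)).trans ?_)
    calc _ ≤ c₁ * (k t + b t) * ‖u‖ ^ 2
          + (‖u‖ * (c₂ * (k t + b t) * (∫ z, ‖z‖ * ‖partialD j (baseBump d) z‖) * ‖u‖)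
            + c₂ * (k t + b t) * ‖u‖ ^ 2) := by
          gcongr
          · exact h5.trans h6
          · exact h4.trans h7
      _ = _ := by ring
  change |inner ℝ u (transportReg n (a t) v)| ≤ _
  rw [transportReg_apply, inner_sum, Finset.sum_mul, Finset.sum_mul]
  exact (Finset.abs_sum_le_sum_abs _ _).trans (Finset.sum_le_sum fun j _ => hterm j)

/-- Uniqueness of bounded `L²` solutions. -/
theorem eq_zero_of_solvesFrom (h : RegularDrift m T a k b) {σ : ℝ → L2 d} {B : ℝ}
    (hB : ∀ t, ‖σ t‖ ≤ B) (hσm : AEStronglyMeasurable σ) {t₀ : ℝ} (h0 : σ t₀ = 0)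
    (hσ : SolvesFrom a 0 t₀ σ) (t : ℝ) : σ t = 0 := by
  obtain ⟨c, -, hc⟩ := exists_commutator_bound d m
  choose C hC using fun n => h.exists_norm_transportReg_le n
  have hkb : Integrable fun t => k t + b t := h.integrable_k.add h.integrable_b
  refine eq_zero_of_regularization (t₀ := t₀) hB hσm (M := truncMoll d)
    (N := fun n t => transportReg n (a t)) (ν := fun n t => C n * (k t + b t))
    (fun n => hkb.const_mul _) hC (fun n f => h.aestronglyMeasurable_transportReg n f)
    (fun n f s => ?_) (hkb.const_mul c) (fun n t f => hc h n t f) tendsto_truncMoll t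
  have hz := memLp_smear (moll_smooth (d := d) n).continuous (moll_compact n) f
  have e : inner ℝ (truncMoll d n (σ s)) f
      = inner ℝ (σ s) (toL2 fun x => cut d n x * smear (moll d n) (fun y => f y) x) := by
    rw [truncMoll, ContinuousLinearMap.comp_apply, inner_moll_conv, inner_mulOp (cut_isBddCont n),
      conv_moll_eq, mulOp_toL2 (cut_isBddCont n) hz]
  rw [e, hσ _ ((cut_smooth n).mul (smear_moll_smooth n f)) (cut_compact n).mul_right s, h0]
  simp only [Pi.zero_apply, inner_zero_left, zero_add]
  simp_rw [fun τ => toL2_transport_cut_smear n (h.continuous τ) f]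

end Uniqueness

/-! ### From weak to strong continuity in `H^m`. -/

section StrongContinuity

variable {d m : ℕ}

/-- Weak continuity and upper semicontinuity of the norm give strong continuity. -/
lemma continuousAt_of_weak {H : Type*} [NormedAddCommGroup H] [InnerProductSpace ℝ H]
    {ρ : ℝ → H} {t₀ : ℝ} (hw : ContinuousAt (fun t => inner ℝ (ρ t) (ρ t₀)) t₀) {r : ℝ → ℝ}
    (hr : ∀ t, ‖ρ t‖ ≤ r t) (hrc : ContinuousAt r t₀) (hr0 : r t₀ = ‖ρ t₀‖) :
    ContinuousAt ρ t₀ := by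
  rw [ContinuousAt, tendsto_iff_norm_sub_tendsto_zero]
  have h1 : Tendsto (fun t => r t ^ 2 - 2 * inner ℝ (ρ t) (ρ t₀) + ‖ρ t₀‖ ^ 2) (𝓝 t₀) (𝓝 0) := by
    have h : Tendsto (fun t => r t ^ 2 - 2 * inner ℝ (ρ t) (ρ t₀) + ‖ρ t₀‖ ^ 2) (𝓝 t₀)
        (𝓝 (r t₀ ^ 2 - 2 * inner ℝ (ρ t₀) (ρ t₀) + ‖ρ t₀‖ ^ 2)) :=
      ((hrc.pow 2).sub (hw.const_mul 2)).add_const (‖ρ t₀‖ ^ 2)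
    rw [hr0, real_inner_self_eq_norm_sq] at h
    convert h using 2
    ring
  have h2 : Tendsto (fun t => ‖ρ t - ρ t₀‖ ^ 2) (𝓝 t₀) (𝓝 0) := by
    refine squeeze_zero (fun t => sq_nonneg _) (fun t => ?_) h1
    rw [norm_sub_sq_real]
    have := hr t
    gcongr
  have h3 := h2.sqrt
  rw [Real.sqrt_zero] at h3
  exact h3.congr fun t => Real.sqrt_sq (norm_nonneg _)

/-- Existence of a strongly continuous solution. -/
theorem exists_continuous_evolution (d m : ℕ) : ∃ K : ℝ, 0 ≤ K ∧ ∀ {T : ℝ} {a : ℝ → Rd d → Rd d}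
    {k b : ℝ → ℝ}, RegularDrift m T a k b → ∀ {g : ℝ → HS d m}, Integrable g →
    ∀ u₀ : HS d m, ∃ ρ : ℝ → HS d m, Continuous ρ ∧ ρ 0 = u₀ ∧ (∃ B : ℝ, ∀ t, ‖ρ t‖ ≤ B) ∧
      (∀ t, ‖ρ t‖ ≤ (‖u₀‖ + 2 * |∫ τ in 0..t, ‖g τ‖|) * Real.exp (2 * |∫ τ in 0..t, K * k τ|)) ∧
      SolvesFrom a (fun t => incl d m (g t)) 0 (fun t => incl d m (ρ t)) ∧
      ∀ Φ : ℝ × Rd d → ℝ, ContDiff ℝ ∞ Φ → HasCompactSupport Φ → ∀ t,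
        inner ℝ (incl d m (ρ t)) (toL2 (slice Φ t)) = inner ℝ (incl d m u₀) (toL2 (slice Φ 0))
          + ∫ τ in 0..t, (inner ℝ (incl d m (g τ)) (toL2 (slice Φ τ))
            + inner ℝ (incl d m (ρ τ)) (toL2 (slice (timeD Φ) τ))
            + inner ℝ (incl d m (ρ τ)) (toL2 (transport (a τ) (slice Φ τ)))) := by
  obtain ⟨K, hK, hex⟩ := exists_evolution d m
  refine ⟨K, hK, fun {T a k b} h {g} hg u₀ => ?_⟩
  have hKk : Integrable fun τ => K * k τ := h.integrable_k.const_mul K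
  have hbdd : ∀ {t₀ : ℝ} {u : HS d m} {ρ : ℝ → HS d m},
      (∀ t, ‖ρ t‖ ≤ (‖u‖ + 2 * |∫ τ in t₀..t, ‖g τ‖|) * Real.exp (2 * |∫ τ in t₀..t, K * k τ|)) →
      ∀ t, ‖ρ t‖ ≤ (‖u‖ + 2 * ∫ τ, ‖g τ‖) * Real.exp (2 * ∫ τ, K * k τ) := by
    intro t₀ u ρ hρ t
    refine (hρ t).trans ?_
    have h1 := abs_intervalIntegral_le_integral hg.norm (fun t => norm_nonneg _) t₀ t
    have h2 := abs_intervalIntegral_le_integral hKk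
      (fun t => mul_nonneg hK (h.k_nonneg t)) t₀ t
    have h3 : 0 ≤ ∫ τ, ‖g τ‖ := integral_nonneg fun _ => norm_nonneg _
    gcongr
  have hmeas : ∀ {ρ : ℝ → HS d m}, (∀ v, Continuous fun t => inner ℝ (ρ t) v) →
      AEStronglyMeasurable (fun t => incl d m (ρ t)) := by
    intro ρ hρ
    refine aestronglyMeasurable_of_inner fun v => ?_
    have hc := (hρ ((incl d m).adjoint v)).aestronglyMeasurable (μ := volume)
    refine hc.congr (Eventually.of_forall fun t => ?_)
    simp only [ContinuousLinearMap.adjoint_inner_right]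
    exact real_inner_comm _ _
  obtain ⟨ρ, hρc, hρ0, hρb, hρs, hρΦ⟩ := hex h hg 0 u₀
  have hinclb : ∀ {σ : ℝ → HS d m} {B : ℝ}, (∀ t, ‖σ t‖ ≤ B) → ∀ t, ‖incl d m (σ t)‖ ≤ B :=
    fun hσ t => (norm_comp_le _ _).trans (hσ t)
  have hgi : Integrable fun t => incl d m (g t) := (incl d m).integrable_comp hg
  refine ⟨ρ, continuous_iff_continuousAt.2 fun t₀ => ?_, hρ0, ⟨_, hbdd hρb⟩, hρb, hρs, hρΦ⟩
  -- By uniqueness the solution issued from `ρ t₀` at time `t₀` is `ρ` itself, so `ρ` inherits an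
  -- estimate centred at `t₀`.
  obtain ⟨σ, hσc, hσ0, hσb, hσs, -⟩ := hex h hg t₀ (ρ t₀)
  have hρσ : ∀ t, ρ t = σ t := by
    intro t
    refine incl_injective (sub_eq_zero.1 ?_)
    have hrs := hρs.restart h hgi (hinclb (hbdd hρb)) (hmeas hρc) t₀
    have hd := hrs.sub h hgi hσs (hinclb (hbdd hρb)) (hmeas hρc) (hinclb (hbdd hσb)) (hmeas hσc)
    refine eq_zero_of_solvesFrom h (B := _) (fun t => (norm_sub_le _ _).trans
      (add_le_add (hinclb (hbdd hρb) t) (hinclb (hbdd hσb) t)))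
      ((hmeas hρc).sub (hmeas hσc)) ?_ hd t
    rw [hσ0, sub_self]
  have hcont : ∀ {f : ℝ → ℝ}, Integrable f → Continuous fun t => ∫ τ in t₀..t, f τ := fun hf =>
    intervalIntegral.continuous_primitive (fun _ _ => hf.intervalIntegrable) t₀
  -- The bound is continuous and equals `‖ρ t₀‖` at `t₀`, which excludes a jump of the norm on
  -- either side.
  refine continuousAt_of_weak (hρc (ρ t₀)).continuousAt
    (r := fun t => (‖ρ t₀‖ + 2 * |∫ τ in t₀..t, ‖g τ‖|) * Real.exp (2 * |∫ τ in t₀..t, K * k τ|))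
    (fun t => by rw [hρσ t]; exact hσb t) ?_ (by simp)
  have h1 := hcont hg.norm
  have h2 := hcont hKk
  exact ((continuous_const.add (continuous_const.mul h1.abs)).mul
    (Real.continuous_exp.comp (continuous_const.mul h2.abs))).continuousAt

end StrongContinuity

/-! ### Reduction to drifts regular at every time. -/

section Normalization

variable {d m : ℕ} {T : ℝ} {a : ℝ → Rd d → Rd d}

lemma cbNorm_nonneg {F : Type*} [NormedAddCommGroup F] [NormedSpace ℝ F] (k : ℕ) (f : Rd d → F) :
    0 ≤ cbNorm k f :=
  Finset.sum_nonneg fun _ _ => Real.iSup_nonneg fun _ => norm_nonneg _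

lemma sum_multiD_le_cbNorm {F : Type*} [NormedAddCommGroup F] [NormedSpace ℝ F] {k : ℕ}
    {f : Rd d → F} (hf : MemCb k f) (x : Rd d) :
    ∑ α : MultiIndex d k, ‖multiD α.toFun f x‖ ≤ cbNorm k f := by
  refine Finset.sum_le_sum fun α _ => ?_
  obtain ⟨B, hB⟩ := hf.2 α
  exact le_ciSup (f := fun x => ‖multiD α.toFun f x‖) ⟨B, by rintro _ ⟨y, rfl⟩; exact hB y⟩ x

/-- The `i`-th derivative of `f` has the norm of the derivative of order `i - 1` of `jac f`, which
is why order `0` is excluded and `m + 1` allowed. -/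
lemma norm_iteratedFDeriv_le_cbNorm {f : Rd d → Rd d} (hf : MemCb m (jac f)) {i : ℕ} (hi : 1 ≤ i)
    (him : i ≤ m + 1) (x : Rd d) :
    ‖iteratedFDeriv ℝ i f x‖ ≤ (d + 1) ^ m * cbNorm m (jac f) := by
  obtain ⟨i, rfl⟩ := Nat.exists_eq_add_of_le' hi
  rw [← norm_iteratedFDeriv_fderiv]
  refine (norm_iteratedFDeriv_le_multiD (k := m) (by omega) hf.1 x).trans ?_
  exact mul_le_mul_of_nonneg_left (sum_multiD_le_cbNorm hf x) (by positivity)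

lemma norm_zero_le_cSeminorm (k : ℕ) (f : Rd d → Rd d) : ‖f 0‖ ≤ cSeminorm k {0} f := by
  have h0 : multiD (MultiIndex.zero d k).toFun f = f := by
    rw [multiD_eq_wordD]
    have : word (MultiIndex.zero d k).toFun = [] := by
      refine List.eq_nil_of_length_eq_zero ?_
      rw [length_word]
      simp [MultiIndex.zero, MultiIndex.toFun]
    rw [this, wordD_nil]
  have h1 : ‖f 0‖ ≤ ⨆ x : ({0} : Set (Rd d)), ‖multiD (MultiIndex.zero d k).toFun f x‖ := by
    rw [h0]
    exact le_ciSup (f := fun x : ({0} : Set (Rd d)) => ‖f x‖) (Set.finite_range _).bddAbove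
      ⟨0, rfl⟩
  refine h1.trans (Finset.single_le_sum (f := fun α : MultiIndex d k =>
    ⨆ x : ({0} : Set (Rd d)), ‖multiD α.toFun f x‖)
    (fun _ _ => Real.iSup_nonneg fun _ => norm_nonneg _) (Finset.mem_univ _))

lemma DriftHyp.integrableOn_norm_zero (h : DriftHyp T m a) :
    IntegrableOn (fun t => ‖a t 0‖) (Icc 0 T) := by
  refine (h.1.2.2 {0} isCompact_singleton).mono' (h.1.1 0).norm (Eventually.of_forall fun t => ?_)
  rw [norm_norm]
  exact norm_zero_le_cSeminorm (m + 1) (a t)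

/-- After modification on a null set of times, a drift becomes regular. -/
theorem DriftHyp.exists_regularDrift (h : DriftHyp T m a) :
    ∃ (a' : ℝ → Rd d → Rd d) (k b : ℝ → ℝ), RegularDrift m T a' k b ∧
      (∀ᵐ t ∂(volume.restrict (Icc 0 T)), a' t = a t) ∧
      ∀ t, k t ≤ (d + 1) ^ m * cbNorm m (jac (a t)) := by
  set μ := (volume : Measure ℝ).restrict (Icc 0 T) with hμ
  -- Measurability in time holds for each `x` up to a null set depending on `x`. A countable dense
  -- set needs a single null set, and continuity in `x` handles the other points.
  set D : ℕ → Rd d := TopologicalSpace.denseSeq (Rd d)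
  set P : ℝ → Prop := fun t => ContDiff ℝ (m + 1 : ℕ) (a t) ∧ MemCb m (jac (a t)) ∧
    ∀ n, a t (D n) = (h.1.1 (D n)).mk _ t with hP
  have hae : ∀ᵐ t ∂μ, P t := by
    filter_upwards [h.1.2.1, h.2.2.1, ae_all_iff.2 fun n => (h.1.1 (D n)).ae_eq_mk]
      with t h1 h2 h3
    exact ⟨by exact_mod_cast h1, h2, h3⟩
  -- The bad times need not form a measurable set, so a measurable null superset is removed; the
  -- drift is set to zero outside `G`.
  set G : Set ℝ := Icc 0 T \ toMeasurable μ {t | ¬ P t} with hG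
  have hGm : MeasurableSet G := measurableSet_Icc.diff (measurableSet_toMeasurable _ _)
  have hGP : ∀ t ∈ G, P t := fun t ht => by
    by_contra hne
    exact ht.2 (subset_toMeasurable _ _ hne)
  have hGae : ∀ᵐ t ∂μ, t ∈ G := by
    have h1 : ∀ᵐ t ∂μ, t ∉ toMeasurable μ {t | ¬ P t} := by
      refine measure_eq_zero_iff_ae_notMem.1 ?_
      rw [measure_toMeasurable]
      exact hae
    filter_upwards [h1, ae_restrict_mem measurableSet_Icc] with t h1 h2
    exact ⟨h2, h1⟩
  have hGI : G ⊆ Icc 0 T := sdiff_subset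
  set κ : ℝ → ℝ := fun t => (d + 1) ^ m * cbNorm m (jac (a t)) with hκ
  have hκ0 : ∀ t, 0 ≤ κ t := fun t => mul_nonneg (by positivity) (cbNorm_nonneg _ _)
  have hin : ∀ t ∈ G, G.indicator a t = a t := fun t ht => indicator_of_mem ht a
  have hout : ∀ t, t ∉ G → G.indicator a t = 0 := fun t ht => indicator_of_notMem ht a
  have hcd : ∀ t, ContDiff ℝ (m + 1 : ℕ) (G.indicator a t) := fun t => by
    by_cases ht : t ∈ G
    · rw [hin t ht]; exact (hGP t ht).1
    · rw [hout t ht]; exact contDiff_const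
  refine ⟨G.indicator a, G.indicator κ, G.indicator fun t => ‖a t 0‖, ⟨?_, hcd, ?_, ?_, ?_, ?_,
    ?_, ?_, ?_⟩, ?_, ?_⟩
  · have hD : ∀ n, Measurable fun t => G.indicator a t (D n) := fun n => by
      have e : (fun t => G.indicator a t (D n)) = G.indicator ((h.1.1 (D n)).mk _) := by
        ext1 t
        by_cases ht : t ∈ G
        · rw [hin t ht, indicator_of_mem ht]; exact (hGP t ht).2.2 n
        · rw [hout t ht, indicator_of_notMem ht]; rfl
      rw [e]
      exact (h.1.1 (D n)).stronglyMeasurable_mk.measurable.indicator hGm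
    intro x
    have hx : x ∈ closure (range D) := TopologicalSpace.denseRange_denseSeq (Rd d) x
    obtain ⟨y, hy, hlim⟩ := mem_closure_iff_seq_limit.1 hx
    choose ν hν using hy
    refine measurable_of_tendsto_metrizable (f := fun n t => G.indicator a t (y n)) (fun n => ?_)
      (tendsto_pi_nhds.2 fun t => ((hcd t).continuous.tendsto x).comp hlim)
    rw [← hν n]; exact hD _
  · rw [integrable_indicator_iff hGm]
    exact IntegrableOn.mono_set (h.2.2.2.const_mul _) hGI
  · rw [integrable_indicator_iff hGm]
    exact h.integrableOn_norm_zero.mono_set hGI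
  · exact fun t => indicator_nonneg (fun t _ => hκ0 t) t
  · exact fun t => indicator_nonneg (fun t _ => norm_nonneg _) t
  · intro t i hi him x
    by_cases ht : t ∈ G
    · rw [hin t ht, indicator_of_mem ht]
      exact norm_iteratedFDeriv_le_cbNorm (hGP t ht).2.1 hi him x
    · rw [hout t ht, indicator_of_notMem ht]
      have : iteratedFDeriv ℝ i (0 : Rd d → Rd d) x = 0 := by
        rw [show (0 : Rd d → Rd d) = fun _ => 0 from rfl, iteratedFDeriv_fun_zero]; rfl
      rw [this, norm_zero]
  · intro t
    by_cases ht : t ∈ G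
    · rw [hin t ht, indicator_of_mem ht]
    · rw [hout t ht, indicator_of_notMem ht]; simp
  · exact fun t ht => hout t fun h => ht (hGI h)
  · filter_upwards [hGae] with t ht using hin t ht
  · intro t
    exact indicator_le_self' (fun t _ => hκ0 t) t

end Normalization

/-! ### The weak formulation in terms of `L²` inner products. -/

section WeakForm

variable {d m : ℕ} {T : ℝ} {a : ℝ → Rd d → Rd d} {k b : ℝ → ℝ}

/-- The weak formulation of the Liouville problem, in terms of inner products in `L²`. -/
def WeakForm (T : ℝ) (a : ℝ → Rd d → Rd d) (g : ℝ → L2 d) (r : L2 d) (σ : ℝ → L2 d) : Prop :=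
  ∀ φ : ℝ × Rd d → ℝ, IsTestFunction T φ →
    -(∫ t in (0 : ℝ)..T, inner ℝ (σ t) (toL2 (slice (timeD φ) t)))
      - (∫ t in (0 : ℝ)..T, inner ℝ (σ t) (toL2 (transport (a t) (slice φ t))))
    = (∫ t in (0 : ℝ)..T, inner ℝ (g t) (toL2 (slice φ t))) + inner ℝ r (toL2 (slice φ 0))

/-- The time integrals ignore null sets and times outside `[0, T]`, so the drift may be regularized
and the curves extended arbitrarily. -/
lemma isWeakSolution_iff (hT : 0 ≤ T) {a' : ℝ → Rd d → Rd d} (h : RegularDrift m T a' k b)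
    (hae : ∀ᵐ t ∂(volume.restrict (Icc 0 T)), a' t = a t) {g : ℝ → Hm d m} {ρ₀ : Hm d m}
    {σ : ℝ → Hm d m} {g' σ' : ℝ → L2 d} (hg : ∀ t ∈ Icc 0 T, g' t = (g t).toL2)
    (hσ : ∀ t ∈ Icc 0 T, σ' t = (σ t).toL2) :
    IsWeakSolution T a g ρ₀ σ ↔ WeakForm T a' g' ρ₀.toL2 σ' := by
  refine forall₂_congr fun φ hφ => ?_
  have hI : ∀ {t}, t ∈ uIcc 0 T → t ∈ Icc 0 T := fun ht => by rwa [uIcc_of_le hT] at ht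
  have e1 : ∫ t in (0 : ℝ)..T, ∫ x, (σ t).toL2 x * deriv (fun s => φ (s, x)) t
      = ∫ t in (0 : ℝ)..T, inner ℝ (σ' t) (toL2 (slice (timeD φ) t)) := by
    refine intervalIntegral.integral_congr fun t ht => ?_
    rw [hσ t (hI ht), inner_toL2_right _ (slice_memLp (timeD_smooth hφ.1) (timeD_compact hφ.2.1) t)]
    simp_rw [fun x => (hasDerivAt_time hφ.1 t x).deriv]
    rfl
  have e2 : ∫ t in (0 : ℝ)..T, ∫ x, (σ t).toL2 x * fderiv ℝ (fun y => φ (t, y)) x (a t x)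
      = ∫ t in (0 : ℝ)..T, inner ℝ (σ' t) (toL2 (transport (a' t) (slice φ t))) := by
    refine intervalIntegral.integral_congr_ae ?_
    filter_upwards [ae_imp_of_ae_restrict hae] with t h1 ht
    rw [uIoc_of_le hT] at ht
    have ht' : t ∈ Icc 0 T := Ioc_subset_Icc_self ht
    rw [hσ t ht', inner_toL2_right _ (memLp_transport (h.continuous t) (slice_smooth hφ.1 t)
      (slice_compact hφ.2.1 t)), h1 ht']
    rfl
  have e3 : ∫ t in (0 : ℝ)..T, ∫ x, (g t).toL2 x * φ (t, x)
      = ∫ t in (0 : ℝ)..T, inner ℝ (g' t) (toL2 (slice φ t)) := by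
    refine intervalIntegral.integral_congr fun t ht => ?_
    rw [hg t (hI ht), inner_toL2_right _ (slice_memLp hφ.1 hφ.2.1 t)]
    rfl
  have e4 : ∫ x, ρ₀.toL2 x * φ (0, x) = inner ℝ ρ₀.toL2 (toL2 (slice φ 0)) := by
    rw [inner_toL2_right _ (slice_memLp hφ.1 hφ.2.1 0)]
    rfl
  rw [e1, e2, e3, e4]

/-- A solution in integrated form, tested with functions on space-time, is a weak solution. -/
lemma weakForm_of_integrated (h : RegularDrift m T a k b) {g σ : ℝ → L2 d} {r : L2 d}
    (hg : Integrable g) (hσ : Continuous σ) {B : ℝ} (hB : ∀ t, ‖σ t‖ ≤ B)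
    (hΦ : ∀ Φ : ℝ × Rd d → ℝ, ContDiff ℝ ∞ Φ → HasCompactSupport Φ → ∀ t,
        inner ℝ (σ t) (toL2 (slice Φ t)) = inner ℝ r (toL2 (slice Φ 0))
          + ∫ τ in 0..t, (inner ℝ (g τ) (toL2 (slice Φ τ))
            + inner ℝ (σ τ) (toL2 (slice (timeD Φ) τ))
            + inner ℝ (σ τ) (toL2 (transport (a τ) (slice Φ τ))))) :
    WeakForm T a g r σ := by
  intro φ hφ
  have hm : AEStronglyMeasurable σ := hσ.aestronglyMeasurable
  have i2 := (integrable_inner_of_bounded hB hm (integrable_toL2_slice (timeD_smooth hφ.1)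
    (timeD_compact hφ.2.1))).intervalIntegrable (a := 0) (b := T)
  have i3 := (integrable_inner_of_bounded hB hm
    (h.integrable_transport_slice hφ.1 hφ.2.1)).intervalIntegrable (a := 0) (b := T)
  obtain ⟨C, hC⟩ := (hasCompactSupport_toL2_slice hφ.2.1).exists_bound_of_continuous
    (continuous_toL2_slice hφ.1 hφ.2.1)
  have i1 : IntervalIntegrable (fun t => inner ℝ (g t) (toL2 (slice φ t))) volume 0 T := by
    have := integrable_inner_of_bounded hC (continuous_toL2_slice hφ.1
      hφ.2.1).aestronglyMeasurable hg
    simp_rw [real_inner_comm] at this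
    exact this.intervalIntegrable
  have e := hΦ φ hφ.1 hφ.2.1 T
  -- The support lies in `t < T`, so there is no boundary term at the final time.
  have h0 : slice φ T = fun _ => 0 := by
    ext x
    by_contra hne
    exact lt_irrefl T (hφ.2.2 (subset_tsupport φ (show (T, x) ∈ Function.support φ from hne)))
  rw [h0, toL2_zero, inner_zero_right, intervalIntegral.integral_add (i1.add i2) i3,
    intervalIntegral.integral_add i1 i2] at e
  linarith

end WeakForm

/-! ### From weak solutions to the integrated equation. -/

section Converse

variable {d m : ℕ} {T : ℝ} {a : ℝ → Rd d → Rd d} {k b : ℝ → ℝ}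

/-- The fundamental lemma of the calculus of variations in the form needed to recover the integrated
equation from the weak one. -/
lemma eqOn_primitive_of_weak (hT : 0 < T) {F G : ℝ → ℝ} {c : ℝ} (hF : Continuous F)
    (hG : Integrable G)
    (hw : ∀ θ : ℝ → ℝ, ContDiff ℝ ∞ θ → HasCompactSupport θ → (∃ T' < T, ∀ t, T' ≤ t → θ t = 0) →
      -(∫ t in (0 : ℝ)..T, deriv θ t * F t) = (∫ t in (0 : ℝ)..T, θ t * G t) + θ 0 * c) :
    EqOn F (fun t => c + ∫ τ in 0..t, G τ) (Icc 0 T) := by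
  set P : ℝ → ℝ := fun t => c + ∫ τ in 0..t, G τ with hP
  have hPc : Continuous P := continuous_const.add (continuous_integral_from hG 0)
  have hPsub : ∀ s t, P t - P s = ∫ τ in s..t, G τ := fun s t => by
    rw [← integral_sub_from hG 0 s t]; simp only [hP]; ring
  have hq : Continuous fun t => F t - P t := hF.sub hPc
  have hzero : ∀ᵐ t, t ∈ Ioo 0 T → F t - P t = 0 := by
    refine isOpen_Ioo.ae_eq_zero_of_integral_contDiff_smul_eq_zero
      (hq.locallyIntegrable.locallyIntegrableOn _) fun χ hχ hχc hχs => ?_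
    have hχz : ∀ t, t ∉ Ioo 0 T → χ t = 0 := fun t ht => by
      by_contra hne
      exact ht (hχs (subset_tsupport χ hne))
    obtain ⟨T', hT', hχT⟩ : ∃ T' < T, ∀ t, T' ≤ t → χ t = 0 := by
      have hTn : (tsupport χ)ᶜ ∈ 𝓝 T :=
        (isClosed_tsupport χ).isOpen_compl.mem_nhds fun hmem => lt_irrefl T (hχs hmem).2
      obtain ⟨l, u, hlu, hsub⟩ := mem_nhds_iff_exists_Ioo_subset.1 hTn
      refine ⟨(l + T) / 2, by linarith [hlu.1], fun t ht => ?_⟩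
      by_cases htT : t < T
      · by_contra hne
        exact hsub ⟨by linarith [hlu.1], htT.trans hlu.2⟩ (subset_tsupport χ hne)
      · exact hχz t fun hmem => htT hmem.2
    -- The primitive of `-χ` that vanishes near `T`: testing with it turns the weak equation into
    -- information on `∫ χ F`.
    set Θ : ℝ → ℝ := fun t => - ∫ τ in T..t, χ τ with hΘ
    have hΘd : ∀ t, HasDerivAt Θ (-χ t) t := fun t =>
      (intervalIntegral.integral_hasDerivAt_right (hχ.continuous.intervalIntegrable _ _)
        (hχ.continuous.stronglyMeasurableAtFilter _ _) hχ.continuous.continuousAt).neg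
    have hΘs : ContDiff ℝ ∞ Θ := by
      rw [contDiff_infty_iff_deriv]
      refine ⟨fun t => (hΘd t).differentiableAt, ?_⟩
      have : deriv Θ = fun t => -χ t := by ext t; exact (hΘd t).deriv
      rw [this]
      exact hχ.neg
    have hΘz : ∀ t, T' ≤ t → Θ t = 0 := fun t ht => by
      rw [hΘ]
      simp only
      rw [neg_eq_zero, ← intervalIntegral.integral_zero (a := T) (b := t) (μ := volume)]
      refine intervalIntegral.integral_congr fun τ hτ => hχT τ ?_
      exact (le_min hT'.le ht).trans hτ.1
    -- `Θ` is constant, possibly nonzero, for negative times; a bump equal to `1` near `[0, T]`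
    -- makes the support compact and changes none of the integrals.
    let β : ContDiffBump (0 : ℝ) := ⟨T + 1, T + 2, by linarith, by linarith⟩
    have hβ : ∀ t ∈ Icc 0 T, (fun t => β t * Θ t) =ᶠ[𝓝 t] Θ := fun t ht => by
      have hmem : t ∈ Metric.ball (0 : ℝ) β.rIn := by
        rw [mem_ball_zero_iff, Real.norm_of_nonneg ht.1]
        change t < T + 1
        linarith [ht.2]
      filter_upwards [β.eventuallyEq_one_of_mem_ball hmem] with s hs
      rw [hs]; simp
    have hw' := hw (fun t => β t * Θ t) (β.contDiff.mul hΘs) β.hasCompactSupport.mul_right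
      ⟨T', hT', fun t ht => by rw [hΘz t ht, mul_zero]⟩
    have hI : ∀ {t}, t ∈ uIcc 0 T → t ∈ Icc 0 T := fun ht => by rwa [uIcc_of_le hT.le] at ht
    have e1 : ∫ t in (0 : ℝ)..T, deriv (fun t => β t * Θ t) t * F t
        = - ∫ t in (0 : ℝ)..T, χ t * F t := by
      rw [← intervalIntegral.integral_neg]
      refine intervalIntegral.integral_congr fun t ht => ?_
      rw [(hβ t (hI ht)).deriv_eq, (hΘd t).deriv, neg_mul]
    have e2 : ∫ t in (0 : ℝ)..T, (β t * Θ t) * G t = ∫ t in (0 : ℝ)..T, Θ t * G t := by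
      refine intervalIntegral.integral_congr fun t ht => ?_
      rw [show β t * Θ t = Θ t from (hβ t (hI ht)).eq_of_nhds]
    have e3 : β 0 * Θ 0 = Θ 0 := (hβ 0 ⟨le_rfl, hT.le⟩).eq_of_nhds
    rw [e1, e2, e3, neg_neg] at hw'
    have hχi : Integrable χ := hχ.continuous.integrable_of_hasCompactSupport hχc
    -- The product rule gives for `P` the identity that the weak equation gives for `F`; the
    -- difference is `∫ χ (F - P) = 0`.
    have hprod := inner_sub_inner_eq_integral (u := P) (u' := G) (v := Θ) (v' := fun t => -χ t) hG
      hχi.neg hPsub (fun s t => by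
        rw [intervalIntegral.integral_neg, ← integral_sub_from hχi T s t, hΘ]; ring) 0 T
    have hP0 : P 0 = c := by simp [hP]
    rw [hΘz T hT'.le, inner_zero_right, hP0, zero_sub] at hprod
    have i1 : IntervalIntegrable (fun t => inner ℝ (G t) (Θ t)) volume 0 T :=
      intervalIntegrable_inner hG hΘs.continuous 0 T
    have i2 : IntervalIntegrable (fun t => inner ℝ (P t) (-χ t)) volume 0 T :=
      (hPc.inner hχ.continuous.neg).intervalIntegrable _ _
    rw [intervalIntegral.integral_add i1 i2] at hprod
    have e4 : ∫ t in (0 : ℝ)..T, inner ℝ (P t) (-χ t) = - ∫ t in (0 : ℝ)..T, χ t * P t := by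
      rw [← intervalIntegral.integral_neg]
      refine intervalIntegral.integral_congr fun t _ => ?_
      simp
    have e5 : ∫ t in (0 : ℝ)..T, inner ℝ (G t) (Θ t) = ∫ t in (0 : ℝ)..T, Θ t * G t :=
      intervalIntegral.integral_congr fun t _ => by simp
    have e6 : inner ℝ c (Θ 0) = Θ 0 * c := by simp
    rw [e4, e5, e6] at hprod
    have e7 : ∫ t, χ t • (F t - P t) = ∫ t in (0 : ℝ)..T, (χ t * F t - χ t * P t) := by
      rw [← intervalIntegral.integral_eq_integral_of_support_subset (a := 0) (b := T)]
      · refine intervalIntegral.integral_congr fun t _ => ?_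
        simp only [smul_eq_mul]; ring
      · intro t ht
        by_contra hne
        refine ht ?_
        simp only
        rw [hχz t fun hmem => hne (Ioo_subset_Ioc_self hmem), zero_smul]
    have i3 : Continuous fun t => χ t * F t := hχ.continuous.mul hF
    have i4 : Continuous fun t => χ t * P t := hχ.continuous.mul hPc
    rw [e7, intervalIntegral.integral_sub (i3.intervalIntegrable _ _) (i4.intervalIntegrable _ _)]
    linarith
  refine Measure.eqOn_Icc_of_ae_eq volume hT.ne ?_ hF.continuousOn hPc.continuousOn
  rw [EventuallyEq, ← restrict_Ioo_eq_restrict_Icc, ae_restrict_iff' measurableSet_Ioo]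
  filter_upwards [hzero] with t ht hmem
  linarith [ht hmem]

/-- A continuous weak solution, extended by constants, solves the integrated equation. -/
lemma solvesFrom_of_weakForm (hT : 0 < T) (h : RegularDrift m T a k b) {g σ : ℝ → L2 d} {r : L2 d}
    (hg : Integrable g) (hg0 : ∀ t, t ∉ Icc 0 T → g t = 0) (hσ : Continuous σ) {B : ℝ}
    (hB : ∀ t, ‖σ t‖ ≤ B) (hσ0 : ∀ t, t ≤ 0 → σ t = σ 0) (hσT : ∀ t, T ≤ t → σ t = σ T)
    (hw : WeakForm T a g r σ) : σ 0 = r ∧ SolvesFrom a g 0 σ := by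
  -- Test with products `θ t * ψ x`, for which the weak equation becomes scalar in time.
  have key : ∀ ψ : Rd d → ℝ, ContDiff ℝ ∞ ψ → HasCompactSupport ψ →
      EqOn (fun t => inner ℝ (σ t) (toL2 ψ)) (fun t => inner ℝ r (toL2 ψ) + ∫ τ in 0..t,
        (inner ℝ (g τ) (toL2 ψ) + inner ℝ (σ τ) (toL2 (transport (a τ) ψ)))) (Icc 0 T) := by
    intro ψ hψ hψc
    have hψL := memLp_of_compact hψ.continuous hψc
    have i1 : Integrable fun τ => inner ℝ (g τ) (toL2 ψ) := hg.inner_const _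
    have i2 := integrable_inner_of_bounded hB hσ.aestronglyMeasurable
      (h.integrable_transport hψ hψc)
    refine eqOn_primitive_of_weak hT (hσ.inner continuous_const) (i1.add i2)
      fun θ hθ hθc ⟨T', hT', hθT⟩ => ?_
    set φ : ℝ × Rd d → ℝ := fun p => θ p.1 * ψ p.2 with hφ
    have hφs : ContDiff ℝ ∞ φ := (hθ.comp contDiff_fst).mul (hψ.comp contDiff_snd)
    have hφc : HasCompactSupport φ := by
      refine HasCompactSupport.intro (hθc.isCompact.prod hψc.isCompact) fun p hp => ?_
      by_cases h1 : p.1 ∈ tsupport θ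
      · have h2 : p.2 ∉ tsupport ψ := fun h2 => hp ⟨h1, h2⟩
        simp [hφ, image_eq_zero_of_notMem_tsupport h2]
      · simp [hφ, image_eq_zero_of_notMem_tsupport h1]
    have hφT : tsupport φ ⊆ {p | p.1 < T} := by
      have h1 : tsupport φ ⊆ {p | p.1 ≤ T'} := by
        refine closure_minimal (fun p hp => ?_) (isClosed_le continuous_fst continuous_const)
        by_contra hlt
        exact hp (by simp [hφ, hθT p.1 (not_le.1 hlt).le])
      exact fun p hp => (h1 hp).trans_lt hT'
    have s1 : ∀ t, toL2 (slice φ t) = θ t • toL2 ψ := fun t => by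
      rw [toL2_smul _ hψL]; rfl
    have s2 : ∀ t, toL2 (slice (timeD φ) t) = deriv θ t • toL2 ψ := fun t => by
      rw [toL2_smul _ hψL]
      congr 1
      ext x
      refine (hasDerivAt_time hφs t x).unique ?_
      exact (hθ.differentiable (by simp) t).hasDerivAt.mul_const (ψ x)
    have s3 : ∀ t, toL2 (transport (a t) (slice φ t)) = θ t • toL2 (transport (a t) ψ) := by
      intro t
      rw [toL2_smul _ (memLp_transport (h.continuous t) hψ hψc)]
      congr 1
      ext x
      have : fderiv ℝ (slice φ t) x = θ t • fderiv ℝ ψ x :=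
        fderiv_const_mul (hψ.differentiable (by simp) x) (θ t)
      rw [transport, this]
      rfl
    have hwφ := hw φ ⟨hφs, hφc, hφT⟩
    simp_rw [s1, s2, s3, real_inner_smul_right] at hwφ
    have j1 : IntervalIntegrable (fun t => θ t * inner ℝ (g t) (toL2 ψ)) volume 0 T :=
      i1.intervalIntegrable.continuousOn_mul hθ.continuous.continuousOn
    have j2 : IntervalIntegrable (fun t => θ t * inner ℝ (σ t) (toL2 (transport (a t) ψ)))
        volume 0 T := i2.intervalIntegrable.continuousOn_mul hθ.continuous.continuousOn
    simp only [mul_add]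
    rw [intervalIntegral.integral_add j1 j2]
    linarith
  have h0 : σ 0 = r := by
    refine L2_ext_test fun ψ hψ hψc => ?_
    have := key ψ hψ hψc ⟨le_rfl, hT.le⟩
    simpa using this
  refine ⟨h0, fun ψ hψ hψc t => ?_⟩
  rw [h0]
  have i1 : Integrable fun τ => inner ℝ (g τ) (toL2 ψ) := hg.inner_const _
  have i2 := integrable_inner_of_bounded hB hσ.aestronglyMeasurable (h.integrable_transport hψ hψc)
  set G : ℝ → ℝ := fun τ =>
    inner ℝ (g τ) (toL2 ψ) + inner ℝ (σ τ) (toL2 (transport (a τ) ψ)) with hG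
  have hGi : Integrable G := i1.add i2
  -- Source and drift vanish off `[0, T]`, so the extension by constants solves the equation at all
  -- times.
  have hGz : ∀ τ, τ ∉ Icc 0 T → G τ = 0 := fun τ hτ => by
    have : transport (a τ) ψ = fun _ => 0 := by
      ext x; simp [transport, h.eq_zero τ hτ]
    simp [hG, hg0 τ hτ, this, toL2_zero]
  rcases le_total t 0 with ht | ht
  · have hint : ∫ τ in 0..t, G τ = 0 := by
      rw [intervalIntegral.integral_symm, neg_eq_zero, intervalIntegral.integral_of_le ht,
        integral_Ioc_eq_integral_Ioo]
      refine setIntegral_eq_zero_of_forall_eq_zero fun τ hτ => hGz τ fun hm => ?_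
      linarith [hτ.2, hm.1]
    rw [hint, hσ0 t ht, h0, add_zero]
  · rcases le_total t T with htT | htT
    · exact key ψ hψ hψc ⟨ht, htT⟩
    · have hint : ∫ τ in T..t, G τ = 0 := by
        rw [intervalIntegral.integral_of_le htT]
        refine setIntegral_eq_zero_of_forall_eq_zero fun τ hτ => hGz τ fun hm => ?_
        linarith [hτ.1, hm.2]
      rw [hσT t htT, ← intervalIntegral.integral_add_adjacent_intervals
        (hGi.intervalIntegrable (a := 0) (b := T)) hGi.intervalIntegrable, hint, add_zero]
      exact key ψ hψ hψc ⟨hT.le, le_rfl⟩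

end Converse

/-! ### Conclusion in the original norms. -/

section WellPosedness

variable {d m : ℕ} {T : ℝ} {a : ℝ → Rd d → Rd d} {k b : ℝ → ℝ}

/-- The `L¹` source terms, as functions on the line. -/
lemma integrable_indicator_ofHm {g : ℝ → Hm d m} (hg : IntegrableOn g (Icc 0 T)) :
    Integrable ((Icc 0 T).indicator fun t => ofHm (g t)) := by
  have h1 : AEStronglyMeasurable (fun t => ofHm (g t)) (volume.restrict (Icc 0 T)) :=
    (ContinuousLinearMap.continuous ofHm).comp_aestronglyMeasurable hg.1
  have h2 : Integrable (fun t => ofHm (g t)) (volume.restrict (Icc 0 T)) :=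
    Integrable.mono' hg.norm h1 (Eventually.of_forall fun t => norm_ofHm_le (g t))
  exact (integrable_indicator_iff (ε' := HS d m) measurableSet_Icc).2 h2

/-- Two continuous weak solutions coincide. -/
lemma eqOn_of_isWeakSolution (hT : 0 < T) {a' : ℝ → Rd d → Rd d} (h : RegularDrift m T a' k b)
    (hae : ∀ᵐ t ∂(volume.restrict (Icc 0 T)), a' t = a t) {g : ℝ → Hm d m}
    (hg : IntegrableOn g (Icc 0 T)) {ρ₀ : Hm d m} {σ ρ : ℝ → Hm d m}
    (hσ : ContinuousOn σ (Icc 0 T)) (hσw : IsWeakSolution T a g ρ₀ σ)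
    (hρ : ContinuousOn ρ (Icc 0 T)) (hρw : IsWeakSolution T a g ρ₀ ρ) : EqOn σ ρ (Icc 0 T) := by
  set g' : ℝ → L2 d := (Icc 0 T).indicator fun t => incl d m (ofHm (g t)) with hg'
  have hg'i : Integrable g' := by
    have e : g' = fun t => incl d m ((Icc 0 T).indicator (fun t => ofHm (g t)) t) := by
      ext1 t
      by_cases ht : t ∈ Icc 0 T
      · rw [hg', indicator_of_mem ht, indicator_of_mem ht]
      · rw [hg', indicator_of_notMem ht, indicator_of_notMem ht, map_zero]
    rw [e]
    exact (incl d m).integrable_comp (integrable_indicator_ofHm hg)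
  have hg'0 : ∀ t, t ∉ Icc 0 T → g' t = 0 := fun t ht => indicator_of_notMem ht _
  -- Curves known only on `[0, T]` are extended by their end values, since the uniqueness theorem
  -- concerns bounded curves on the whole line.
  set E : (ℝ → Hm d m) → ℝ → L2 d :=
    fun σ t => incl d m (ofHm (IccExtend hT.le (fun s : Icc 0 T => σ s) t)) with hE
  have hEI : ∀ σ : ℝ → Hm d m, ∀ t ∈ Icc 0 T, E σ t = (σ t).toL2 := fun σ t ht => by
    simp only [hE]
    rw [IccExtend_of_mem hT.le _ ht, incl_ofHm]
  have hEc : ∀ {σ : ℝ → Hm d m}, ContinuousOn σ (Icc 0 T) → Continuous (E σ) := fun hσ =>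
    (incl d m ∘L ofHm).continuous.comp (continuousOn_iff_continuous_domRestrict.1 hσ).Icc_extend'
  have hEb : ∀ {σ : ℝ → Hm d m}, ContinuousOn σ (Icc 0 T) → ∃ B : ℝ, ∀ t, ‖E σ t‖ ≤ B := by
    intro σ hσ
    obtain ⟨B, hB⟩ := isCompact_Icc.exists_bound_of_continuousOn hσ
    refine ⟨B, fun t => (norm_comp_le _ _).trans ((norm_ofHm_le _).trans ?_)⟩
    exact hB _ (projIcc 0 T hT.le t).2
  have hEs : ∀ {σ : ℝ → Hm d m}, ContinuousOn σ (Icc 0 T) → IsWeakSolution T a g ρ₀ σ →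
      E σ 0 = ρ₀.toL2 ∧ SolvesFrom a' g' 0 (E σ) := by
    intro σ hσ hw
    obtain ⟨B, hB⟩ := hEb hσ
    refine solvesFrom_of_weakForm hT h hg'i hg'0 (hEc hσ) hB (fun t ht => ?_) (fun t ht => ?_)
      ((isWeakSolution_iff hT.le h hae (fun t ht => ?_) (hEI σ)).1 hw)
    · simp only [hE]
      rw [IccExtend_of_le_left hT.le _ ht, IccExtend_of_le_left hT.le _ le_rfl]
    · simp only [hE]
      rw [IccExtend_of_right_le hT.le _ ht, IccExtend_of_right_le hT.le _ le_rfl]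
    · rw [hg', indicator_of_mem ht, incl_ofHm]
  obtain ⟨B, hB⟩ := hEb hσ
  obtain ⟨B', hB'⟩ := hEb hρ
  obtain ⟨hσ0, hσs⟩ := hEs hσ hσw
  obtain ⟨hρ0, hρs⟩ := hEs hρ hρw
  have hσm := (hEc hσ).aestronglyMeasurable (μ := volume)
  have hρm := (hEc hρ).aestronglyMeasurable (μ := volume)
  intro t ht
  have hz := eq_zero_of_solvesFrom h (fun t => (norm_sub_le _ _).trans (add_le_add (hB t) (hB' t)))
    (hσm.sub hρm) (by rw [hσ0, hρ0, sub_self]) (hσs.sub h hg'i hρs hB hσm hB' hρm) t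
  rw [sub_eq_zero, hEI σ t ht, hEI ρ t ht, ← incl_ofHm, ← incl_ofHm] at hz
  exact congrArg toHm (incl_injective hz)

/-- Existence, uniqueness and the a priori estimate for the Liouville problem in `H^m`. -/
theorem wellPosed (d m : ℕ) : ∃ C : ℝ, 0 < C ∧ ∀ T : ℝ, 0 < T → ∀ a : ℝ → Rd d → Rd d,
    DriftHyp T m a → ∀ (ρ₀ : Hm d m) (g : ℝ → Hm d m), IntegrableOn g (Icc 0 T) →
    ∃ ρ : ℝ → Hm d m, ContinuousOn ρ (Icc 0 T) ∧ IsWeakSolution T a g ρ₀ ρ ∧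
      (∀ σ : ℝ → Hm d m, ContinuousOn σ (Icc 0 T) → IsWeakSolution T a g ρ₀ σ →
        EqOn σ ρ (Icc 0 T)) ∧
      ∀ t ∈ Icc 0 T, ‖ρ t‖ ≤ C * (‖ρ₀‖ + ∫ τ in (0 : ℝ)..t, ‖g τ‖) *
        Real.exp (C * ∫ τ in (0 : ℝ)..t, cbNorm m (jac (a τ))) := by
  obtain ⟨K, hK, hex⟩ := exists_continuous_evolution d m
  set N : ℝ := (Fintype.card (MultiIndex d m) : ℝ) with hN
  have hN0 : 0 ≤ N := Nat.cast_nonneg _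
  set L : ℝ := 2 * K * (d + 1) ^ m with hL
  have hL0 : 0 ≤ L := by positivity
  -- `N` converts the Hilbert norm to the `ℓ¹` norm and `2` comes from the energy estimate. `L` is
  -- the rate in the exponential, and `1` ensures positivity; their sum serves in both places.
  refine ⟨2 * N + L + 1, by positivity, fun T hT a ha ρ₀ g hg => ?_⟩
  obtain ⟨a', k, b, h, hae, hk⟩ := ha.exists_regularDrift
  set g' : ℝ → HS d m := (Icc 0 T).indicator fun t => ofHm (g t) with hg'
  have hg'i : Integrable g' := integrable_indicator_ofHm hg
  obtain ⟨ρ, hρc, hρ0, ⟨B, hB⟩, hρb, -, hρΦ⟩ := hex h hg'i (ofHm ρ₀)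
  have hw : IsWeakSolution T a g ρ₀ fun t => toHm (ρ t) := by
    refine (isWeakSolution_iff hT.le h hae (g' := fun t => incl d m (g' t))
      (σ' := fun t => incl d m (ρ t)) (fun t ht => ?_) fun t ht => rfl).2
      (weakForm_of_integrated h ((incl d m).integrable_comp hg'i)
        ((incl d m).continuous.comp hρc) (fun t => (norm_comp_le _ _).trans (hB t)) hρΦ)
    simp only [hg']
    rw [indicator_of_mem ht, incl_ofHm]
  have hc : ContinuousOn (fun t => toHm (ρ t)) (Icc 0 T) :=
    (toHm.continuous.comp hρc).continuousOn
  refine ⟨fun t => toHm (ρ t), hc, hw,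
    fun σ hσ hσw => eqOn_of_isWeakSolution hT h hae hg hσ hσw hc hw, fun t ht => ?_⟩
  have hsub : uIcc 0 t ⊆ Icc 0 T := by
    rw [uIcc_of_le ht.1]; exact Icc_subset_Icc_right ht.2
  have hgn : IntervalIntegrable (fun τ => ‖g τ‖) volume 0 t :=
    IntegrableOn.intervalIntegrable (hg.mono_set hsub).norm
  have hcb : IntervalIntegrable (fun τ => cbNorm m (jac (a τ))) volume 0 t :=
    (IntegrableOn.mono_set ha.2.2.2 hsub).intervalIntegrable
  have h1 : |∫ τ in 0..t, ‖g' τ‖| ≤ ∫ τ in 0..t, ‖g τ‖ := by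
    rw [abs_of_nonneg (intervalIntegral.integral_nonneg ht.1 fun _ _ => norm_nonneg _)]
    refine intervalIntegral.integral_mono_on ht.1 hg'i.norm.intervalIntegrable hgn fun τ hτ => ?_
    have hτT : τ ∈ Icc 0 T := ⟨hτ.1, hτ.2.trans ht.2⟩
    simp only [hg']
    rw [indicator_of_mem hτT]
    exact norm_ofHm_le _
  have h2 : 2 * |∫ τ in 0..t, K * k τ| ≤ L * ∫ τ in 0..t, cbNorm m (jac (a τ)) := by
    rw [abs_of_nonneg (intervalIntegral.integral_nonneg ht.1
      fun τ _ => mul_nonneg hK (h.k_nonneg τ)), intervalIntegral.integral_const_mul]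
    have h3 : ∫ τ in 0..t, k τ ≤ ∫ τ in 0..t, (d + 1) ^ m * cbNorm m (jac (a τ)) :=
      intervalIntegral.integral_mono_on ht.1 h.integrable_k.intervalIntegrable
        (hcb.const_mul _) fun τ _ => hk τ
    rw [intervalIntegral.integral_const_mul] at h3
    calc 2 * (K * ∫ τ in 0..t, k τ)
        ≤ 2 * (K * ((d + 1) ^ m * ∫ τ in 0..t, cbNorm m (jac (a τ)))) := by gcongr
      _ = _ := by rw [hL]; ring
  have hI1 : 0 ≤ ∫ τ in 0..t, ‖g τ‖ :=
    intervalIntegral.integral_nonneg ht.1 fun _ _ => norm_nonneg _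
  have hI2 : 0 ≤ ∫ τ in 0..t, cbNorm m (jac (a τ)) :=
    intervalIntegral.integral_nonneg ht.1 fun _ _ => cbNorm_nonneg _ _
  have h4 : ‖ρ t‖ ≤ 2 * (‖ρ₀‖ + ∫ τ in 0..t, ‖g τ‖)
      * Real.exp ((2 * N + L + 1) * ∫ τ in 0..t, cbNorm m (jac (a τ))) := by
    refine (hρb t).trans (mul_le_mul ?_ (Real.exp_le_exp.2 (h2.trans ?_)) (Real.exp_nonneg _)
      (by positivity))
    · linarith [norm_ofHm_le ρ₀, norm_nonneg ρ₀]
    · exact mul_le_mul_of_nonneg_right (by linarith) hI2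
  calc ‖toHm (ρ t)‖ ≤ N * ‖ρ t‖ := norm_toHm_le _
    _ ≤ N * (2 * (‖ρ₀‖ + ∫ τ in 0..t, ‖g τ‖)
      * Real.exp ((2 * N + L + 1) * ∫ τ in 0..t, cbNorm m (jac (a τ)))) :=
        mul_le_mul_of_nonneg_left h4 hN0
    _ = (2 * N) * (‖ρ₀‖ + ∫ τ in 0..t, ‖g τ‖)
      * Real.exp ((2 * N + L + 1) * ∫ τ in 0..t, cbNorm m (jac (a τ))) := by ring
    _ ≤ _ := by
      gcongr
      linarith

end WellPosedness

end Liouville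

end

theorem mainTheorem2 (d m : ℕ) :
    ∃ C : ℝ, 0 < C ∧
      ∀ (T : ℝ), 0 < T →
      ∀ (a : ℝ → Liouville.Rd d → Liouville.Rd d), Liouville.DriftHyp T m a →
      ∀ (ρ₀ : Liouville.Hm d m) (g : ℝ → Liouville.Hm d m), IntegrableOn g (Icc 0 T) →
      ∃ ρ : ℝ → Liouville.Hm d m,
        ContinuousOn ρ (Icc 0 T) ∧ Liouville.IsWeakSolution T a g ρ₀ ρ ∧
        (∀ σ : ℝ → Liouville.Hm d m,
          ContinuousOn σ (Icc 0 T) → Liouville.IsWeakSolution T a g ρ₀ σ →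
            EqOn σ ρ (Icc 0 T)) ∧
        ∀ t ∈ Icc 0 T,
          ‖ρ t‖ ≤ C * (‖ρ₀‖ + ∫ τ in (0 : ℝ)..t, ‖g τ‖) *
            Real.exp (C * ∫ τ in (0 : ℝ)..t, Liouville.cbNorm m (Liouville.jac (a τ))) := by
  exact Liouville.wellPosed d m
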